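/- **Online auctions with unlimited supply: setting.** An unlimited number of copies of an item is for sale; the bidders have values in $[0,\infty)$ and arrive one by one. A deterministic online auction decides, when the $k$-th bidder arrives and only on the basis of the bids of the first $k$ bidders, irrevocably whether this bidder is served and at which price in $[0,\infty)$ (bidders who are not served pay nothing); the total number $n$ of bidders is not known to it. It is truthful if bidding one's true value always maximizes one's utility (value minus price if served, $0$ otherwise), whatever the others bid, and a truthful bidder never has negative utility. A (randomized, universally truthful) online auction $A$ is a probability distribution over deterministic truthful online auctions. For $b\in[0,\infty)^n$ let $\mathbb E[A(b)]$ be its expected total payment when the $n$ bidders with bids $b_1,\dots,b_n$ arrive in uniformly random order, independent of the internal randomness of $A$. Let $$\mathrm{maxV}(b)=\max_{1\le k<n} k\cdot b_{(k+1)},\qquad b_{(1)}\ge b_{(2)}\ge\dots\ge b_{(n)},$$ (with $\mathrm{maxV}(b)=0$ for $n\le 1$). The auction $A$ has competitive ratio $\beta>0$ against $\mathrm{maxV}$ if $\mathbb E[A(b)]\ge \mathrm{maxV}(b)/\beta$ for all $n$ and all $b\in[0,\infty)^n$. The *optimal competitive ratio* is the infimum of all $\beta>0$ for which there is an online auction with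 competitive ratio $\beta$ against $\mathrm{maxV}$. **Corollary.** The sequence $$\lambda_\ell = 1-\sum_{i=2}^{\ell}\frac{i}{i-1}\binom{\ell-1}{i-1}\left(\frac{-1}{\ell}\right)^{i-1}$$ converges to a limit $\lambda=2.42\ldots$, that is, $2.42\le\lambda<2.43$. The optimal competitive ratio of random-order online auctions against $\mathrm{maxV}$ lies between $2$ and $\lambda$ (in particular, online auctions with a finite competitive ratio against $\mathrm{maxV}$ exist). -/

import Mathlib

open MeasureTheory Filter Topology
open scoped NNReal

/-- The decision about one bidder: the bidder is rejected (and pays nothing), or is served at a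
given price. -/
inductive Decision : Type
  | reject : Decision
  | serve (price : ℝ≥0) : Decision

/-- The payment collected by a decision. -/
def Decision.payment : Decision → ℝ≥0
  | .reject => 0
  | .serve p => p

/-- The quasi-linear utility that a bidder with value `v` derives from a decision. -/
def Decision.utility (v : ℝ≥0) : Decision → ℝ
  | .reject => 0
  | .serve p => (v : ℝ) - (p : ℝ)

/-- A deterministic truthful online auction with unlimited supply and an unknown number of bidders.
When the bidder number `k` (counted from `0`) arrives and bids `z`, and the earlier bidders bid
`h 0, …, h (k-1)`, the irrevocable decision `decision k h z` is taken. -/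
structure DetOnlineAuction where
  /-- whether the arriving bidder is served, and at what price -/
  decision : (k : ℕ) → (Fin k → ℝ≥0) → ℝ≥0 → Decision
  /-- bidding the true value `v` is a dominant strategy -/
  truthful : ∀ (k : ℕ) (h : Fin k → ℝ≥0) (v z : ℝ≥0),
    (decision k h z).utility v ≤ (decision k h v).utility v
  /-- voluntary participation: a truthful bidder never has negative utility -/
  individuallyRational : ∀ (k : ℕ) (h : Fin k → ℝ≥0) (v : ℝ≥0),
    0 ≤ (decision k h v).utility v

/-- The revenue of a deterministic online auction when `n` bidders arrive in the order
`0, 1, …, n - 1` with bids `b`. -/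
def DetOnlineAuction.revenue (M : DetOnlineAuction) {n : ℕ} (b : Fin n → ℝ≥0) : ℝ≥0 :=
  ∑ k : Fin n,
    (M.decision k.val (fun j : Fin k.val => b (Fin.castLE k.isLt.le j)) (b k)).payment

/-- A randomized (universally truthful) online auction: a probability distribution over
deterministic truthful online auctions. -/
structure OnlineAuction where
  /-- the sample space of the internal randomness -/
  Ω : Type
  [measurableSpace : MeasurableSpace Ω]
  /-- the law of the internal randomness -/
  P : Measure Ω
  [isProbabilityMeasure : IsProbabilityMeasure P]
  /-- the deterministic auction that is run for each outcome of the internal randomness -/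
  det : Ω → DetOnlineAuction
  /-- every payment is a random variable -/
  measurable_payment : ∀ (k : ℕ) (h : Fin k → ℝ≥0) (z : ℝ≥0),
    Measurable fun ω => ((det ω).decision k h z).payment

attribute [instance] OnlineAuction.measurableSpace OnlineAuction.isProbabilityMeasure

/-- The expected revenue on the bids `b` when the `n` bidders arrive in uniformly random order
(independent of the internal randomness); `σ k` is the bidder who arrives at time `k`.
The integrand is measurable and takes values in `[0, ∑ i, b i]`, hence it is integrable. -/
noncomputable def OnlineAuction.expectedRevenue (A : OnlineAuction) {n : ℕ}
    (b : Fin n → ℝ≥0) : ℝ :=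
  (∑ σ : Equiv.Perm (Fin n), ∫ ω, (((A.det ω).revenue (fun k => b (σ k)) : ℝ≥0) : ℝ) ∂A.P)
    / (Nat.factorial n : ℝ)

/-- The bids in non-increasing order: `sortedBids b i` is the `(i + 1)`-st highest bid. -/
noncomputable def sortedBids {n : ℕ} (b : Fin n → ℝ≥0) (i : Fin n) : ℝ≥0 :=
  b (Tuple.sort (fun j => OrderDual.toDual (b j)) i)

/-- The maximum Vickrey revenue `max_{1 ≤ k < n} k * b_(k+1)`, which is `0` for `n ≤ 1`. -/
noncomputable def maxV {n : ℕ} (b : Fin n → ℝ≥0) : ℝ≥0 :=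
  (Finset.univ.filter fun k : Fin n => 1 ≤ k.val).sup
    fun k => (k.val : ℝ≥0) * sortedBids b k

/-- The auction `A` has competitive ratio `β` against `maxV`, for random arrival order:
its expected revenue is at least `maxV b / β` for all numbers of bidders and all bids. -/
def OnlineAuction.IsCompetitive (A : OnlineAuction) (β : ℝ) : Prop :=
  0 < β ∧ ∀ (n : ℕ) (b : Fin n → ℝ≥0), ((maxV b : ℝ≥0) : ℝ) / β ≤ A.expectedRevenue b

/-- The optimal competitive ratio of random-order online auctions against `maxV`.
The infimum would be `0` if there were no competitive auction at all, so a positive lower bound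
on it contains the existence of one. -/
noncomputable def optimalOnlineRatio : ℝ :=
  sInf {β : ℝ | ∃ A : OnlineAuction, A.IsCompetitive β}

/-- The numbers
`1 - ∑_{i=2}^ℓ (i / (i - 1)) * choose (ℓ - 1) (i - 1) * (-1 / ℓ) ^ (i - 1)`. -/
noncomputable def offlineRatio (l : ℕ) : ℝ :=
  1 - ∑ i ∈ Finset.Icc 2 l,
    ((i : ℝ) / ((i : ℝ) - 1)) * (Nat.choose (l - 1) (i - 1) : ℝ) * (-1 / (l : ℝ)) ^ (i - 1)

/-!
The limit of the offline ratios is `1 + limitExcess`, where `limitExcess` is the integral over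
`[0, 1]` of `(1 - (1 - t) * exp (-t)) / t`. Expanding the integrand into a power series identifies
the limit (`tendsto_offlineRatio`, by dominated convergence), and the partial sums of the resulting
alternating series enclose it (`limitExcess_bounds`).

*Upper bound.* The benchmark `twoBuyer` is the largest revenue `k * t` of a single price `t` that
`k ≥ 2` bidders accept. In random order, an auction which in each round extracts from a uniformly
random one of the `k + 1` bidders so far a `1 / (k + 1)`-fraction of `twoBuyer / β` is
`β`-competitive against `maxV`: only the first one of the bidders with bids of at least the
`(m + 1)`-st highest bid is lost (`le_sum_perm_revenue`). Such an auction offers the last bidder a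
random price that depends on the other bids. For bids on a finite grid of powers of `r`, a
monotone function of a bidder's own bid is the expected payment for some random price exactly if
its expectation is at most `1` when the own bid follows the equal-revenue law, which exceeds `x`
with probability about `1 / x` (`exists_priceLaw` for one direction). So the benchmark has to be
split into monotone charges `ρ i` with `E[ρ i | other bids] ≤ β` (`exists_grid_charges`).

The splitting exists (`exists_charges`) if `E[f * l] ≤ β' * ∑ i, E[l (update b i ⊤)]` for all
monotone `l ≥ 0`, where `f` is the benchmark, the bids are independent with the equal-revenue law,
and `β' < β`. It has the form `ρ i = waterLevel / w i` with weights `w i ≥ 1` that depend on the other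
bids only, and the weights are the limit of an increasing iteration which does not decrease the
dual objective `scalingPotential`; the inequality bounds this objective and hence the weights, and
because the weights remain monotone, it is needed for monotone `l` only. The inequality itself is
a covariance inequality
(`prodExp_twoBuyer_mul_le`): revealing the bids level by level, lowest possible bid first, the
benchmark reacts to the information that a bid exceeds its current level by at most `β'` times the
next level (`prodExp_twoBuyer_sub_le`). The bound on the reaction follows by exchangeability from
`E[f] ≤ β' * n` for all numbers `n` of bidders.

The expectation `E[f]` is bounded by integrating tail bounds. If `f ≥ z`, then the bidders in the
largest group that supports `z` share the cost `1` equally, where the share of a bidder does not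
depend on the own bid (`prodExp_exists_price_le`); so `P(f ≥ z)` is at most `n / z` times the
probability that the others can support a given bidder (`tailProb_le`). A second use of equal shares
bounds this probability by `1 - (1 - t) * exp (-t)` for `t` near `n / z` (`partnerProb_le`), and
`∫ n / z * (1 - (1 - n / z) * exp (-n / z)) dz` over `z ≥ n` is `n * limitExcess`. The range `z ≤ n`
contributes at most `n` to `E[f]`.

The grid is refined and enlarged by a limit along an ultrafilter (`exists_isCharge`).

*Lower bound.* Two bids that independently follow the equal-revenue law on the values `s * r ^ j`,
`j ≤ J`, have an expected minimum close to `2 * s`. The second bidder pays at most `s` in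
expectation, whatever the auction (`sum_erLaw_payment_le`). The first bidder faces a price law
that does not depend on any bid, and hence pays a negligible fraction of a bid of order `s` as `s`
tends to infinity (`tendsto_firstPayment_div`).
-/

namespace RandomOrder

open Function

/-! ### Expectations over independent coordinates -/

section ProdExp

variable {ι L : Type*} [Fintype ι] [DecidableEq ι] [Fintype L]

/-- The expectation of `g` when the coordinates are independent and coordinate `i` has the law
with weights `w i`. -/
noncomputable def prodExp (w : ι → L → ℝ) (g : (ι → L) → ℝ) : ℝ :=
  ∑ x, (∏ i, w i (x i)) * g x

theorem prodExp_add (w : ι → L → ℝ) (g g' : (ι → L) → ℝ) :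
    prodExp w (fun b => g b + g' b) = prodExp w g + prodExp w g' := by
  simp [prodExp, mul_add, Finset.sum_add_distrib]

theorem prodExp_sub (w : ι → L → ℝ) (g g' : (ι → L) → ℝ) :
    prodExp w (fun b => g b - g' b) = prodExp w g - prodExp w g' := by
  simp [prodExp, mul_sub, Finset.sum_sub_distrib]

theorem prodExp_const_mul (w : ι → L → ℝ) (a : ℝ) (g : (ι → L) → ℝ) :
    prodExp w (fun b => a * g b) = a * prodExp w g := by
  simp only [prodExp, Finset.mul_sum]
  exact Finset.sum_congr rfl fun x _ => by ring

theorem prodExp_sum {κ : Type*} (s : Finset κ) (w : ι → L → ℝ) (g : κ → (ι → L) → ℝ) :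
    prodExp w (fun b => ∑ k ∈ s, g k b) = ∑ k ∈ s, prodExp w (g k) := by
  simp only [prodExp, Finset.mul_sum]
  exact Finset.sum_comm

theorem prodExp_const {w : ι → L → ℝ} (hw : ∀ i, ∑ y, w i y = 1) (a : ℝ) :
    prodExp w (fun _ => a) = a := by
  classical
  have h := Finset.prod_univ_sum (fun _ : ι => (Finset.univ : Finset L)) w
  simp only [hw, Finset.prod_const_one, Fintype.piFinset_univ] at h
  simp [prodExp, ← Finset.sum_mul, ← h]

/-- Only outcomes of positive probability matter for an inequality between expectations. -/
theorem prodExp_mono_of_support {w : ι → L → ℝ} (hw : ∀ i y, 0 ≤ w i y) {g g' : (ι → L) → ℝ}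
    (h : ∀ b, (∀ i, w i (b i) ≠ 0) → g b ≤ g' b) : prodExp w g ≤ prodExp w g' := by
  refine Finset.sum_le_sum fun b _ => ?_
  by_cases hb : ∀ i, w i (b i) ≠ 0
  · exact mul_le_mul_of_nonneg_left (h b hb) (Finset.prod_nonneg fun i _ => hw i _)
  · push Not at hb
    obtain ⟨i, hi⟩ := hb
    rw [Finset.prod_eq_zero (Finset.mem_univ i) hi]
    simp

theorem prodExp_mono {w : ι → L → ℝ} (hw : ∀ i y, 0 ≤ w i y) {g g' : (ι → L) → ℝ}
    (h : ∀ b, g b ≤ g' b) : prodExp w g ≤ prodExp w g' :=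
  prodExp_mono_of_support hw fun b _ => h b

theorem prodExp_nonneg {w : ι → L → ℝ} (hw : ∀ i y, 0 ≤ w i y) {g : (ι → L) → ℝ}
    (h : ∀ b, 0 ≤ g b) : 0 ≤ prodExp w g :=
  Finset.sum_nonneg fun b _ => mul_nonneg (Finset.prod_nonneg fun i _ => hw i _) (h b)

/-- Fubini's theorem for one coordinate: the law of coordinate `i` may be replaced by `u` if
coordinate `i` is integrated out with respect to `u` first. -/
theorem prodExp_update {w : ι → L → ℝ} {i : ι} (hw : ∑ y, w i y = 1) (u : L → ℝ)
    (g : (ι → L) → ℝ) :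
    prodExp (update w i u) g = prodExp w (fun b => ∑ y, u y * g (update b i y)) := by
  classical
  let e : Equiv.Perm ((ι → L) × L) :=
    { toFun := fun z => (update z.1 i z.2, z.1 i)
      invFun := fun z => (update z.1 i z.2, z.1 i)
      left_inv := fun z => by simp
      right_inv := fun z => by simp }
  have key : ∀ z : (ι → L) × L,
      (∏ k, w k (z.1 k)) * (u z.2 * g (update z.1 i z.2)) =
        (∏ k, (update w i u) k ((e z).1 k)) * g (e z).1 * w i (e z).2 := by
    rintro ⟨b, y⟩
    have he : e (b, y) = (update b i y, b i) := rfl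
    rw [he]
    dsimp only
    rw [Fintype.prod_eq_mul_prod_compl i, Fintype.prod_eq_mul_prod_compl i]
    have : ∏ k ∈ {i}ᶜ, (update w i u) k (update b i y k) = ∏ k ∈ {i}ᶜ, w k (b k) := by
      refine Finset.prod_congr rfl fun k hk => ?_
      have hk' : k ≠ i := by simpa using hk
      simp [hk']
    rw [this]
    simp
    ring
  calc prodExp (update w i u) g
      = ∑ z : (ι → L) × L, (∏ k, (update w i u) k (z.1 k)) * g z.1 * w i z.2 := by
        rw [Fintype.sum_prod_type]
        simp [prodExp, ← Finset.mul_sum, hw]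
    _ = ∑ z : (ι → L) × L, (∏ k, w k (z.1 k)) * (u z.2 * g (update z.1 i z.2)) := by
        rw [← Equiv.sum_comp e]
        exact Finset.sum_congr rfl fun z _ => (key z).symm
    _ = _ := by
        rw [Fintype.sum_prod_type]
        simp [prodExp, Finset.mul_sum]

theorem prodExp_resample {w : ι → L → ℝ} {i : ι} (hw : ∑ y, w i y = 1) (g : (ι → L) → ℝ) :
    prodExp w (fun b => ∑ y, w i y * g (update b i y)) = prodExp w g := by
  rw [← prodExp_update hw, update_eq_self]

/-- The law of a coordinate on which `g` does not depend is irrelevant. -/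
theorem prodExp_update_of_indep {w : ι → L → ℝ} {i : ι} (hw : ∑ y, w i y = 1) {u : L → ℝ}
    (hu : ∑ y, u y = 1) {g : (ι → L) → ℝ} (hg : ∀ b y, g (update b i y) = g b) :
    prodExp (update w i u) g = prodExp w g := by
  simp [prodExp_update hw, hg, ← Finset.sum_mul, hu]

theorem prodExp_congr_of_indep (s : Finset ι) {w w' : ι → L → ℝ} (hw : ∀ i, ∑ y, w i y = 1)
    (hw' : ∀ i, ∑ y, w' i y = 1) (h : ∀ i ∉ s, w i = w' i) {g : (ι → L) → ℝ}
    (hg : ∀ i ∈ s, ∀ b y, g (update b i y) = g b) : prodExp w g = prodExp w' g := by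
  induction s using Finset.induction_on generalizing w with
  | empty =>
    have : w = w' := funext fun i => h i (by simp)
    rw [this]
  | insert a s ha ih =>
    rw [← prodExp_update_of_indep (hw a) (hw' a) (hg a (by simp))]
    refine ih (fun i => ?_) (fun i hi => ?_) (fun i hi => hg i (by simp [hi]))
    · by_cases hia : i = a
      · subst hia; simpa using hw' i
      · simpa [hia] using hw i
    · by_cases hia : i = a
      · subst hia; simp
      · simpa [hia] using h i (by simp [hia, hi])

/-- The product of image measures is the image of the product measure. -/
theorem prodExp_map [DecidableEq L] (φ : L → L) {w w' : ι → L → ℝ}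
    (h : ∀ i x, w i x = ∑ y, if φ y = x then w' i y else 0) (g : (ι → L) → ℝ) :
    prodExp w g = prodExp w' (fun b => g (fun i => φ (b i))) := by
  classical
  have h1 : ∀ x : ι → L, ∏ i, w i (x i) =
      ∑ y : ι → L, if (fun i => φ (y i)) = x then ∏ i, w' i (y i) else 0 := by
    intro x
    simp only [h]
    rw [Finset.prod_univ_sum, Fintype.piFinset_univ]
    refine Finset.sum_congr rfl fun y _ => ?_
    split_ifs with hy
    · exact Finset.prod_congr rfl fun i _ => if_pos (congrFun hy i)
    · obtain ⟨i, hi⟩ := Function.ne_iff.mp hy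
      exact Finset.prod_eq_zero (Finset.mem_univ i) (if_neg hi)
  simp only [prodExp, h1, Finset.sum_mul]
  rw [Finset.sum_comm]
  refine Finset.sum_congr rfl fun y _ => ?_
  simp [ite_mul]

/-- Independent and identically distributed coordinates are exchangeable. -/
theorem prodExp_perm (σ : Equiv.Perm ι) (p : L → ℝ) (g : (ι → L) → ℝ) :
    prodExp (fun _ => p) (fun b => g (b ∘ σ)) = prodExp (fun _ => p) g := by
  unfold prodExp
  refine Fintype.sum_equiv (Equiv.arrowCongr σ.symm (Equiv.refl L)) _ _ fun x => ?_
  have : (Equiv.arrowCongr σ.symm (Equiv.refl L)) x = x ∘ σ := by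
    ext i; simp [Equiv.arrowCongr]
  rw [this]
  congr 1
  exact (Equiv.prod_comp σ (fun i => p (x i))).symm

end ProdExp

/-! ### Attaining a monotone benchmark -/

section Attain

variable {ι L : Type*} [Fintype ι] [DecidableEq ι] [Fintype L]

/-- The water level of a benchmark `f` for the weights `w`: if bidder `i` is charged
`waterLevel f w b / w b i`, the total charge is `f b`. -/
noncomputable def waterLevel (f : (ι → L) → ℝ) (w : (ι → L) → ι → ℝ) (b : ι → L) : ℝ :=
  f b / ∑ i, (w b i)⁻¹

/-- One step of the scaling iteration, which is started from the constant weights `1`: the weight of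
bidder `i` is set to the smallest number that is at least `1` and keeps the expected charge of
bidder `i`, given the other bids, below `c`. -/
noncomputable def scalingStep (p : L → ℝ) (f : (ι → L) → ℝ) (c : ℝ) (w : (ι → L) → ι → ℝ)
    (b : ι → L) (i : ι) : ℝ :=
  max 1 ((∑ y, p y * waterLevel f w (update b i y)) / c)

/-- The properties of weights that the scaling iteration preserves. -/
structure IsScalingWeight [Preorder L] (w : (ι → L) → ι → ℝ) : Prop where
  one_le : ∀ b i, 1 ≤ w b i
  mono : ∀ i, Monotone fun b => w b i
  update_self : ∀ b i y, w (update b i y) i = w b i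
  comp_perm : ∀ (σ : Equiv.Perm ι) b i, w (b ∘ σ) i = w b (σ i)

namespace IsScalingWeight

variable [Preorder L] {w w' : (ι → L) → ι → ℝ}

omit [Fintype ι] in
theorem pos (hw : IsScalingWeight w) (b : ι → L) (i : ι) : 0 < w b i :=
  lt_of_lt_of_le one_pos (hw.one_le b i)

theorem sum_inv_pos [Nonempty ι] (hw : IsScalingWeight w) (b : ι → L) :
    0 < ∑ i, (w b i)⁻¹ :=
  Finset.sum_pos (fun i _ => inv_pos.mpr (hw.pos b i)) Finset.univ_nonempty

end IsScalingWeight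

theorem comp_perm_update {α β : Type*} [DecidableEq α] (σ : Equiv.Perm α) (b : α → β) (i : α)
    (y : β) : update (b ∘ σ) i y = update b (σ i) y ∘ σ := by
  ext k
  by_cases hk : k = i
  · subst hk; simp
  · have : σ k ≠ σ i := fun h => hk (σ.injective h)
    simp [hk, this]

variable {p : L → ℝ} {f : (ι → L) → ℝ} {c : ℝ}

theorem waterLevel_nonneg [Preorder L] {w : (ι → L) → ι → ℝ} (hf : ∀ b, 0 ≤ f b)
    (hw : IsScalingWeight w) (b : ι → L) : 0 ≤ waterLevel f w b :=
  div_nonneg (hf b) (Finset.sum_nonneg fun i _ => (inv_pos.mpr (hw.pos b i)).le)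

theorem waterLevel_le_waterLevel [Preorder L] [Nonempty ι] {w w' : (ι → L) → ι → ℝ}
    (hf : ∀ b, 0 ≤ f b) (hfm : Monotone f) (hw : IsScalingWeight w) (hw' : IsScalingWeight w')
    (hww : ∀ b i, w b i ≤ w' b i) {b b' : ι → L} (hb : b ≤ b') :
    waterLevel f w b ≤ waterLevel f w' b' :=
  div_le_div₀ (hf b') (hfm hb) (hw'.sum_inv_pos b') <| Finset.sum_le_sum fun i _ =>
    inv_anti₀ (hw.pos b i) ((hw.mono i hb).trans (hww b' i))

omit [Fintype L] in
theorem waterLevel_comp_perm [Preorder L] {w : (ι → L) → ι → ℝ}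
    (hfs : ∀ (σ : Equiv.Perm ι) b, f (b ∘ σ) = f b) (hw : IsScalingWeight w)
    (σ : Equiv.Perm ι) (b : ι → L) : waterLevel f w (b ∘ σ) = waterLevel f w b := by
  simp only [waterLevel, hfs, hw.comp_perm]
  rw [Equiv.sum_comp σ (fun i => (w b i)⁻¹)]

theorem isScalingWeight_scalingStep [Preorder L] [Nonempty ι] {w : (ι → L) → ι → ℝ}
    (hp : ∀ y, 0 ≤ p y) (hf : ∀ b, 0 ≤ f b) (hfm : Monotone f)
    (hfs : ∀ (σ : Equiv.Perm ι) b, f (b ∘ σ) = f b) (hc : 0 < c) (hw : IsScalingWeight w) :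
    IsScalingWeight (scalingStep p f c w) where
  one_le b i := le_max_left _ _
  mono i b b' h := max_le_max le_rfl <| by
    gcongr with y
    · exact hp y
    · exact waterLevel_le_waterLevel hf hfm hw hw (fun _ _ => le_rfl) 
        (update_le_update_iff.mpr ⟨le_rfl, fun k _ => h k⟩)
  update_self b i y := by simp [scalingStep]
  comp_perm σ b i := by
    simp only [scalingStep, comp_perm_update, waterLevel_comp_perm hfs hw]

theorem scalingStep_le_scalingStep [Preorder L] [Nonempty ι] {w w' : (ι → L) → ι → ℝ}
    (hp : ∀ y, 0 ≤ p y) (hf : ∀ b, 0 ≤ f b) (hfm : Monotone f) (hc : 0 < c)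
    (hw : IsScalingWeight w) (hw' : IsScalingWeight w') (hww : ∀ b i, w b i ≤ w' b i)
    (b : ι → L) (i : ι) : scalingStep p f c w b i ≤ scalingStep p f c w' b i := by
  refine max_le_max le_rfl ?_
  gcongr with y
  · exact hp y
  · exact waterLevel_le_waterLevel hf hfm hw hw' hww le_rfl

/-- The dual objective of the entropy minimization problem behind the scaling iteration. It is
concave in the logarithms of the weights. -/
noncomputable def scalingPotential (p : L → ℝ) (f : (ι → L) → ℝ) (c : ℝ)
    (w : (ι → L) → ι → ℝ) : ℝ :=
  prodExp (fun _ => p) (fun b => f b * -Real.log (∑ i, (w b i)⁻¹)) -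
    c * ∑ i, prodExp (fun _ => p) (fun b => Real.log (w b i))

omit [DecidableEq ι] in
/-- Jensen's inequality for the logarithm of a sum of reciprocals. -/
theorem sum_mul_log_le_log_sum_inv [Nonempty ι] {u u' : ι → ℝ} (hu : ∀ i, 0 < u i)
    (hu' : ∀ i, 0 < u' i) :
    ∑ i, (u' i)⁻¹ / (∑ k, (u' k)⁻¹) * (Real.log (u' i) - Real.log (u i)) ≤
      Real.log (∑ i, (u i)⁻¹) - Real.log (∑ i, (u' i)⁻¹) := by
  have hS : 0 < ∑ k, (u k)⁻¹ := Finset.sum_pos (fun i _ => inv_pos.mpr (hu i)) Finset.univ_nonempty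
  have hS' : 0 < ∑ k, (u' k)⁻¹ :=
    Finset.sum_pos (fun i _ => inv_pos.mpr (hu' i)) Finset.univ_nonempty
  have h := (strictConcaveOn_log_Ioi.concaveOn).le_map_sum (t := Finset.univ)
    (w := fun i => (u' i)⁻¹ / ∑ k, (u' k)⁻¹) (p := fun i => u' i / u i)
    (fun i _ => div_nonneg (inv_pos.mpr (hu' i)).le hS'.le)
    (by rw [← Finset.sum_div, div_self hS'.ne'])
    (fun i _ => div_pos (hu' i) (hu i))
  simp only [smul_eq_mul] at h
  have e1 : ∑ i, (u' i)⁻¹ / (∑ k, (u' k)⁻¹) * (u' i / u i) = (∑ i, (u i)⁻¹) / ∑ i, (u' i)⁻¹ := by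
    rw [Finset.sum_div]
    refine Finset.sum_congr rfl fun i _ => ?_
    have := (hu i).ne'
    have := (hu' i).ne'
    field_simp
  rw [e1, Real.log_div hS.ne' hS'.ne'] at h
  refine le_trans (le_of_eq (Finset.sum_congr rfl fun i _ => ?_)) h
  rw [Real.log_div (hu' i).ne' (hu i).ne']

/-- The dual objective does not decrease in a step of the scaling iteration that increases the
weights. -/
theorem scalingPotential_le_scalingStep [Preorder L] [Nonempty ι] {w : (ι → L) → ι → ℝ}
    (hp : ∀ y, 0 ≤ p y) (hp1 : ∑ y, p y = 1) (hf : ∀ b, 0 ≤ f b) (hfm : Monotone f)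
    (hfs : ∀ (σ : Equiv.Perm ι) b, f (b ∘ σ) = f b) (hc : 0 < c)
    (hw : IsScalingWeight w) (hww : ∀ b i, w b i ≤ scalingStep p f c w b i) :
    scalingPotential p f c w ≤ scalingPotential p f c (scalingStep p f c w) := by
  set w' := scalingStep p f c w with hw'def
  have hw' : IsScalingWeight w' := isScalingWeight_scalingStep hp hf hfm hfs hc hw
  have hpp : ∀ (_ : ι) y, 0 ≤ p y := fun _ => hp
  -- the gain of the first part is at least the expected value of `f` times a convex combination
  have h1 : ∀ b, ∑ i, waterLevel f w' b * ((w' b i)⁻¹ * (Real.log (w' b i) - Real.log (w b i))) ≤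
      f b * -Real.log (∑ i, (w' b i)⁻¹) - f b * -Real.log (∑ i, (w b i)⁻¹) := by
    intro b
    have := mul_le_mul_of_nonneg_left
      (sum_mul_log_le_log_sum_inv (hw.pos b) (hw'.pos b)) (hf b)
    rw [Finset.mul_sum] at this
    refine le_trans (le_of_eq (Finset.sum_congr rfl fun i _ => ?_)) (this.trans (le_of_eq (by ring)))
    rw [waterLevel]
    ring
  -- a weight that was raised above `1` makes the expected charge equal to `c`
  have h2 : ∀ i, c * prodExp (fun _ => p) (fun b => Real.log (w' b i) - Real.log (w b i)) ≤
      prodExp (fun _ => p)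
        (fun b => waterLevel f w' b * ((w' b i)⁻¹ * (Real.log (w' b i) - Real.log (w b i)))) := by
    intro i
    rw [← prodExp_const_mul, ← prodExp_resample (w := fun _ : ι => p) (i := i) hp1
      (fun b => waterLevel f w' b * ((w' b i)⁻¹ * (Real.log (w' b i) - Real.log (w b i))))]
    refine prodExp_mono hpp fun b => ?_
    simp only [hw'.update_self, hw.update_self]
    simp only [← mul_assoc]
    rw [← Finset.sum_mul, ← Finset.sum_mul]
    have hlog : 0 ≤ Real.log (w' b i) - Real.log (w b i) :=
      sub_nonneg.mpr (Real.log_le_log (hw.pos b i) (hww b i))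
    rcases hlog.eq_or_lt with h0 | h0
    · rw [← h0]; simp
    refine mul_le_mul_of_nonneg_right ?_ h0.le
    have hgt : 1 < w' b i := lt_of_le_of_lt (hw.one_le b i) <| by
      by_contra hcon
      have := Real.log_le_log (hw'.pos b i) (not_lt.mp hcon)
      linarith
    have heq : w' b i = (∑ y, p y * waterLevel f w (update b i y)) / c := by
      rcases max_choice 1 ((∑ y, p y * waterLevel f w (update b i y)) / c) with h | h
      · have : w' b i = 1 := h
        linarith
      · exact h
    have hle : ∑ y, p y * waterLevel f w (update b i y) ≤
        ∑ y, p y * waterLevel f w' (update b i y) :=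
      Finset.sum_le_sum fun y _ => mul_le_mul_of_nonneg_left
        (waterLevel_le_waterLevel hf hfm hw hw' hww le_rfl) (hp y)
    rw [eq_div_iff hc.ne'] at heq
    rw [← heq] at hle
    rw [← div_eq_mul_inv, le_div_iff₀ (hw'.pos b i)]
    linarith
  have h3 := prodExp_mono hpp h1
  rw [prodExp_sub, prodExp_sum] at h3
  have h4 := Finset.sum_le_sum fun i (_ : i ∈ Finset.univ) => h2 i
  simp only [prodExp_sub] at h4
  rw [← Finset.mul_sum, Finset.sum_sub_distrib, mul_sub] at h4
  unfold scalingPotential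
  linarith

/-- The dual objective is bounded above in terms of the weights if `f` satisfies the dual
inequality, for all monotone test functions, with a constant `c' < c`. -/
theorem scalingPotential_le [LinearOrder L] [OrderTop L] [Nonempty ι] {w : (ι → L) → ι → ℝ} {c' : ℝ}
    (hp : ∀ y, 0 ≤ p y) (hf : ∀ b, 0 ≤ f b) (hc' : 0 ≤ c')
    (hcert : ∀ l : (ι → L) → ℝ, Monotone l → (∀ b, 0 ≤ l b) →
      prodExp (fun _ => p) (fun b => f b * l b) ≤
        c' * ∑ i, prodExp (fun _ => p) (fun b => l (update b i ⊤)))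
    (hw : IsScalingWeight w) :
    scalingPotential p f c w ≤
      -((c - c') * ∑ i, prodExp (fun _ => p) (fun b => Real.log (w b i))) := by
  set l : (ι → L) → ℝ := fun b => Finset.univ.inf' Finset.univ_nonempty fun i => Real.log (w b i)
  have hpp : ∀ (_ : ι) y, 0 ≤ p y := fun _ => hp
  have hl : Monotone l := fun b b' h => Finset.inf'_mono_fun fun i _ =>
    Real.log_le_log (hw.pos b i) (hw.mono i h)
  have hl0 : ∀ b, 0 ≤ l b := fun b => Finset.le_inf' _ _ fun i _ => Real.log_nonneg (hw.one_le b i)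
  have h1 : prodExp (fun _ => p) (fun b => f b * -Real.log (∑ i, (w b i)⁻¹)) ≤
      prodExp (fun _ => p) (fun b => f b * l b) := by
    refine prodExp_mono hpp fun b => mul_le_mul_of_nonneg_left ?_ (hf b)
    refine Finset.le_inf' _ _ fun i _ => ?_
    rw [neg_le, ← Real.log_inv]
    exact Real.log_le_log (inv_pos.mpr (hw.pos b i))
      (Finset.single_le_sum (f := fun i => (w b i)⁻¹)
        (fun k _ => (inv_pos.mpr (hw.pos b k)).le) (Finset.mem_univ i))
  have h2 : ∑ i, prodExp (fun _ => p) (fun b => l (update b i ⊤)) ≤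
      ∑ i, prodExp (fun _ => p) (fun b => Real.log (w b i)) := by
    refine Finset.sum_le_sum fun i _ => prodExp_mono hpp fun b => ?_
    calc l (update b i ⊤) ≤ Real.log (w (update b i ⊤) i) :=
          Finset.inf'_le _ (Finset.mem_univ i)
      _ = _ := by rw [hw.update_self]
  have h3 := hcert l hl hl0
  have h4 := mul_le_mul_of_nonneg_left h2 hc'
  unfold scalingPotential
  linarith

/-- A symmetric monotone benchmark `f` can be collected by charges that are nondecreasing in the
own bid and have expectation at most `c` given the other bids, provided that `f` satisfies the
dual inequality for all *monotone* test functions with a constant `c' < c`. -/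
theorem exists_charges [LinearOrder L] [OrderTop L] [Nonempty ι] {c' : ℝ}
    (hp : ∀ y, 0 < p y) (hp1 : ∑ y, p y = 1) (hf : ∀ b, 0 ≤ f b) (hfm : Monotone f)
    (hfs : ∀ (σ : Equiv.Perm ι) b, f (b ∘ σ) = f b) (hc' : 0 ≤ c') (hcc : c' < c)
    (hcert : ∀ l : (ι → L) → ℝ, Monotone l → (∀ b, 0 ≤ l b) →
      prodExp (fun _ => p) (fun b => f b * l b) ≤
        c' * ∑ i, prodExp (fun _ => p) (fun b => l (update b i ⊤))) :
    ∃ r : (ι → L) → ι → ℝ, (∀ b i, 0 ≤ r b i) ∧ (∀ b i, Monotone fun y => r (update b i y) i) ∧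
      (∀ (σ : Equiv.Perm ι) b i, r (b ∘ σ) i = r b (σ i)) ∧ (∀ b, ∑ i, r b i = f b) ∧
      ∀ b i, ∑ y, p y * r (update b i y) i ≤ c := by
  have hp0 : ∀ y, 0 ≤ p y := fun y => (hp y).le
  have hpp : ∀ (_ : ι) y, 0 ≤ p y := fun _ => hp0
  have hc : 0 < c := hc'.trans_lt hcc
  let W : ℕ → (ι → L) → ι → ℝ := fun t => (scalingStep p f c)^[t] fun _ _ => 1
  have hWs : ∀ t, W (t + 1) = scalingStep p f c (W t) := fun t => iterate_succ_apply' _ _ _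
  have hWg : ∀ t, IsScalingWeight (W t) := by
    intro t
    induction t with
    | zero => exact ⟨fun _ _ => le_rfl, fun _ _ _ _ => le_rfl, fun _ _ _ => rfl, fun _ _ _ => rfl⟩
    | succ t ih => rw [hWs]; exact isScalingWeight_scalingStep hp0 hf hfm hfs hc ih
  have hWm : ∀ t b i, W t b i ≤ W (t + 1) b i := by
    intro t
    induction t with
    | zero => exact fun b i => (hWg 1).one_le b i
    | succ t ih =>
      intro b i
      rw [hWs, hWs (t + 1)]
      exact scalingStep_le_scalingStep hp0 hf hfm hc (hWg t) (hWg _) ih b i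
  have hWpot : ∀ t, scalingPotential p f c (W 0) ≤ scalingPotential p f c (W t) := by
    intro t
    induction t with
    | zero => exact le_rfl
    | succ t ih =>
      refine ih.trans ?_
      rw [hWs]
      refine scalingPotential_le_scalingStep hp0 hp1 hf hfm hfs hc (hWg t) fun b i => ?_
      rw [← hWs]
      exact hWm t b i
  -- the dual inequality bounds the expected logarithms of the weights, hence the weights
  have hbdd : ∀ b i, ∃ C, ∀ t, W t b i ≤ C := by
    intro b i
    have hP : 0 < ∏ k, p (b k) := Finset.prod_pos fun k _ => hp _
    refine ⟨Real.exp (-scalingPotential p f c (W 0) / (c - c') / ∏ k, p (b k)), fun t => ?_⟩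
    rw [← Real.log_le_iff_le_exp ((hWg t).pos b i), le_div_iff₀ hP, le_div_iff₀ (sub_pos.mpr hcc)]
    have hlog : ∀ b' k, 0 ≤ Real.log (W t b' k) := fun b' k => Real.log_nonneg ((hWg t).one_le b' k)
    have h1 : (∏ k, p (b k)) * Real.log (W t b i) ≤
        prodExp (fun _ => p) (fun b => Real.log (W t b i)) :=
      Finset.single_le_sum (f := fun x : ι → L => (∏ k, p (x k)) * Real.log (W t x i))
        (fun x _ => mul_nonneg (Finset.prod_nonneg fun k _ => hp0 _) (hlog x i)) (Finset.mem_univ b)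
    have h2 : prodExp (fun _ => p) (fun b => Real.log (W t b i)) ≤
        ∑ k, prodExp (fun _ => p) (fun b => Real.log (W t b k)) :=
      Finset.single_le_sum (f := fun k => prodExp (fun _ => p) (fun b => Real.log (W t b k)))
        (fun k _ => prodExp_nonneg hpp fun b => hlog b k) (Finset.mem_univ i)
    have h3 := (hWpot t).trans (scalingPotential_le (c := c) hp0 hf hc' hcert (hWg t))
    have h4 := mul_le_mul_of_nonneg_left (h1.trans h2) (sub_pos.mpr hcc).le
    linarith
  have hmono : ∀ b i, Monotone fun t => W t b i := fun b i => monotone_nat_of_le_succ fun t => hWm t b i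
  choose C hC using hbdd
  have hlim : ∀ b i, ∃ x, Tendsto (fun t => W t b i) atTop (𝓝 x) := fun b i =>
    ⟨_, tendsto_atTop_ciSup (hmono b i) ⟨C b i, by rintro _ ⟨t, rfl⟩; exact hC b i t⟩⟩
  choose w hwlim using hlim
  have hw : IsScalingWeight w := by
    refine ⟨fun b i => ?_, fun i b b' h => ?_, fun b i y => ?_, fun σ b i => ?_⟩
    · exact ge_of_tendsto' (hwlim b i) fun t => (hWg t).one_le b i
    · exact le_of_tendsto_of_tendsto' (hwlim b i) (hwlim b' i) fun t => (hWg t).mono i h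
    · refine tendsto_nhds_unique (hwlim _ i) ?_
      simpa only [(hWg _).update_self] using hwlim b i
    · refine tendsto_nhds_unique (hwlim _ i) ?_
      simpa only [(hWg _).comp_perm] using hwlim b (σ i)
  have hlevel : ∀ b, Tendsto (fun t => waterLevel f (W t) b) atTop (𝓝 (waterLevel f w b)) := by
    intro b
    refine tendsto_const_nhds.div (tendsto_finsetSum _ fun i _ => ?_) (hw.sum_inv_pos b).ne'
    exact (hwlim b i).inv₀ (hw.pos b i).ne'
  have hfix : ∀ b i, (∑ y, p y * waterLevel f w (update b i y)) / c ≤ w b i := by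
    intro b i
    refine le_of_tendsto_of_tendsto'
      ((tendsto_finsetSum _ fun y _ => (hlevel (update b i y)).const_mul (p y)).div_const c)
      ((hwlim b i).comp (tendsto_add_atTop_nat 1)) fun t => ?_
    rw [comp_apply, hWs]
    exact le_max_right _ _
  refine ⟨fun b i => waterLevel f w b / w b i, fun b i => ?_, fun b i y y' h => ?_, fun σ b i => ?_,
    fun b => ?_, fun b i => ?_⟩
  · exact div_nonneg (waterLevel_nonneg hf hw b) (hw.pos b i).le
  · dsimp only
    rw [hw.update_self, hw.update_self]
    refine div_le_div_of_nonneg_right ?_ (hw.pos b i).le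
    refine waterLevel_le_waterLevel hf hfm hw hw (fun _ _ => le_rfl) ?_
    exact update_le_update_iff.mpr ⟨h, fun _ _ => le_rfl⟩
  · simp only [waterLevel_comp_perm hfs hw, hw.comp_perm]
  · simp only [div_eq_mul_inv]
    rw [← Finset.mul_sum, waterLevel, div_mul_cancel₀ _ (hw.sum_inv_pos b).ne']
  · simp only [hw.update_self, ← mul_div_assoc]
    rw [← Finset.sum_div, div_le_iff₀ (hw.pos b i)]
    have := hfix b i
    rw [div_le_iff₀ hc] at this
    linarith

end Attain

/-! ### The benchmark of the best price with at least two buyers -/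

section Benchmark

variable {ι : Type*}

/-- The number of `j ∈ A` with `t ≤ x j`. -/
noncomputable def countGE (A : Finset ι) (x : ι → ℝ) (t : ℝ) : ℕ :=
  (A.filter fun j => t ≤ x j).card

/-- The largest revenue that a single price can collect from the bids `x j`, `j ∈ A`, when at
least two of them have to accept it. It suffices to consider the bids as prices. -/
noncomputable def twoBuyer (A : Finset ι) (x : ι → ℝ) : ℝ :=
  A.fold max 0 fun i => if 2 ≤ countGE A x (x i) then (countGE A x (x i) : ℝ) * x i else 0

theorem countGE_le_card (A : Finset ι) (x : ι → ℝ) (t : ℝ) : countGE A x t ≤ A.card :=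
  Finset.card_filter_le _ _

theorem countGE_mono {A : Finset ι} {x x' : ι → ℝ} {t t' : ℝ}
    (h : ∀ i ∈ A, t ≤ x i → t' ≤ x' i) : countGE A x t ≤ countGE A x' t' :=
  Finset.card_le_card fun i hi => by
    simp only [Finset.mem_filter] at hi ⊢
    exact ⟨hi.1, h i hi.1 hi.2⟩

theorem countGE_subset {A B : Finset ι} (h : A ⊆ B) (x : ι → ℝ) (t : ℝ) :
    countGE A x t ≤ countGE B x t :=
  Finset.card_le_card (Finset.filter_subset_filter _ h)

theorem countGE_comp_perm {A : Finset ι} (σ : Equiv.Perm ι) (hσ : ∀ i, σ i ∈ A ↔ i ∈ A)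
    (x : ι → ℝ) (t : ℝ) : countGE A (x ∘ σ) t = countGE A x t := by
  refine Finset.card_bij (fun i _ => σ i) (fun i hi => ?_) (fun _ _ _ _ h => σ.injective h)
    (fun j hj => ⟨σ.symm j, ?_, by simp⟩)
  · simpa [hσ] using hi
  · have := hσ (σ.symm j)
    simp only [Equiv.apply_symm_apply] at this
    simpa [← this] using hj

theorem twoBuyer_nonneg (A : Finset ι) (x : ι → ℝ) : 0 ≤ twoBuyer A x :=
  (Finset.le_fold_max _).mpr (Or.inl le_rfl)

theorem twoBuyer_le_iff {A : Finset ι} {x : ι → ℝ} {c : ℝ} (hc : 0 ≤ c) :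
    twoBuyer A x ≤ c ↔
      ∀ (t : ℝ) (k : ℕ), 0 ≤ t → 2 ≤ k → k ≤ countGE A x t → (k : ℝ) * t ≤ c := by
  rw [twoBuyer, Finset.fold_max_le]
  constructor
  · rintro ⟨-, h⟩ t k ht hk hkA
    have hne : (A.filter fun j => t ≤ x j).Nonempty :=
      Finset.card_pos.mp (lt_of_lt_of_le (by omega) hkA)
    obtain ⟨i, hi, hmin⟩ := Finset.exists_min_image _ x hne
    rw [Finset.mem_filter] at hi
    have hcount : countGE A x t ≤ countGE A x (x i) :=
      countGE_mono fun j hj htj => hmin j (Finset.mem_filter.mpr ⟨hj, htj⟩)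
    have := h i hi.1
    rw [if_pos (by omega)] at this
    refine le_trans ?_ this
    exact mul_le_mul (by exact_mod_cast hkA.trans hcount) hi.2 ht (Nat.cast_nonneg _)
  · refine fun h => ⟨hc, fun i _ => ?_⟩
    split_ifs with h2
    · rcases le_or_gt 0 (x i) with hx | hx
      · exact h _ _ hx h2 le_rfl
      · exact (mul_nonpos_of_nonneg_of_nonpos (Nat.cast_nonneg _) hx.le).trans hc
    · exact hc

theorem le_twoBuyer {A : Finset ι} {x : ι → ℝ} {t : ℝ} {k : ℕ} (ht : 0 ≤ t) (hk : 2 ≤ k)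
    (hkA : k ≤ countGE A x t) : (k : ℝ) * t ≤ twoBuyer A x :=
  (twoBuyer_le_iff (twoBuyer_nonneg A x)).mp le_rfl t k ht hk hkA

theorem exists_of_le_twoBuyer {A : Finset ι} {x : ι → ℝ} {z : ℝ} (hz : 0 < z)
    (h : z ≤ twoBuyer A x) : ∃ k : ℕ, 2 ≤ k ∧ k ≤ countGE A x (z / k) := by
  rw [twoBuyer, Finset.le_fold_max] at h
  rcases h with h | ⟨i, _, h⟩
  · exact absurd h (not_le.mpr hz)
  split_ifs at h with h2
  · refine ⟨_, h2, countGE_mono fun j _ hj => le_trans ?_ hj⟩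
    rw [div_le_iff₀ (by positivity)]
    linarith
  · exact absurd h (not_le.mpr hz)

theorem twoBuyer_congr {κ : Type*} {A : Finset ι} {B : Finset κ} {x : ι → ℝ}
    {y : κ → ℝ} (h : ∀ t, countGE A x t = countGE B y t) : twoBuyer A x = twoBuyer B y := by
  refine le_antisymm ?_ ?_
  · rw [twoBuyer_le_iff (twoBuyer_nonneg _ _)]
    intro t k ht hk hkA
    exact le_twoBuyer ht hk (h t ▸ hkA)
  · rw [twoBuyer_le_iff (twoBuyer_nonneg _ _)]
    intro t k ht hk hkA
    exact le_twoBuyer ht hk (h t ▸ hkA)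

theorem twoBuyer_comp_perm {A : Finset ι} (σ : Equiv.Perm ι) (hσ : ∀ i, σ i ∈ A ↔ i ∈ A)
    (x : ι → ℝ) : twoBuyer A (x ∘ σ) = twoBuyer A x :=
  twoBuyer_congr (countGE_comp_perm σ hσ x)

theorem twoBuyer_mono {A : Finset ι} {x x' : ι → ℝ} (h : ∀ i ∈ A, x i ≤ x' i) :
    twoBuyer A x ≤ twoBuyer A x' := by
  rw [twoBuyer_le_iff (twoBuyer_nonneg _ _)]
  intro t k ht hk hkA
  exact le_twoBuyer ht hk (hkA.trans (countGE_mono fun i hi hit => hit.trans (h i hi)))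

theorem twoBuyer_subset {A B : Finset ι} (h : A ⊆ B) (x : ι → ℝ) :
    twoBuyer A x ≤ twoBuyer B x := by
  rw [twoBuyer_le_iff (twoBuyer_nonneg _ _)]
  intro t k ht hk hkA
  exact le_twoBuyer ht hk (hkA.trans (countGE_subset h x t))

theorem twoBuyer_le_mul {A : Finset ι} {x x' : ι → ℝ} {r : ℝ} (hr : 0 < r)
    (h : ∀ i ∈ A, x' i ≤ r * x i) : twoBuyer A x' ≤ r * twoBuyer A x := by
  rw [twoBuyer_le_iff (mul_nonneg hr.le (twoBuyer_nonneg _ _))]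
  intro t k ht hk hkA
  have := le_twoBuyer (div_nonneg ht hr.le) hk (hkA.trans (countGE_mono (x' := x) fun i hi hit =>
    (div_le_iff₀' hr).mpr (hit.trans (h i hi))))
  calc (k : ℝ) * t = r * (k * (t / r)) := by field_simp
    _ ≤ _ := mul_le_mul_of_nonneg_left this hr.le

theorem twoBuyer_le_add {A : Finset ι} {x x' : ι → ℝ} {δ : ℝ} (hδ : 0 ≤ δ)
    (h : ∀ i ∈ A, x' i ≤ x i + δ) : twoBuyer A x' ≤ twoBuyer A x + A.card * δ := by
  have hA : 0 ≤ (A.card : ℝ) * δ := by positivity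
  rw [twoBuyer_le_iff (add_nonneg (twoBuyer_nonneg _ _) hA)]
  intro t k ht hk hkA
  have hkc : (k : ℝ) * δ ≤ A.card * δ :=
    mul_le_mul_of_nonneg_right (by exact_mod_cast hkA.trans (countGE_le_card A x' t)) hδ
  rcases le_or_gt δ t with hδt | hδt
  · have := le_twoBuyer (sub_nonneg.mpr hδt) hk (hkA.trans (countGE_mono (x' := x) fun i hi hit =>
      sub_le_iff_le_add.mpr (hit.trans (h i hi))))
    linarith [mul_sub (k : ℝ) t δ]
  · have : (k : ℝ) * t ≤ k * δ := mul_le_mul_of_nonneg_left hδt.le (Nat.cast_nonneg _)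
    linarith [twoBuyer_nonneg A x]

/-- If the bids outside `A` are below those in `A`, then lowering bids in `A` decreases the
benchmark of all bids at most as much as that of the bids in `A`: a price that some bidder outside
`A` accepts is accepted by all of `A`. -/
theorem twoBuyer_univ_sub_le [Fintype ι] {A : Finset ι} {x x' : ι → ℝ}
    (hA : ∀ i ∈ A, ∀ k ∉ A, x k ≤ x' i) (hxx : ∀ i ∈ A, x' i ≤ x i) (hx : ∀ k ∉ A, x' k = x k) :
    twoBuyer Finset.univ x - twoBuyer Finset.univ x' ≤ twoBuyer A x - twoBuyer A x' := by
  have h1 : twoBuyer A x' ≤ twoBuyer A x := twoBuyer_mono hxx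
  have h2 : twoBuyer A x' ≤ twoBuyer Finset.univ x' := twoBuyer_subset (Finset.subset_univ A) x'
  have h3 := twoBuyer_nonneg A x'
  rw [sub_le_iff_le_add, twoBuyer_le_iff (by linarith)]
  intro t k ht hk hkA
  by_cases hex : ∃ j, j ∉ A ∧ t ≤ x j
  · obtain ⟨j, hjA, hj⟩ := hex
    have := le_twoBuyer ht hk (hkA.trans (countGE_mono (x' := x') fun i _ hit => ?_))
    · linarith
    · by_cases hi : i ∈ A
      · exact hj.trans (hA i hi j hjA)
      · rw [hx i hi]; exact hit
  · push Not at hex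
    have hcount : countGE Finset.univ x t ≤ countGE A x t := by
      refine Finset.card_le_card fun i hi => ?_
      simp only [Finset.mem_filter, Finset.mem_univ, true_and] at hi ⊢
      refine ⟨?_, hi⟩
      by_contra hiA
      exact absurd hi (not_le.mpr (hex i hiA))
    have := le_twoBuyer ht hk (hkA.trans hcount)
    linarith

end Benchmark

/-! ### Truncated equal-revenue laws -/

section EqualRevenue

variable {J : ℕ} {r : ℝ}

/-- The equal-revenue law on the levels `c, …, J`, where level `x` stands for the bid `r ^ x`:
a level of at least `x ≥ c` has probability `r ^ c / r ^ x`. -/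
noncomputable def erLaw (r : ℝ) (J c : ℕ) (x : Fin (J + 1)) : ℝ :=
  if (x : ℕ) < c then 0
  else if (x : ℕ) = J then r ^ c * (r⁻¹) ^ J
  else r ^ c * ((r⁻¹) ^ (x : ℕ) - (r⁻¹) ^ ((x : ℕ) + 1))

/-- The law of the constant `c`. -/
noncomputable def pointLaw (J c : ℕ) (x : Fin (J + 1)) : ℝ := if (x : ℕ) = c then 1 else 0

theorem erLaw_eq (hr : 1 < r) {c : ℕ} (hc : c < J) (x : Fin (J + 1)) :
    erLaw r J c x = (1 - r⁻¹) * pointLaw J c x + r⁻¹ * erLaw r J (c + 1) x := by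
  have hr0 : r ≠ 0 := by positivity
  unfold erLaw pointLaw
  rcases lt_trichotomy (x : ℕ) c with h | h | h
  · rw [if_pos h, if_neg h.ne, if_pos (by omega)]; ring
  · rw [if_neg (by omega), if_neg (by omega), if_pos h, if_pos (by omega), h, pow_succ, inv_pow]
    field_simp
    ring
  · rw [if_neg (by omega : ¬ (x : ℕ) < c), if_neg (by omega : ¬ (x : ℕ) = c),
      if_neg (by omega : ¬ (x : ℕ) < c + 1)]
    have key : ∀ z : ℝ, r ^ c * z = (1 - r⁻¹) * 0 + r⁻¹ * (r ^ (c + 1) * z) := fun z => by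
      rw [pow_succ]; field_simp; ring
    split_ifs
    · exact key _
    · exact key _

theorem erLaw_top (hr : 1 < r) : erLaw r J J = pointLaw J J := by
  have hr0 : r ≠ 0 := by positivity
  ext x
  have := x.isLt
  unfold erLaw pointLaw
  split_ifs
  · omega
  · rfl
  · rw [← mul_pow, mul_inv_cancel₀ hr0, one_pow]
  · omega

theorem erLaw_nonneg (hr : 1 < r) (c : ℕ) (x : Fin (J + 1)) : 0 ≤ erLaw r J c x := by
  have h1 : r⁻¹ ≤ 1 := inv_le_one_of_one_le₀ hr.le
  have h0 : 0 ≤ r⁻¹ := by positivity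
  unfold erLaw
  split_ifs
  · exact le_rfl
  · positivity
  · exact mul_nonneg (by positivity) (sub_nonneg.mpr (pow_le_pow_of_le_one h0 h1 (by omega)))

theorem erLaw_pos (hr : 1 < r) (x : Fin (J + 1)) : 0 < erLaw r J 0 x := by
  have h1 : r⁻¹ < 1 := inv_lt_one_of_one_lt₀ hr
  have h0 : 0 < r⁻¹ := by positivity
  unfold erLaw
  rw [if_neg (by omega)]
  split_ifs
  · positivity
  · exact mul_pos (by positivity) (sub_pos.mpr (pow_lt_pow_right_of_lt_one₀ h0 h1 (by omega)))

theorem le_of_erLaw_ne_zero {c : ℕ} {x : Fin (J + 1)} (h : erLaw r J c x ≠ 0) : c ≤ x := by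
  by_contra hx
  exact h (if_pos (by omega))

theorem pointLaw_nonneg (c : ℕ) (x : Fin (J + 1)) : 0 ≤ pointLaw J c x := by
  unfold pointLaw; split_ifs <;> norm_num

theorem pointLaw_eq {c : ℕ} (hc : c ≤ J) :
    pointLaw J c = fun x => if x = (⟨c, by omega⟩ : Fin (J + 1)) then 1 else 0 := by
  ext x; simp [pointLaw, Fin.ext_iff]

theorem sum_pointLaw_mul {c : ℕ} (hc : c ≤ J) (g : Fin (J + 1) → ℝ) :
    ∑ x, pointLaw J c x * g x = g ⟨c, by omega⟩ := by
  simp [pointLaw_eq hc]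

theorem sum_pointLaw {c : ℕ} (hc : c ≤ J) : ∑ x, pointLaw J c x = 1 := by
  simp [pointLaw_eq hc]

theorem sum_erLaw (hr : 1 < r) {c : ℕ} (hc : c ≤ J) : ∑ x, erLaw r J c x = 1 := by
  induction hc using Nat.decreasingInduction with
  | self => rw [erLaw_top hr]; exact sum_pointLaw le_rfl
  | of_succ c hc ih =>
    simp only [erLaw_eq hr hc, Finset.sum_add_distrib, ← Finset.mul_sum, ih, sum_pointLaw hc.le]
    ring

/-- A bid that follows the equal-revenue law is at least `x` with probability `1 / x`, for the
values `x = r ^ m` of the levels. -/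
theorem sum_erLaw_ge (hr : 1 < r) {m : ℕ} (hm : m ≤ J) :
    ∑ x : Fin (J + 1), (if m ≤ (x : ℕ) then erLaw r J 0 x else 0) = (r⁻¹) ^ m := by
  have hr0 : r ≠ 0 := by positivity
  have : ∀ x : Fin (J + 1), (if m ≤ (x : ℕ) then erLaw r J 0 x else 0) =
      (r⁻¹) ^ m * erLaw r J m x := by
    intro x
    have key : ∀ z : ℝ, z = (r⁻¹) ^ m * (r ^ m * z) := fun z => by
      rw [← mul_assoc, ← mul_pow, inv_mul_cancel₀ hr0, one_pow, one_mul]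
    unfold erLaw
    rw [if_neg (by omega : ¬ (x : ℕ) < 0)]
    by_cases h : m ≤ (x : ℕ)
    · rw [if_pos h, if_neg (by omega : ¬ (x : ℕ) < m)]
      split_ifs
      · rw [pow_zero, one_mul]; exact key _
      · rw [pow_zero, one_mul]; exact key _
    · rw [if_neg h, if_pos (by omega), mul_zero]
  rw [Finset.sum_congr rfl fun x _ => this x, ← Finset.mul_sum, sum_erLaw hr hm, mul_one]

/-- Raising every level by one, up to the cap `J`. -/
def levelSucc (J : ℕ) (y : Fin (J + 1)) : Fin (J + 1) := ⟨min J ((y : ℕ) + 1), by omega⟩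

theorem erLaw_succ_eq_sum (hr : 1 < r) {c : ℕ} (hc : c < J) (x : Fin (J + 1)) :
    erLaw r J (c + 1) x = ∑ y, if levelSucc J y = x then erLaw r J c y else 0 := by
  have hr0 : r ≠ 0 := by positivity
  have hx := x.isLt
  rcases Nat.lt_or_ge x J with hxJ | hxJ
  · rcases Nat.eq_zero_or_pos (x : ℕ) with h0 | h0
    · rw [Finset.sum_eq_zero]
      · exact if_pos (by omega)
      · intro y _
        rw [if_neg]
        simp only [levelSucc, Fin.ext_iff]
        omega
    · rw [Finset.sum_eq_single (⟨(x : ℕ) - 1, by omega⟩ : Fin (J + 1))]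
      · rw [if_pos (by simp only [levelSucc, Fin.ext_iff]; omega)]
        unfold erLaw
        dsimp only
        by_cases hlt : (x : ℕ) < c + 1
        · rw [if_pos hlt, if_pos (by omega)]
        · rw [if_neg hlt, if_neg (by omega), if_neg (by omega), if_neg (by omega)]
          obtain ⟨m, hm⟩ : ∃ m, (x : ℕ) = m + 1 := ⟨x - 1, by omega⟩
          rw [hm, Nat.add_sub_cancel, pow_succ r c, pow_succ r⁻¹ (m + 1), pow_succ r⁻¹ m]
          field_simp
      · intro y _ hy
        rw [if_neg]
        simp only [levelSucc, Fin.ext_iff, ne_eq] at hy ⊢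
        omega
      · simp
  · have hJ : 1 ≤ J := by omega
    rw [Finset.sum_eq_add (⟨J - 1, by omega⟩ : Fin (J + 1)) (⟨J, by omega⟩ : Fin (J + 1))]
    · rw [if_pos (by simp only [levelSucc, Fin.ext_iff]; omega),
        if_pos (by simp only [levelSucc, Fin.ext_iff]; omega)]
      unfold erLaw
      dsimp only
      rw [if_neg (by omega), if_pos (by omega), if_neg (by omega), if_neg (by omega),
        if_neg (by omega), if_pos rfl]
      obtain ⟨m, rfl⟩ : ∃ m, J = m + 1 := ⟨J - 1, by omega⟩
      rw [Nat.add_sub_cancel, pow_succ r c, pow_succ r⁻¹ m]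
      field_simp
      ring
    · simp only [ne_eq, Fin.mk.injEq]; omega
    · rintro y _ ⟨h1, h2⟩
      rw [if_neg]
      simp only [levelSucc, Fin.ext_iff, ne_eq] at h1 h2 ⊢
      omega
    · simp
    · simp

end EqualRevenue

/-! ### A covariance inequality -/

section Covariance

variable {ι : Type*} [DecidableEq ι] {J : ℕ} {r : ℝ}

/-- The laws of the bids when bidder `i ∈ A` is only known to bid at least level `c i`, and
bidder `i ∉ A` is known to bid level `c i`. -/
noncomputable def partialLaw (r : ℝ) (J : ℕ) (A : Finset ι) (c : ι → ℕ) (i : ι) :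
    Fin (J + 1) → ℝ :=
  if i ∈ A then erLaw r J (c i) else pointLaw J (c i)

theorem sum_partialLaw (hr : 1 < r) (A : Finset ι) {c : ι → ℕ} {i : ι} (hc : c i ≤ J) :
    ∑ y, partialLaw r J A c i y = 1 := by
  unfold partialLaw
  split_ifs
  · exact sum_erLaw hr hc
  · exact sum_pointLaw hc

theorem partialLaw_nonneg (hr : 1 < r) (A : Finset ι) (c : ι → ℕ) (i : ι) (y : Fin (J + 1)) :
    0 ≤ partialLaw r J A c i y := by
  unfold partialLaw
  split_ifs
  · exact erLaw_nonneg hr _ _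
  · exact pointLaw_nonneg _ _

theorem partialLaw_erase {A : Finset ι} (c : ι → ℕ) (i : ι) :
    partialLaw r J (A.erase i) c = update (partialLaw r J A c) i (pointLaw J (c i)) := by
  ext k y
  by_cases hk : k = i
  · subst hk; simp [partialLaw]
  · simp [partialLaw, hk]

theorem partialLaw_update {A : Finset ι} (c : ι → ℕ) {i : ι} (hi : i ∈ A) (m : ℕ) :
    partialLaw r J A (update c i m) = update (partialLaw r J A c) i (erLaw r J m) := by
  ext k y
  by_cases hk : k = i
  · subst hk; simp [partialLaw, hi]
  · simp [partialLaw, hk]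

variable [Fintype ι]

/-- Whether an unknown bid at least `c i` is equal to its lower bound or not is revealed. -/
theorem prodExp_partialLaw_split (hr : 1 < r) {A : Finset ι} {c : ι → ℕ} {i : ι} (hi : i ∈ A)
    (hc : c i < J) (g : (ι → Fin (J + 1)) → ℝ) :
    prodExp (partialLaw r J A c) g =
      (1 - r⁻¹) * prodExp (partialLaw r J (A.erase i) c) g +
        r⁻¹ * prodExp (partialLaw r J A (update c i (c i + 1))) g := by
  have hw := sum_partialLaw (J := J) hr A (c := c) hc.le
  rw [partialLaw_erase, partialLaw_update c hi, prodExp_update hw, prodExp_update hw,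
    ← prodExp_const_mul, ← prodExp_const_mul, ← prodExp_add, ← prodExp_resample hw]
  congr 1
  ext b
  rw [Finset.mul_sum, Finset.mul_sum, ← Finset.sum_add_distrib]
  refine Finset.sum_congr rfl fun y _ => ?_
  rw [partialLaw, if_pos hi, erLaw_eq hr hc]
  ring

theorem prodExp_pointLaw {c : ι → ℕ} (hc : ∀ i, c i ≤ J) (g : (ι → Fin (J + 1)) → ℝ) :
    prodExp (fun i => pointLaw J (c i)) g = g fun i => ⟨c i, Nat.lt_succ_of_le (hc i)⟩ := by
  unfold prodExp
  rw [Finset.sum_eq_single fun i => (⟨c i, Nat.lt_succ_of_le (hc i)⟩ : Fin (J + 1))]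
  · simp [pointLaw]
  · intro x _ hx
    obtain ⟨i, hi⟩ := Function.ne_iff.mp hx
    rw [Finset.prod_eq_zero (Finset.mem_univ i), zero_mul]
    simpa [pointLaw, Fin.ext_iff] using hi
  · simp

/-- The covariance of `f` with a monotone function `l` is controlled by the effects of single
bids on `l`, if the value of revealing that a bid at level `j` is higher than `j` is at most
`β * r ^ (j + 1)`. The bids are revealed level by level, always for a bidder
whose lower bound is minimal. -/
theorem covariance_le (hr : 1 < r) {f l : (ι → Fin (J + 1)) → ℝ} {β : ℝ} (hβ : 0 ≤ β)
    (hl : Monotone l)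
    (hf : ∀ (A : Finset ι) (c : ι → ℕ) (i : ι), i ∈ A → c i < J → (∀ k ∉ A, c k ≤ c i) →
      (∀ k ∈ A, c k = c i ∨ c k = c i + 1) →
      prodExp (partialLaw r J A (update c i (c i + 1))) f -
        prodExp (partialLaw r J (A.erase i) c) f ≤ β * r ^ (c i + 1))
    (N : ℕ) (A : Finset ι) (c : ι → ℕ) (hN : ∑ k ∈ A, (J - c k) ≤ N) (hc : ∀ k, c k ≤ J)
    (hdead : ∀ i ∈ A, ∀ k ∉ A, c k ≤ c i) (halive : ∀ i ∈ A, ∀ k ∈ A, c k ≤ c i + 1) :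
    prodExp (partialLaw r J A c) (fun b => f b * l b) -
        prodExp (partialLaw r J A c) f * prodExp (partialLaw r J A c) l ≤
      β * ∑ k ∈ A, r ^ c k * (prodExp (partialLaw r J A c) (fun b => l (update b k ⊤)) -
        prodExp (partialLaw r J A c) l) := by
  have hr0 : (0 : ℝ) < r := by positivity
  induction N generalizing A c with
  | zero =>
    have hcJ : ∀ k ∈ A, c k = J := fun k hk => by
      have := (Finset.sum_eq_zero_iff.mp (Nat.le_zero.mp hN)) k hk
      have := hc k
      omega
    have hw : partialLaw r J A c = fun i => pointLaw J (c i) := by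
      ext i y
      unfold partialLaw
      split_ifs with hi
      · rw [hcJ i hi, erLaw_top hr]
      · rfl
    rw [hw]
    simp only [prodExp_pointLaw hc, sub_self]
    exact mul_nonneg hβ (Finset.sum_nonneg fun k _ => mul_nonneg (by positivity)
      (sub_nonneg.mpr (hl (le_update_self_iff.mpr le_top))))
  | succ N ih =>
    by_cases hA : ∀ k ∈ A, c k = J
    · exact ih A c (by
        rw [Finset.sum_eq_zero fun k hk => by rw [hA k hk, Nat.sub_self]]
        exact Nat.zero_le _) hc hdead halive
    push Not at hA
    obtain ⟨k₀, hk₀, hk₀J⟩ := hA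
    obtain ⟨i, hi, hmin⟩ := A.exists_min_image c ⟨k₀, hk₀⟩
    have hiJ : c i < J := by
      have := hmin k₀ hk₀
      have := hc k₀
      omega
    set j := c i with hj
    have hfi := hf A c i hi hiJ (fun k hk => hdead i hi k hk) (fun k hk => by
      have := hmin k hk
      have := halive i hi k hk
      omega)
    rw [← Finset.add_sum_erase A _ hi] at hN
    have ihd := ih (A.erase i) c (by omega) hc
      (fun m hm k hk => by
        by_cases hki : k = i
        · subst hki; exact hmin m (Finset.mem_of_mem_erase hm)
        · exact hdead m (Finset.mem_of_mem_erase hm) k fun h =>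
            hk (Finset.mem_erase.mpr ⟨hki, h⟩))
      (fun m hm k hk => halive m (Finset.mem_of_mem_erase hm) k (Finset.mem_of_mem_erase hk))
    have ihu := ih A (update c i (j + 1))
      (by
        rw [← Finset.add_sum_erase A _ hi, update_self,
          Finset.sum_congr rfl fun k hk => by rw [update_of_ne (Finset.ne_of_mem_erase hk)]]
        omega)
      (fun k => by
        by_cases hki : k = i
        · subst hki; simpa using hiJ
        · simpa [hki] using hc k)
      (fun m hm k hk => by
        have hki : k ≠ i := fun h => hk (h ▸ hi)
        rw [update_of_ne hki]
        by_cases hmi : m = i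
        · subst hmi; rw [update_self]; exact (hdead m hi k hk).trans (by omega)
        · rw [update_of_ne hmi]; exact hdead m hm k hk)
      (fun m hm k hk => by
        have h1 := hmin m hm
        have h2 := halive i hi k hk
        have h3 := halive m hm k hk
        by_cases hki : k = i <;> by_cases hmi : m = i <;> simp [hki, hmi] <;> omega)
    rw [← Finset.add_sum_erase A _ hi] at ihu ⊢
    rw [update_self, Finset.sum_congr rfl fun k hk => by
      rw [update_of_ne (Finset.ne_of_mem_erase hk)]] at ihu
    simp only [prodExp_partialLaw_split hr hi hiJ]
    rw [← hj]
    -- The bid of `i` itself is irrelevant when it is replaced by the top level.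
    have hw : ∀ i, ∑ y, partialLaw r J A c i y = 1 := fun k => sum_partialLaw hr A (hc k)
    have hTi : prodExp (partialLaw r J (A.erase i) c) (fun b => l (update b i ⊤)) =
        prodExp (partialLaw r J A (update c i (j + 1))) (fun b => l (update b i ⊤)) := by
      rw [partialLaw_erase, partialLaw_update c hi, prodExp_update_of_indep (hw i)
        (sum_pointLaw (hc i)) (by simp), prodExp_update_of_indep (hw i) (sum_erLaw hr hiJ)
        (by simp)]
    have hld : prodExp (partialLaw r J (A.erase i) c) l ≤
        prodExp (partialLaw r J A (update c i (j + 1))) l := by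
      rw [partialLaw_erase, partialLaw_update c hi, prodExp_update (hw i), prodExp_update (hw i)]
      refine prodExp_mono (partialLaw_nonneg hr A c) fun b => ?_
      rw [sum_pointLaw_mul (hc i)]
      calc l (update b i ⟨c i, _⟩)
          = ∑ y, erLaw r J (j + 1) y * l (update b i ⟨c i, Nat.lt_succ_of_le (hc i)⟩) := by
            rw [← Finset.sum_mul, sum_erLaw hr hiJ, one_mul]
        _ ≤ _ := Finset.sum_le_sum fun y _ => by
            by_cases hy : erLaw r J (j + 1) y = 0
            · simp [hy]
            · refine mul_le_mul_of_nonneg_left (hl ?_) (erLaw_nonneg hr _ _)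
              have := le_of_erLaw_ne_zero hy
              exact update_le_update_iff.mpr ⟨by rw [Fin.le_def]; dsimp only; omega,
                fun _ _ => le_rfl⟩
    rw [hTi]
    set D := partialLaw r J (A.erase i) c
    set U := partialLaw r J A (update c i (j + 1))
    generalize prodExp U (fun b => l (update b i ⊤)) = τ at *
    have hsum : ∑ k ∈ A.erase i, r ^ c k *
        ((1 - r⁻¹) * prodExp D (fun b => l (update b k ⊤)) +
          r⁻¹ * prodExp U (fun b => l (update b k ⊤)) -
          ((1 - r⁻¹) * prodExp D l + r⁻¹ * prodExp U l)) =
        (1 - r⁻¹) * ∑ k ∈ A.erase i, r ^ c k * (prodExp D (fun b => l (update b k ⊤)) -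
          prodExp D l) + r⁻¹ * ∑ k ∈ A.erase i, r ^ c k *
          (prodExp U (fun b => l (update b k ⊤)) - prodExp U l) := by
      rw [Finset.mul_sum, Finset.mul_sum, ← Finset.sum_add_distrib]
      exact Finset.sum_congr rfl fun k _ => by ring
    rw [hsum]
    set q := r⁻¹ with hq
    have hq0 : 0 ≤ q := by positivity
    have hq1 : q ≤ 1 := inv_le_one_of_one_le₀ hr.le
    have hqr : q * r ^ (j + 1) = r ^ j := by rw [pow_succ, hq]; field_simp
    have e1 := mul_le_mul_of_nonneg_left ihd (sub_nonneg.mpr hq1)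
    have e2 := mul_le_mul_of_nonneg_left ihu hq0
    have e3 := mul_le_mul_of_nonneg_left (mul_le_mul_of_nonneg_right hfi (sub_nonneg.mpr hld))
      (mul_nonneg (sub_nonneg.mpr hq1) hq0)
    have e4 : q * (β * (r ^ (j + 1) * (τ - prodExp U l))) = β * r ^ j * (τ - prodExp U l) := by
      rw [← hqr]; ring
    have e5 : (1 - q) * q * (β * r ^ (j + 1) * (prodExp U l - prodExp D l)) =
        (1 - q) * β * r ^ j * (prodExp U l - prodExp D l) := by
      rw [← hqr]; ring
    nlinarith [e1, e2, e3, e4, e5]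

end Covariance

/-! ### The value of a single bid for the benchmark -/

section SingleBid

variable {ι : Type*} {J : ℕ} {r : ℝ}

/-- The bids that correspond to a vector of levels. -/
noncomputable def bids (r : ℝ) (b : ι → Fin (J + 1)) (i : ι) : ℝ := r ^ (b i : ℕ)

theorem bids_mono (hr : 1 < r) {b b' : ι → Fin (J + 1)} {i : ι} (h : b i ≤ b' i) :
    bids r b i ≤ bids r b' i :=
  pow_le_pow_right₀ hr.le h

variable [DecidableEq ι]

theorem twoBuyer_bids_update_of_notMem {A : Finset ι} {i : ι} (hi : i ∉ A)
    (b : ι → Fin (J + 1)) (y : Fin (J + 1)) :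
    twoBuyer A (bids r (update b i y)) = twoBuyer A (bids r b) := by
  refine twoBuyer_congr fun t => ?_
  unfold countGE
  congr 1
  refine Finset.filter_congr fun k hk => ?_
  have : k ≠ i := fun h => hi (h ▸ hk)
  simp [bids, this]

variable [Fintype ι]

/-- The expected benchmark of the bidders in `A` when all bids have the equal-revenue law with base
level `j`. -/
noncomputable def meanTwoBuyer (r : ℝ) (J : ℕ) (A : Finset ι) (j : ℕ) : ℝ :=
  prodExp (fun _ => erLaw r J j) fun b => twoBuyer A (bids r b)

theorem meanTwoBuyer_nonneg (hr : 1 < r) (A : Finset ι) (j : ℕ) : 0 ≤ meanTwoBuyer r J A j :=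
  prodExp_nonneg (fun _ => erLaw_nonneg hr j) fun _ => twoBuyer_nonneg _ _

theorem meanTwoBuyer_succ_le (hr : 1 < r) (A : Finset ι) {j : ℕ} (hj : j < J) :
    meanTwoBuyer r J A (j + 1) ≤ r * meanTwoBuyer r J A j := by
  unfold meanTwoBuyer
  rw [prodExp_map (levelSucc J) (fun _ x => erLaw_succ_eq_sum hr hj x), ← prodExp_const_mul]
  refine prodExp_mono (fun _ => erLaw_nonneg hr j) fun b => ?_
  refine twoBuyer_le_mul (by positivity) fun i _ => ?_
  rw [bids, bids, ← pow_succ']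
  exact pow_le_pow_right₀ hr.le (min_le_right _ _)

theorem meanTwoBuyer_le (hr : 1 < r) (A : Finset ι) {j : ℕ} (hj : j ≤ J) :
    meanTwoBuyer r J A j ≤ r ^ j * meanTwoBuyer r J A 0 := by
  induction j with
  | zero => simp
  | succ j ih =>
    refine (meanTwoBuyer_succ_le hr A hj).trans ?_
    rw [pow_succ', mul_assoc]
    exact mul_le_mul_of_nonneg_left (ih (by omega)) (by positivity)

/-- The probability that all bidders in `A` bid more than the base level is `(1 / r) ^ #A`, and
under this condition they follow the next equal-revenue law. -/
theorem prodExp_erLaw_forall_lt (hr : 1 < r) (A : Finset ι) {j : ℕ} (hj : j < J) :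
    prodExp (fun _ => erLaw r J j) (fun b =>
        if ∀ i ∈ A, j < (b i : ℕ) then twoBuyer A (bids r b) else 0) =
      r⁻¹ ^ A.card * meanTwoBuyer r J A (j + 1) := by
  have h1 : meanTwoBuyer r J A (j + 1) = prodExp
      (fun i => if i ∈ A then erLaw r J (j + 1) else erLaw r J j)
      fun b => twoBuyer A (bids r b) := by
    refine prodExp_congr_of_indep Aᶜ (fun _ => sum_erLaw hr hj) (fun i => ?_) (fun i hi => ?_)
      (fun i hi b y => ?_)
    · split_ifs
      · exact sum_erLaw hr hj
      · exact sum_erLaw hr hj.le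
    · rw [Finset.mem_compl, not_not] at hi
      rw [if_pos hi]
    · exact twoBuyer_bids_update_of_notMem (Finset.mem_compl.mp hi) b y
  rw [h1, ← prodExp_const_mul]
  unfold prodExp
  refine Finset.sum_congr rfl fun x _ => ?_
  dsimp only
  split_ifs with hx
  · have : ∏ i, erLaw r J j (x i) = ∏ i, (if i ∈ A then r⁻¹ else 1) *
        (if i ∈ A then erLaw r J (j + 1) else erLaw r J j) (x i) := by
      refine Finset.prod_congr rfl fun i _ => ?_
      by_cases hi : i ∈ A
      · rw [if_pos hi, if_pos hi, erLaw_eq hr hj, pointLaw, if_neg (hx i hi).ne']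
        ring
      · rw [if_neg hi, if_neg hi, one_mul]
    rw [this, Finset.prod_mul_distrib, Finset.prod_ite_mem, Finset.univ_inter, Finset.prod_const]
    ring
  · push Not at hx
    obtain ⟨i, hi, hij⟩ := hx
    have h0 : (∏ i, (if i ∈ A then erLaw r J (j + 1) else erLaw r J j) (x i)) = 0 := by
      refine Finset.prod_eq_zero (Finset.mem_univ i) ?_
      rw [if_pos hi, erLaw, if_pos (by omega)]
    rw [h0, mul_zero, zero_mul]

/-- Some bidder bids the base level or none does, and all bidders are alike: so knowing that one
of them bids the base level lowers the expectation by a fraction of about `1 / #A` only. -/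
theorem meanTwoBuyer_sub_le (hr : 1 < r) {A : Finset ι} {i : ι} (hi : i ∈ A) {j : ℕ}
    (hj : j < J) :
    A.card * (meanTwoBuyer r J A j - prodExp (fun _ => erLaw r J j)
        (fun b => twoBuyer A (bids r (update b i ⟨j, by omega⟩)))) ≤
      meanTwoBuyer r J A j * (1 + Fintype.card ι * (1 - r⁻¹ ^ Fintype.card ι)) := by
  set y : Fin (J + 1) := ⟨j, by omega⟩ with hy
  set e := meanTwoBuyer r J A j with he
  set m := prodExp (fun _ => erLaw r J j) (fun b => twoBuyer A (bids r (update b i y))) with hm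
  set q := r⁻¹ with hq
  have hq0 : 0 < q := by positivity
  have hq1 : q < 1 := inv_lt_one_of_one_lt₀ hr
  have he0 : 0 ≤ e := meanTwoBuyer_nonneg hr A j
  have hw : ∀ _ : ι, ∑ y, erLaw r J j y = 1 := fun _ => sum_erLaw hr hj.le
  have hsymm : ∀ k ∈ A, prodExp (fun _ => erLaw r J j)
      (fun b => twoBuyer A (bids r (update b k y))) = m := by
    intro k hk
    rw [hm, ← prodExp_perm (Equiv.swap i k)]
    congr 1
    ext b
    have hb := comp_perm_update (Equiv.swap i k) b k y
    rw [Equiv.swap_apply_right] at hb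
    rw [hb]
    refine (twoBuyer_comp_perm (Equiv.swap i k) (fun l => ?_) (bids r (update b i y)))
    rcases eq_or_ne l i with rfl | hli
    · simp [hi, hk]
    rcases eq_or_ne l k with rfl | hlk
    · simp [hi, hk]
    rw [Equiv.swap_apply_of_ne_of_ne hli hlk]
  have hlow : ∀ k ∈ A, prodExp (fun _ : ι => erLaw r J j)
      (fun b => if b k = y then twoBuyer A (bids r b) else 0) = (1 - q) * m := by
    intro k hk
    rw [← hsymm k hk, ← prodExp_const_mul,
      ← prodExp_resample (w := fun _ : ι => erLaw r J j) (i := k) (hw k)]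
    congr 1
    ext b
    have : erLaw r J j y = 1 - q := by
      rw [erLaw_eq hr hj, pointLaw, if_pos rfl, erLaw, if_pos (by simp [hy])]
      ring
    simp [← this]
  have hsplit : e ≤ A.card * ((1 - q) * m) + q ^ A.card * meanTwoBuyer r J A (j + 1) := by
    rw [← prodExp_erLaw_forall_lt hr A hj, ← nsmul_eq_mul, ← Finset.sum_const,
      ← Finset.sum_congr rfl hlow, ← prodExp_sum, ← prodExp_add, he, meanTwoBuyer]
    refine prodExp_mono_of_support (fun _ => erLaw_nonneg hr j) fun b hb => ?_
    split_ifs with hall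
    · exact le_add_of_nonneg_left (Finset.sum_nonneg fun k _ => by
        split_ifs
        · exact twoBuyer_nonneg _ _
        · exact le_rfl)
    · push Not at hall
      obtain ⟨k, hk, hkj⟩ := hall
      have hky : b k = y := Fin.ext (le_antisymm hkj (le_of_erLaw_ne_zero (hb k)))
      rw [add_zero]
      refine le_trans (le_of_eq (if_pos (c := b k = y) hky).symm) (Finset.single_le_sum
        (f := fun k => if b k = y then twoBuyer A (bids r b) else 0) (fun k _ => ?_) hk)
      split_ifs
      · exact twoBuyer_nonneg _ _
      · exact le_rfl
  have hK : 1 ≤ A.card := Finset.card_pos.mpr ⟨i, hi⟩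
  obtain ⟨K, hK⟩ : ∃ K, A.card = K + 1 := ⟨A.card - 1, by omega⟩
  have hKn : K ≤ Fintype.card ι := by have := A.card_le_univ; omega
  have hnext : q ^ A.card * meanTwoBuyer r J A (j + 1) ≤ q ^ K * e := by
    calc q ^ A.card * meanTwoBuyer r J A (j + 1) ≤ q ^ A.card * (r * e) :=
          mul_le_mul_of_nonneg_left (meanTwoBuyer_succ_le hr A hj) (by positivity)
      _ = q ^ K * e := by rw [hK, pow_succ, hq]; field_simp
  have hgeom : 1 - q ^ K = (1 - q) * ∑ s ∈ Finset.range K, q ^ s := by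
    rw [mul_comm]; exact (geom_sum_mul_neg q K).symm
  have h3 : e * ∑ s ∈ Finset.range K, q ^ s ≤ A.card * m := by
    have : (1 - q) * (e * ∑ s ∈ Finset.range K, q ^ s) ≤ (1 - q) * (A.card * m) := by
      rw [mul_left_comm, ← hgeom]
      linarith
    exact le_of_mul_le_mul_left this (sub_pos.mpr hq1)
  have h4 : (K : ℝ) - ∑ s ∈ Finset.range K, q ^ s ≤
      Fintype.card ι * (1 - q ^ Fintype.card ι) := by
    calc (K : ℝ) - ∑ s ∈ Finset.range K, q ^ s = ∑ s ∈ Finset.range K, (1 - q ^ s) := by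
          simp [Finset.sum_sub_distrib]
      _ ≤ ∑ s ∈ Finset.range K, (1 - q ^ Fintype.card ι) := by
          refine Finset.sum_le_sum fun s hs => ?_
          have := Finset.mem_range.mp hs
          have := pow_le_pow_of_le_one hq0.le hq1.le (by omega : s ≤ Fintype.card ι)
          linarith
      _ = K * (1 - q ^ Fintype.card ι) := by
          rw [Finset.sum_const, Finset.card_range, nsmul_eq_mul]
      _ ≤ _ := mul_le_mul_of_nonneg_right (by exact_mod_cast hKn)
          (sub_nonneg.mpr (pow_le_one₀ hq0.le hq1.le))
  have h5 : (A.card : ℝ) = K + 1 := by exact_mod_cast hK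
  have h6 := mul_le_mul_of_nonneg_left h4 he0
  nlinarith [h3, h5, h6]

/-- The bound on the value of the information that the bid of `i` is higher than its level `c i`,
in the case that all other undetermined bids are known to be higher than this level. -/
theorem prodExp_twoBuyer_sub_le_of_pure (hr : 1 < r) {C : ℝ} (hC : 0 ≤ C)
    (hmean : ∀ A : Finset ι, meanTwoBuyer r J A 0 ≤ A.card * C)
    {A : Finset ι} {c : ι → ℕ} {i : ι} (hi : i ∈ A) (hciJ : c i < J)
    (hdead : ∀ k ∉ A, c k ≤ c i) (halive : ∀ k ∈ A, k ≠ i → c k = c i + 1) :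
    prodExp (partialLaw r J A (update c i (c i + 1))) (fun b => twoBuyer Finset.univ (bids r b)) -
        prodExp (partialLaw r J (A.erase i) c) (fun b => twoBuyer Finset.univ (bids r b)) ≤
      (Fintype.card ι * (1 - r⁻¹) + C * (1 + Fintype.card ι * (1 - r⁻¹ ^ Fintype.card ι))) *
        r ^ (c i + 1) := by
  set j := c i with hj
  set n := Fintype.card ι with hn
  set q := r⁻¹ with hq
  have hq0 : 0 < q := by positivity
  have hq1 : q < 1 := inv_lt_one_of_one_lt₀ hr
  set w := partialLaw r J A (update c i (j + 1)) with hwdef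
  have hwA : ∀ k ∈ A, w k = erLaw r J (j + 1) := by
    intro k hk
    rw [hwdef, partialLaw, if_pos hk]
    by_cases hki : k = i
    · subst hki; rw [update_self]
    · rw [update_of_ne hki, halive k hk hki]
  have hwD : ∀ k ∉ A, w k = pointLaw J (c k) := by
    intro k hk
    rw [hwdef, partialLaw, if_neg hk, update_of_ne (ne_of_mem_of_not_mem hi hk).symm]
  have hcD : ∀ k ∉ A, c k ≤ J := fun k hk => (hdead k hk).trans hciJ.le
  have hw1 : ∀ k, ∑ y, w k y = 1 := by
    intro k
    by_cases hk : k ∈ A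
    · rw [hwA k hk, sum_erLaw hr hciJ]
    · rw [hwD k hk, sum_pointLaw (hcD k hk)]
  have hw0 : ∀ k y, 0 ≤ w k y := partialLaw_nonneg hr _ _
  have herase : partialLaw r J (A.erase i) c = update w i (pointLaw J j) := by
    ext k y
    by_cases hk : k = i
    · subst hk; simp [partialLaw, hj]
    · simp [partialLaw, hk, hwdef]
  set y₀ : Fin (J + 1) := ⟨j, by omega⟩ with hy₀
  set y₁ : Fin (J + 1) := ⟨j + 1, by omega⟩ with hy₁
  rw [herase, prodExp_update (hw1 i), ← prodExp_sub]
  -- Lowering the bid to level `j + 1` matters for the bidders in `A` only, and lowering it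
  -- further to level `j` matters little.
  have hstep : prodExp w (fun b => twoBuyer Finset.univ (bids r b) -
      ∑ y, pointLaw J j y * twoBuyer Finset.univ (bids r (update b i y))) ≤
      prodExp w (fun b => (twoBuyer A (bids r b) - twoBuyer A (bids r (update b i y₁))) +
        n * (1 - q) * r ^ (j + 1)) := by
    refine prodExp_mono_of_support hw0 fun b hb => ?_
    rw [sum_pointLaw_mul hciJ.le]
    have hbA : ∀ k ∈ A, j + 1 ≤ (b k : ℕ) := fun k hk =>
      le_of_erLaw_ne_zero (hwA k hk ▸ hb k)
    have hbD : ∀ k ∉ A, (b k : ℕ) ≤ j := fun k hk => by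
      have := hb k
      rw [hwD k hk, pointLaw] at this
      have : (b k : ℕ) = c k := by by_contra h; exact this (if_neg h)
      exact this ▸ hdead k hk
    have hle : ∀ k, update b i y₁ k ≤ b k := fun k => by
      by_cases hk : k = i
      · subst hk; rw [update_self]; exact hbA k hi
      · rw [update_of_ne hk]
    have h1 := twoBuyer_univ_sub_le (A := A) (x := bids r b) (x' := bids r (update b i y₁))
      (fun k hk l hl => by
        refine pow_le_pow_right₀ hr.le ?_
        have h1 := hbD l hl
        by_cases hki : k = i
        · subst hki; rw [update_self]; exact h1.trans (Nat.le_succ j)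
        · rw [update_of_ne hki]; have := hbA k hk; omega)
      (fun k _ => bids_mono hr (hle k))
      (fun k hk => by
        unfold bids
        rw [update_of_ne (ne_of_mem_of_not_mem hi hk).symm])
    have hδ : r ^ (j + 1) - r ^ j = (1 - q) * r ^ (j + 1) := by
      rw [pow_succ, hq]; field_simp
    have hδ0 : 0 ≤ r ^ (j + 1) - r ^ j := by
      rw [hδ]; exact mul_nonneg (sub_nonneg.mpr hq1.le) (by positivity)
    have h2 := twoBuyer_le_add (A := Finset.univ) (x := bids r (update b i y₀))
      (x' := bids r (update b i y₁)) hδ0 (fun k _ => by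
        unfold bids
        by_cases hki : k = i
        · subst hki; simp [hy₀, hy₁]
        · simp only [update_of_ne hki]; linarith)
    rw [Finset.card_univ, ← hn, hδ] at h2
    linarith
  refine hstep.trans ?_
  rw [prodExp_add, prodExp_const hw1]
  have hindep : prodExp w (fun b => twoBuyer A (bids r b) -
      twoBuyer A (bids r (update b i y₁))) = prodExp (fun _ => erLaw r J (j + 1))
      (fun b => twoBuyer A (bids r b) - twoBuyer A (bids r (update b i y₁))) := by
    refine prodExp_congr_of_indep Aᶜ hw1 (fun _ => sum_erLaw hr hciJ) (fun k hk => ?_)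
      (fun k hk b y => ?_)
    · rw [Finset.mem_compl, not_not] at hk
      exact hwA k hk
    · have hkA := Finset.mem_compl.mp hk
      have hki : i ≠ k := fun h => hkA (h ▸ hi)
      rw [twoBuyer_bids_update_of_notMem hkA, update_comm hki.symm,
        twoBuyer_bids_update_of_notMem hkA]
  have hK : (0 : ℝ) < A.card := by exact_mod_cast Finset.card_pos.mpr ⟨i, hi⟩
  have hfac : 0 ≤ 1 + n * (1 - q ^ n) :=
    add_nonneg zero_le_one (mul_nonneg (Nat.cast_nonneg _)
      (sub_nonneg.mpr (pow_le_one₀ hq0.le hq1.le)))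
  have hmain : prodExp w (fun b => twoBuyer A (bids r b) -
      twoBuyer A (bids r (update b i y₁))) ≤ C * (1 + n * (1 - q ^ n)) * r ^ (j + 1) := by
    rw [hindep]
    rcases Nat.lt_or_ge (j + 1) J with hjJ | hjJ
    · rw [prodExp_sub]
      have h1 := meanTwoBuyer_sub_le hr hi hjJ
      have h2 := meanTwoBuyer_le (J := J) hr A hciJ
      have h3 := mul_le_mul_of_nonneg_left (hmean A) (by positivity : 0 ≤ r ^ (j + 1))
      refine le_of_mul_le_mul_left (h1.trans ?_) hK
      calc _ ≤ (r ^ (j + 1) * (A.card * C)) * (1 + n * (1 - q ^ n)) :=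
            mul_le_mul_of_nonneg_right (h2.trans h3) hfac
        _ = _ := by ring
    · refine le_trans (prodExp_mono_of_support (g' := fun _ => 0)
        (fun _ => erLaw_nonneg hr _) fun b hb => ?_) ?_
      · have hbi : y₁ = b i := by
          have := le_of_erLaw_ne_zero (hb i)
          have := (b i).isLt
          exact Fin.ext (by simp only [hy₁]; omega)
        rw [hbi, update_eq_self, sub_self]
      · rw [prodExp_const fun _ => sum_erLaw hr hciJ]
        positivity
  linarith

/-- The bound on the value of the information that the bid of `i` is higher than its level `c i`,
if this level is minimal among the undetermined bids. The other undetermined bids at this level are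
revealed first. -/
theorem prodExp_twoBuyer_sub_le (hr : 1 < r) {C : ℝ} (hC : 0 ≤ C)
    (hmean : ∀ A : Finset ι, meanTwoBuyer r J A 0 ≤ A.card * C)
    (A : Finset ι) (c : ι → ℕ) (i : ι) (hi : i ∈ A) (hciJ : c i < J)
    (hdead : ∀ k ∉ A, c k ≤ c i) (halive : ∀ k ∈ A, c k = c i ∨ c k = c i + 1) :
    prodExp (partialLaw r J A (update c i (c i + 1))) (fun b => twoBuyer Finset.univ (bids r b)) -
        prodExp (partialLaw r J (A.erase i) c) (fun b => twoBuyer Finset.univ (bids r b)) ≤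
      (Fintype.card ι * (1 - r⁻¹) + C * (1 + Fintype.card ι * (1 - r⁻¹ ^ Fintype.card ι))) *
        r ^ (c i + 1) := by
  induction hN : ((A.erase i).filter fun k => c k = c i).card using Nat.strong_induction_on
    generalizing A c with
  | _ N ih =>
    by_cases hpure : ∀ k ∈ A, k ≠ i → c k = c i + 1
    · exact prodExp_twoBuyer_sub_le_of_pure hr hC hmean hi hciJ hdead hpure
    push Not at hpure
    obtain ⟨k, hk, hki, hck'⟩ := hpure
    have hck : c k = c i := (halive k hk).resolve_right hck'
    have hkmem : k ∈ (A.erase i).filter fun k => c k = c i := by simp [hk, hki, hck]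
    have h1 := ih _ (by
        rw [← hN]
        refine Finset.card_lt_card (Finset.ssubset_iff_of_subset ?_ |>.mpr ⟨k, hkmem, ?_⟩)
        · exact Finset.filter_subset_filter _ (Finset.erase_subset_erase _
            (Finset.erase_subset k A))
        · simp) (A.erase k) c (Finset.mem_erase.mpr ⟨hki.symm, hi⟩) hciJ
      (fun l hl => by
        by_cases hlk : l = k
        · rw [hlk, hck]
        · exact hdead l fun h => hl (Finset.mem_erase.mpr ⟨hlk, h⟩))
      (fun l hl => halive l (Finset.mem_of_mem_erase hl)) rfl
    have hci' : update c k (c i + 1) i = c i := update_of_ne hki.symm _ _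
    have h2 := ih _ (by
        rw [← hN, hci']
        refine Finset.card_lt_card (Finset.ssubset_iff_of_subset ?_ |>.mpr ⟨k, hkmem, ?_⟩)
        · intro l hl
          simp only [Finset.mem_filter] at hl ⊢
          refine ⟨hl.1, ?_⟩
          by_cases hlk : l = k
          · rw [hlk, hck]
          · rw [update_of_ne hlk] at hl; exact hl.2
        · simp) A (update c k (c i + 1)) hi (by rwa [hci'])
      (fun l hl => by rw [hci', update_of_ne (ne_of_mem_of_not_mem hk hl).symm]; exact hdead l hl)
      (fun l hl => by
        rw [hci']
        by_cases hlk : l = k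
        · right; rw [hlk, update_self]
        · rw [update_of_ne hlk]; exact halive l hl) rfl
    rw [hci', ← update_comm hki.symm] at h2
    rw [prodExp_partialLaw_split hr hk (c := update c i (c i + 1)) (by
        rw [update_of_ne hki, hck]; exact hciJ),
      prodExp_partialLaw_split hr (Finset.mem_erase.mpr ⟨hki, hk⟩) (c := c) (by rw [hck]; exact hciJ),
      Finset.erase_right_comm, update_of_ne hki, hck]
    have hq0 : 0 ≤ r⁻¹ := by positivity
    have hq1 : r⁻¹ ≤ 1 := inv_le_one_of_one_le₀ hr.le
    have e1 := mul_le_mul_of_nonneg_left h1 (sub_nonneg.mpr hq1)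
    have e2 := mul_le_mul_of_nonneg_left h2 hq0
    linarith

/-- The covariance inequality for the benchmark when all bids follow the equal-revenue law. -/
theorem prodExp_twoBuyer_mul_le (hr : 1 < r) {C β : ℝ} (hC : 0 ≤ C)
    (hmean : ∀ A : Finset ι, meanTwoBuyer r J A 0 ≤ A.card * C)
    (hβ : Fintype.card ι * (1 - r⁻¹) + C * (1 + Fintype.card ι * (1 - r⁻¹ ^ Fintype.card ι)) ≤ β)
    (hCβ : C ≤ β)
    {l : (ι → Fin (J + 1)) → ℝ} (hl : Monotone l) (hl0 : ∀ b, 0 ≤ l b) :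
    prodExp (fun _ => erLaw r J 0) (fun b => twoBuyer Finset.univ (bids r b) * l b) ≤
      β * ∑ i, prodExp (fun _ => erLaw r J 0) (fun b => l (update b i ⊤)) := by
  have hw : partialLaw r J (Finset.univ : Finset ι) (fun _ => 0) = fun _ => erLaw r J 0 := by
    ext; simp [partialLaw]
  have h := covariance_le hr (f := fun b => twoBuyer Finset.univ (bids r b))
    (hC.trans hCβ) hl (fun A c i hi hci hd ha =>
      (prodExp_twoBuyer_sub_le hr hC hmean A c i hi hci hd ha).trans
        (mul_le_mul_of_nonneg_right hβ (by positivity))) _ Finset.univ (fun _ => 0) le_rfl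
    (fun _ => Nat.zero_le _) (by simp) (by simp)
  rw [hw] at h
  simp only [pow_zero, one_mul, Finset.sum_sub_distrib, Finset.sum_const, Finset.card_univ,
    nsmul_eq_mul] at h
  have h1 := mul_le_mul_of_nonneg_right (hmean Finset.univ)
    (prodExp_nonneg (fun _ => erLaw_nonneg (J := J) hr 0) hl0)
  have h2 : C * (Fintype.card ι * prodExp (fun _ : ι => erLaw r J 0) l) ≤
      β * (Fintype.card ι * prodExp (fun _ : ι => erLaw r J 0) l) :=
    mul_le_mul_of_nonneg_right hCβ (mul_nonneg (Nat.cast_nonneg _)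
      (prodExp_nonneg (fun _ => erLaw_nonneg hr 0) hl0))
  rw [Finset.card_univ] at h1
  unfold meanTwoBuyer at h1
  linarith

end SingleBid

/-! ### Tail bounds for the benchmark of equal-revenue bids -/

section Share

variable {ι L : Type*} [DecidableEq ι]

/-- The largest `k ≥ k₀` such that bidder `i`, together with the bidders in `I` who accept the
price `t k`, forms a group of size at least `k`; it is `0` if there is no such `k`. This does not
depend on the bid of bidder `i`. -/
noncomputable def shareSize (t : ℕ → ℝ) (k₀ : ℕ) (I : Finset ι) (x : ι → ℝ) (i : ι) : ℕ :=
  Nat.findGreatest (fun k => k₀ ≤ k ∧ k ≤ countGE (I.erase i) x (t k) + 1) I.card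

theorem countGE_eq_erase_add_one {I : Finset ι} {x : ι → ℝ} {t : ℝ} {i : ι} (hi : i ∈ I)
    (h : t ≤ x i) : countGE I x t = countGE (I.erase i) x t + 1 := by
  unfold countGE
  rw [Finset.filter_erase, Finset.card_erase_add_one]
  simp [hi, h]

/-- When some price `t k` attracts at least `k` bidders, the bidders for whom the price belonging
to their share size is acceptable can jointly pay `1` by equal shares. -/
theorem one_le_sum_inv_shareSize {t : ℕ → ℝ} {k₀ : ℕ} (hk₀ : 1 ≤ k₀)
    (ht : ∀ k k', k₀ ≤ k → k ≤ k' → t k' ≤ t k) {I : Finset ι} {x : ι → ℝ}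
    (h : ∃ k, k₀ ≤ k ∧ k ≤ countGE I x (t k)) :
    1 ≤ ∑ i ∈ I, if t (shareSize t k₀ I x i) ≤ x i then ((shareSize t k₀ I x i : ℝ))⁻¹ else 0 := by
  classical
  obtain ⟨k₁, hk₁, hk₁c⟩ := h
  let P : ℕ → Prop := fun k => k₀ ≤ k ∧ k ≤ countGE I x (t k)
  set k := Nat.findGreatest P I.card with hk
  obtain ⟨hkk₀, hkc⟩ : P k :=
    Nat.findGreatest_spec (hk₁c.trans (countGE_le_card _ _ _)) ⟨hk₁, hk₁c⟩
  have hmax : ∀ m, k < m → ¬ P m := fun m hm hP =>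
    Nat.findGreatest_is_greatest hm (hP.2.trans (countGE_le_card _ _ _)) hP
  have hshare : ∀ i ∈ I, t k ≤ x i → shareSize t k₀ I x i = k := by
    intro i hi hix
    rw [shareSize, Nat.findGreatest_eq_iff]
    refine ⟨hkc.trans (countGE_le_card _ _ _), fun _ => ⟨hkk₀, ?_⟩, fun m hm _ hP => hmax m hm
      ⟨hP.1, ?_⟩⟩
    · rwa [← countGE_eq_erase_add_one hi hix]
    · rw [countGE_eq_erase_add_one hi ((ht k m hkk₀ hm.le).trans hix)]
      exact hP.2
  calc (1 : ℝ) ≤ countGE I x (t k) * (k : ℝ)⁻¹ := by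
        rw [← div_eq_mul_inv, one_le_div (by exact_mod_cast (by omega : 0 < k))]
        exact_mod_cast hkc
    _ = ∑ i ∈ I.filter fun j => t k ≤ x j, (k : ℝ)⁻¹ := by
        rw [Finset.sum_const, nsmul_eq_mul, countGE]
    _ = ∑ i ∈ I, if t k ≤ x i then (k : ℝ)⁻¹ else 0 := Finset.sum_filter _ _
    _ ≤ _ := by
        refine Finset.sum_le_sum fun i hi => ?_
        split_ifs with h1 h2 h2
        · rw [hshare i hi h1]
        · rw [hshare i hi h1] at h2; exact absurd h1 h2
        · positivity
        · exact le_rfl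

variable [Fintype ι] [Fintype L]

/-- If the probability of a bid at or above `t k` is at most `k * s`, then a price `t k` that
attracts at least `k` of the bidders `i ∈ I` exists with probability at most `s * #I`. More
generally, the event may carry a weight `B b ≤ G i b * u (b i)`, where `G i` does not depend on the
bid of `i` and `u` is taken into account in the probabilities; and on the right-hand side, bidder `i`
only counts if the other bidders of `I` can form a group with `i`. -/
theorem prodExp_exists_price_le {p : L → ℝ} (hp : ∀ y, 0 ≤ p y) (hp1 : ∑ y, p y = 1) {v : L → ℝ}
    {t : ℕ → ℝ} {k₀ : ℕ} (hk₀ : 1 ≤ k₀) (ht : ∀ k k', k₀ ≤ k → k ≤ k' → t k' ≤ t k) {s : ℝ}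
    (hs : 0 ≤ s) {I : Finset ι} {B : (ι → L) → ℝ} {G : ι → (ι → L) → ℝ} {u : L → ℝ}
    (hB : ∀ b, 0 ≤ B b) (hG : ∀ i b, 0 ≤ G i b)
    (hBG : ∀ i ∈ I, ∀ b, B b ≤ G i b * u (b i)) (hGi : ∀ i b y, G i (update b i y) = G i b)
    (hu : ∀ k, k₀ ≤ k → ∑ y, p y * (if t k ≤ v y then u y else 0) ≤ k * s) :
    prodExp (fun _ => p) (fun b =>
        open Classical in if ∃ k, k₀ ≤ k ∧ k ≤ countGE I (fun i => v (b i)) (t k)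
          then B b else 0) ≤
      s * ∑ i ∈ I, prodExp (fun _ => p) (fun b => open Classical in
        if ∃ k, k₀ ≤ k ∧ k ≤ countGE (I.erase i) (fun i => v (b i)) (t k) + 1
          then G i b else 0) := by
  classical
  have hP : ∀ b : ι → L, ∀ i y, ∀ τ : ℝ,
      countGE (I.erase i) (fun j => v (update b i y j)) τ =
        countGE (I.erase i) (fun j => v (b j)) τ := by
    intro b i y τ
    unfold countGE
    congr 1
    refine Finset.filter_congr fun k hk => ?_
    dsimp only
    rw [update_of_ne (Finset.ne_of_mem_erase hk)]
  have hκ : ∀ b : ι → L, ∀ i y, shareSize t k₀ I (fun j => v (update b i y j)) i =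
      shareSize t k₀ I (fun j => v (b j)) i := by
    intro b i y
    simp only [shareSize, hP]
  calc _ ≤ prodExp (fun _ => p) (fun b => ∑ i ∈ I,
          (shareSize t k₀ I (fun j => v (b j)) i : ℝ)⁻¹ * G i b *
            (if t (shareSize t k₀ I (fun j => v (b j)) i) ≤ v (b i) then u (b i) else 0)) := by
        refine prodExp_mono (fun _ => hp) fun b => ?_
        have hterm : ∀ i ∈ I, B b * (if t (shareSize t k₀ I (fun j => v (b j)) i) ≤ v (b i) then
              ((shareSize t k₀ I (fun j => v (b j)) i : ℝ))⁻¹ else 0) ≤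
            (shareSize t k₀ I (fun j => v (b j)) i : ℝ)⁻¹ * G i b *
            (if t (shareSize t k₀ I (fun j => v (b j)) i) ≤ v (b i) then u (b i) else 0) := by
          intro i hi
          split_ifs
          · have := mul_le_mul_of_nonneg_left (hBG i hi b)
              (inv_nonneg.mpr (Nat.cast_nonneg (α := ℝ) (shareSize t k₀ I (fun j => v (b j)) i)))
            linarith
          · simp
        refine le_trans ?_ (Finset.sum_le_sum hterm)
        rw [← Finset.mul_sum]
        split_ifs with hex
        · exact le_mul_of_one_le_right (hB b) (one_le_sum_inv_shareSize hk₀ ht hex)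
        · exact mul_nonneg (hB b) (Finset.sum_nonneg fun i _ => by split_ifs <;> positivity)
    _ ≤ _ := by
        rw [prodExp_sum, Finset.mul_sum]
        refine Finset.sum_le_sum fun i hi => ?_
        rw [← prodExp_const_mul, ← prodExp_resample (w := fun _ : ι => p) (i := i) hp1]
        refine prodExp_mono (fun _ => hp) fun b => ?_
        simp only [hκ, hGi, update_self]
        set κ := shareSize t k₀ I (fun j => v (b j)) i with hκdef
        rw [Finset.sum_congr rfl fun y _ => (mul_left_comm (p y) ((κ : ℝ)⁻¹ * G i b) _),
          ← Finset.mul_sum]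
        rcases Nat.eq_zero_or_pos κ with h0 | h0
        · rw [h0, Nat.cast_zero, inv_zero, zero_mul, zero_mul]
          split_ifs
          · exact mul_nonneg hs (hG i b)
          · simp
        · have hspec := Nat.findGreatest_of_ne_zero (hκdef.symm) h0.ne'
          rw [if_pos ⟨κ, hspec⟩]
          have hκ0 : (0 : ℝ) < κ := by exact_mod_cast h0
          calc (κ : ℝ)⁻¹ * G i b * ∑ y, p y * (if t κ ≤ v y then u y else 0)
              ≤ (κ : ℝ)⁻¹ * G i b * (κ * s) :=
                mul_le_mul_of_nonneg_left (hu κ hspec.1) (mul_nonneg (by positivity) (hG i b))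
            _ = s * G i b := by field_simp

/-- The probability that all bids of `I` satisfy a condition. -/
theorem prodExp_prod {p : L → ℝ} (hp1 : ∑ y, p y = 1) (I : Finset ι) (φ : L → ℝ) :
    prodExp (fun _ => p) (fun b => ∏ i ∈ I, φ (b i)) = (∑ y, p y * φ y) ^ I.card := by
  induction I using Finset.induction_on with
  | empty => simpa using prodExp_const (fun _ => hp1) 1
  | insert a s ha ih =>
    rw [Finset.card_insert_of_notMem ha, pow_succ', ← ih, ← prodExp_const_mul,
      ← prodExp_resample (w := fun _ : ι => p) (i := a) hp1]
    congr 1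
    ext b
    rw [Finset.sum_mul]
    refine Finset.sum_congr rfl fun y _ => ?_
    rw [Finset.prod_insert ha, update_self, mul_assoc]
    congr 2
    refine Finset.prod_congr rfl fun k hk => ?_
    rw [update_of_ne (ne_of_mem_of_not_mem hk ha)]

end Share

section Tail

variable {ι : Type*} [Fintype ι] [DecidableEq ι] {J : ℕ} {r : ℝ}

/-- A bid that follows the equal-revenue law is at least `t` with probability at most `1 / t`. -/
theorem sum_erLaw_ge_le (hr : 1 < r) {t : ℝ} (ht : 0 < t) :
    ∑ y : Fin (J + 1), erLaw r J 0 y * (if t ≤ r ^ (y : ℕ) then 1 else 0) ≤ t⁻¹ := by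
  have hr0 : 0 < r := by positivity
  have hle : ∀ m : ℕ, m ≤ J → (∀ y : ℕ, t ≤ r ^ y → m ≤ y) →
      ∑ y : Fin (J + 1), erLaw r J 0 y * (if t ≤ r ^ (y : ℕ) then 1 else 0) ≤ (r⁻¹) ^ m := by
    intro m hm h
    rw [← sum_erLaw_ge hr hm]
    refine Finset.sum_le_sum fun y _ => ?_
    split_ifs with h1 h2 h2
    · simp
    · exact absurd (h _ h1) h2
    · simpa using erLaw_nonneg hr _ _
    · simp
  by_cases hex : ∃ y : Fin (J + 1), t ≤ r ^ (y : ℕ)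
  · have hex' : ∃ m : ℕ, t ≤ r ^ m := ⟨_, hex.choose_spec⟩
    classical
    have hspec := Nat.find_spec hex'
    refine (hle (Nat.find hex') ?_ fun y hy => Nat.find_min' hex' hy).trans ?_
    · exact (Nat.find_min' hex' hex.choose_spec).trans (Nat.lt_succ_iff.mp hex.choose.isLt)
    · rw [inv_pow]
      exact inv_anti₀ ht hspec
  · push Not at hex
    rw [Finset.sum_eq_zero fun y _ => by rw [if_neg (not_le.mpr (hex y)), mul_zero]]
    positivity

/-- The probability that the benchmark of the bidders in `A` is at least `z`. -/
noncomputable def tailProb (r : ℝ) (J : ℕ) (A : Finset ι) (z : ℝ) : ℝ :=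
  prodExp (fun _ => erLaw r J 0) fun b => if z ≤ twoBuyer A (bids r b) then 1 else 0

theorem tailProb_le_one (hr : 1 < r) (A : Finset ι) (z : ℝ) : tailProb r J A z ≤ 1 := by
  rw [← prodExp_const (ι := ι) (fun _ => sum_erLaw (J := J) hr (Nat.zero_le J)) 1]
  refine prodExp_mono (fun _ => erLaw_nonneg hr 0) fun b => ?_
  split_ifs <;> norm_num

theorem tailProb_antitone (hr : 1 < r) (A : Finset ι) : Antitone (tailProb r J A) := by
  intro z z' hz
  refine prodExp_mono (fun _ => erLaw_nonneg hr 0) fun b => ?_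
  split_ifs with h1 h2 h2
  · exact le_rfl
  · exact absurd (hz.trans h1) h2
  · norm_num
  · exact le_rfl

/-- The probability that, for some `k ≥ 1`, at least `k` of the bidders in `I` bid at least
`z / (k + 1)`. -/
noncomputable def partnerProb (r : ℝ) (J : ℕ) (I : Finset ι) (z : ℝ) : ℝ :=
  prodExp (fun _ => erLaw r J 0) fun b => open Classical in
    if ∃ k : ℕ, 1 ≤ k ∧ k ≤ countGE I (bids r b) (z / (k + 1)) then 1 else 0

theorem div_succ_antitone {z : ℝ} (hz : 0 < z) (k k' : ℕ) (h : k ≤ k') :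
    z / ((k' : ℝ) + 1) ≤ z / ((k : ℝ) + 1) := by
  have : (k : ℝ) ≤ k' := by exact_mod_cast h
  gcongr

theorem tailProb_le (hr : 1 < r) (A : Finset ι) {z : ℝ} (hz : 0 < z) :
    tailProb r J A z ≤ z⁻¹ * ∑ i ∈ A, partnerProb r J (A.erase i) z := by
  classical
  have h := prodExp_exists_price_le (ι := ι) (p := erLaw r J 0) (erLaw_nonneg hr 0)
    (sum_erLaw hr (Nat.zero_le J)) (v := fun y : Fin (J + 1) => r ^ (y : ℕ))
    (t := fun k => z / k) (k₀ := 2) (by norm_num)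
    (fun k k' hk hkk' => by
      have h1 : (0 : ℝ) < k := by exact_mod_cast (by omega : 0 < k)
      have h2 : (k : ℝ) ≤ k' := by exact_mod_cast hkk'
      gcongr) (inv_nonneg.mpr hz.le)
    (I := A) (B := fun _ => 1) (G := fun _ _ => 1) (u := fun _ => 1) (by simp) (by simp)
    (by simp) (by simp)
    (fun k hk => by
      have h1 : (0 : ℝ) < k := by exact_mod_cast (by omega : 0 < k)
      refine (sum_erLaw_ge_le hr (div_pos hz h1)).trans (le_of_eq ?_)
      rw [inv_div, div_eq_mul_inv])
  refine le_trans (prodExp_mono (fun _ => erLaw_nonneg hr 0) fun b => ?_)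
    (h.trans (mul_le_mul_of_nonneg_left (Finset.sum_le_sum fun i _ =>
      prodExp_mono (fun _ => erLaw_nonneg hr 0) fun b => ?_) (inv_nonneg.mpr hz.le)))
  · split_ifs with h1 h2 h2
    · exact le_rfl
    · exact absurd (exists_of_le_twoBuyer hz h1) h2
    · norm_num
    · exact le_rfl
  · split_ifs with h1 h2 h2
    · exact le_rfl
    · obtain ⟨k, hk, hkc⟩ := h1
      refine absurd ⟨k - 1, by omega, ?_⟩ h2
      have : ((k - 1 : ℕ) : ℝ) + 1 = k := by rw [Nat.cast_sub (by omega)]; simp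
      rw [this]
      change k ≤ countGE (A.erase i) (bids r b) (z / k) + 1 at hkc
      omega
    · norm_num
    · exact le_rfl

theorem partnerProb_le_two_mul (hr : 1 < r) (I : Finset ι) {z : ℝ} (hz : 0 < z) :
    partnerProb r J I z ≤ 2 * z⁻¹ * I.card := by
  classical
  have h := prodExp_exists_price_le (ι := ι) (p := erLaw r J 0) (erLaw_nonneg hr 0)
    (sum_erLaw hr (Nat.zero_le J)) (v := fun y : Fin (J + 1) => r ^ (y : ℕ))
    (t := fun k => z / (k + 1)) (k₀ := 1) le_rfl
    (fun k k' _ hkk' => div_succ_antitone hz k k' hkk') (s := 2 * z⁻¹) (by positivity)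
    (I := I) (B := fun _ => 1) (G := fun _ _ => 1) (u := fun _ => 1) (by simp) (by simp)
    (by simp) (by simp)
    (fun k hk => by
      have h1 : (1 : ℝ) ≤ k := by exact_mod_cast hk
      refine (sum_erLaw_ge_le hr (by positivity)).trans ?_
      rw [inv_div, div_eq_mul_inv]
      have : 0 < z⁻¹ := by positivity
      nlinarith)
  refine h.trans (mul_le_mul_of_nonneg_left ?_ (by positivity))
  rw [← nsmul_one (I.card), ← Finset.sum_const]
  refine Finset.sum_le_sum fun i _ => ?_
  refine (prodExp_mono (g' := fun _ => 1) (fun _ => erLaw_nonneg hr 0) fun b => ?_).trans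
    (prodExp_const (ι := ι) (fun _ => sum_erLaw (J := J) hr (Nat.zero_le J)) 1).le
  split_ifs <;> norm_num

/-- The sharper bound for `z ≤ r ^ J`: with a good chance all bids in `I` are below `z`, and under
this condition a group of partners is less likely. -/
theorem partnerProb_le (hr : 1 < r) (hr2 : r ≤ 2) {I : Finset ι} {K : ℕ} (hI : I.card = K + 1)
    {z : ℝ} (hz : (K + 2) * r ≤ z) (hzJ : z ≤ r ^ J) :
    partnerProb r J I z ≤ 1 - (1 - r / z) ^ K * (1 - (K + 2) * r / z) := by
  classical
  have hr0 : 0 < r := by positivity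
  have hK0 : (0 : ℝ) ≤ K := Nat.cast_nonneg K
  have hrz : 2 * r ≤ z := by nlinarith
  have hz0 : 0 < z := by linarith
  obtain ⟨m, hm1, hm2⟩ := exists_nat_pow_near (by linarith : 1 ≤ z) hr
  have hmJ : m ≤ J := (pow_le_pow_iff_right₀ hr).mp (hm1.trans hzJ)
  set p := erLaw r J 0 with hp
  have hp0 : ∀ y, 0 ≤ p y := erLaw_nonneg hr 0
  have hp1 : ∑ y, p y = 1 := sum_erLaw hr (Nat.zero_le J)
  set q := (r⁻¹) ^ m with hq
  have hqz1 : z⁻¹ ≤ q := by rw [hq, inv_pow]; exact inv_anti₀ (by positivity) hm1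
  have hqz2 : q ≤ r / z := by
    rw [hq, inv_pow, inv_le_iff_one_le_mul₀ (by positivity), div_mul_eq_mul_div, one_le_div hz0,
      ← pow_succ']
    exact hm2.le
  -- The indicator of a bid below `r ^ m`.
  let u : Fin (J + 1) → ℝ := fun y => if (y : ℕ) < m then 1 else 0
  have hu0 : ∀ y, 0 ≤ u y := fun y => by dsimp only [u]; split_ifs <;> norm_num
  have hu1 : ∀ y, u y ≤ 1 := fun y => by dsimp only [u]; split_ifs <;> norm_num
  have hge : ∑ y : Fin (J + 1), (if m ≤ (y : ℕ) then p y else 0) = q := sum_erLaw_ge hr hmJ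
  have hsplit : ∀ f : Fin (J + 1) → ℝ, ∑ y, p y * (f y * u y) =
      ∑ y, p y * f y - ∑ y : Fin (J + 1), (if m ≤ (y : ℕ) then p y else 0) * f y := by
    intro f
    rw [← Finset.sum_sub_distrib]
    refine Finset.sum_congr rfl fun y _ => ?_
    dsimp only [u]
    split_ifs <;> first | omega | ring
  have hsum : ∑ y, p y * u y = 1 - q := by
    have := hsplit fun _ => 1
    simpa [hp1, hge] using this
  have h := prodExp_exists_price_le (ι := ι) hp0 hp1 (v := fun y : Fin (J + 1) => r ^ (y : ℕ))
    (t := fun k => z / (k + 1)) (k₀ := 1) le_rfl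
    (fun k k' _ hkk' => div_succ_antitone hz0 k k' hkk') (s := z⁻¹) (by positivity)
    (I := I) (B := fun b => ∏ i ∈ I, u (b i)) (G := fun i b => ∏ k ∈ I.erase i, u (b k)) (u := u)
    (fun b => Finset.prod_nonneg fun _ _ => hu0 _)
    (fun _ b => Finset.prod_nonneg fun _ _ => hu0 _)
    (fun i hi b => (Finset.prod_erase_mul I (fun k => u (b k)) hi).ge)
    (fun i b y => Finset.prod_congr rfl fun k hk => by
      rw [update_of_ne (Finset.ne_of_mem_erase hk)])
    (fun k hk => by
      have hk1 : (1 : ℝ) ≤ k := by exact_mod_cast hk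
      have hle := sum_erLaw_ge_le (J := J) hr (t := z / (k + 1)) (by positivity)
      have h1 := hsplit fun y => if z / (k + 1) ≤ r ^ (y : ℕ) then 1 else 0
      have h2 : ∑ y : Fin (J + 1), (if m ≤ (y : ℕ) then p y else 0) *
          (if z / (k + 1) ≤ r ^ (y : ℕ) then 1 else 0) = q := by
        rw [← hge]
        refine Finset.sum_congr rfl fun y _ => ?_
        split_ifs with h3 h4
        · ring
        · refine absurd (le_trans ?_ (pow_le_pow_right₀ hr.le h3)) h4
          rw [div_le_iff₀ (by positivity)]
          rw [pow_succ] at hm2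
          have : 0 < r ^ m := by positivity
          nlinarith
        · ring
        · ring
      have h3 : ∀ y : Fin (J + 1), p y * (if z / (k + 1) ≤ r ^ (y : ℕ) then u y else 0) =
          p y * ((if z / (k + 1) ≤ r ^ (y : ℕ) then 1 else 0) * u y) := fun y => by
        split_ifs <;> simp
      rw [Finset.sum_congr rfl fun y _ => h3 y, h1, h2]
      have h4 : (z / ((k : ℝ) + 1))⁻¹ = k * z⁻¹ + z⁻¹ := by field_simp
      rw [h4] at hle
      linarith)
  have hG : ∀ i ∈ I, prodExp (fun _ => p) (fun b =>
      if ∃ k : ℕ, 1 ≤ k ∧ k ≤ countGE (I.erase i) (fun i => r ^ (b i : ℕ)) (z / (k + 1)) + 1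
        then ∏ k ∈ I.erase i, u (b k) else 0) ≤ (1 - q) ^ K := by
    intro i hi
    have hcard : (I.erase i).card = K := by rw [Finset.card_erase_of_mem hi, hI]; rfl
    rw [← hsum, ← hcard, ← prodExp_prod hp1]
    refine prodExp_mono (fun _ => hp0) fun b => ?_
    split_ifs
    · exact le_rfl
    · exact Finset.prod_nonneg fun _ _ => hu0 _
  have hGsum := h.trans (mul_le_mul_of_nonneg_left (Finset.sum_le_sum hG)
    (inv_nonneg.mpr hz0.le))
  rw [Finset.sum_const, hI, nsmul_eq_mul] at hGsum
  have hP := prodExp_prod (ι := ι) hp1 I u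
  rw [hsum, hI] at hP
  have hfinal : partnerProb r J I z ≤ 1 - (1 - q) ^ (K + 1) + z⁻¹ * ((K + 1 : ℕ) * (1 - q) ^ K) := by
    have h1 := prodExp_const (ι := ι) (w := fun _ => p) (fun _ => hp1) 1
    have h3 : partnerProb r J I z ≤ prodExp (fun _ => p) (fun b => (1 - ∏ i ∈ I, u (b i)) +
        if ∃ k : ℕ, 1 ≤ k ∧ k ≤ countGE I (fun i => r ^ (b i : ℕ)) (z / (k + 1))
          then ∏ i ∈ I, u (b i) else 0) := by
      refine prodExp_mono (fun _ => hp0) fun b => ?_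
      have hle1 : ∏ i ∈ I, u (b i) ≤ 1 := Finset.prod_le_one (fun _ _ => hu0 _) fun _ _ => hu1 _
      change (if ∃ k : ℕ, 1 ≤ k ∧ k ≤ countGE I (fun i => r ^ (b i : ℕ)) (z / (k + 1))
          then (1 : ℝ) else 0) ≤ _
      split_ifs <;> linarith
    rw [prodExp_add, prodExp_sub, h1, hP] at h3
    linarith
  refine hfinal.trans ?_
  have hx1 : r / z ≤ 1 := by rw [div_le_one hz0]; linarith
  have hKz : (K + 2) * r / z ≤ 1 := by rw [div_le_one hz0]; exact hz
  have h4 : (1 - r / z) ^ K ≤ (1 - q) ^ K := pow_le_pow_left₀ (by linarith) (by linarith) K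
  have h5 : 1 - (K + 2) * r / z ≤ 1 - q - (K + 1) * z⁻¹ := by
    have e1 : (K + 2) * r / z = (K + 1) * z⁻¹ * r + r / z := by field_simp; ring
    have e2 : (K + 1) * z⁻¹ ≤ (K + 1) * z⁻¹ * r :=
      le_mul_of_one_le_right (by positivity) hr.le
    linarith
  have h6 : (1 - r / z) ^ K * (1 - (K + 2) * r / z) ≤ (1 - q) ^ K * (1 - q - (K + 1) * z⁻¹) :=
    mul_le_mul h4 h5 (by linarith) (pow_nonneg (by linarith) K)
  have h7 : (1 - q) ^ (K + 1) = (1 - q) ^ K * (1 - q) := pow_succ _ _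
  push_cast
  nlinarith [h6, h7]

theorem exp_neg_le_pow {K : ℕ} {x : ℝ} (hx0 : 0 ≤ x) (hx : (K + 2) * x ≤ 1) :
    Real.exp (-((K + 2) * x)) ≤ (1 - x) ^ K := by
  have hK0 : (0 : ℝ) ≤ K := Nat.cast_nonneg K
  have hx1 : 0 < 1 - x := by nlinarith
  have h1 : (1 - x)⁻¹ ≤ Real.exp (x / (1 - x)) := by
    have := Real.add_one_le_exp (x / (1 - x))
    have e : x / (1 - x) + 1 = (1 - x)⁻¹ := by field_simp; ring
    linarith
  have h2 : Real.exp (-(x / (1 - x))) ≤ 1 - x := by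
    rw [Real.exp_neg]
    exact inv_le_of_inv_le₀ hx1 h1
  calc Real.exp (-((K + 2) * x)) ≤ Real.exp (K * -(x / (1 - x))) := by
        refine Real.exp_le_exp.mpr ?_
        rw [mul_neg, neg_le_neg_iff, ← mul_div_assoc, div_le_iff₀ hx1]
        nlinarith
    _ = Real.exp (-(x / (1 - x))) ^ K := by rw [Real.exp_nat_mul]
    _ ≤ _ := pow_le_pow_left₀ (Real.exp_pos _).le h2 K

theorem tailProb_le_of_le (hr : 1 < r) (hr2 : r ≤ 2) {A : Finset ι} (hA : 2 ≤ A.card)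
    {z : ℝ} (hz : A.card * r ≤ z) (hzJ : z ≤ r ^ J) :
    tailProb r J A z ≤
      A.card / z * (1 - (1 - A.card * r / z) * Real.exp (-(A.card * r / z))) := by
  obtain ⟨K, hK⟩ : ∃ K, A.card = K + 2 := ⟨A.card - 2, by omega⟩
  have hKc : (A.card : ℝ) = K + 2 := by exact_mod_cast hK
  have hK0 : (0 : ℝ) ≤ K := Nat.cast_nonneg K
  rw [hKc] at hz ⊢
  have hz0 : 0 < z := by nlinarith
  have hz1 : (K + 2) * r / z ≤ 1 := by rw [div_le_one hz0]; exact hz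
  refine (tailProb_le hr A hz0).trans ?_
  have h1 : ∀ i ∈ A, partnerProb r J (A.erase i) z ≤
      1 - (1 - (K + 2) * r / z) * Real.exp (-((K + 2) * r / z)) := by
    intro i hi
    refine (partnerProb_le hr hr2 (K := K) (by rw [Finset.card_erase_of_mem hi, hK]; rfl)
      hz hzJ).trans ?_
    have h2 := exp_neg_le_pow (K := K) (x := r / z) (by positivity) (by rwa [← mul_div_assoc])
    rw [← mul_div_assoc] at h2
    have h3 := mul_le_mul_of_nonneg_right h2 (sub_nonneg.mpr hz1)
    linarith
  calc z⁻¹ * ∑ i ∈ A, partnerProb r J (A.erase i) z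
      ≤ z⁻¹ * ∑ i ∈ A, (1 - (1 - (K + 2) * r / z) * Real.exp (-((K + 2) * r / z))) :=
        mul_le_mul_of_nonneg_left (Finset.sum_le_sum h1) (by positivity)
    _ = _ := by rw [Finset.sum_const, nsmul_eq_mul, hKc]; ring

theorem tailProb_le_sq (hr : 1 < r) (A : Finset ι) {z : ℝ} (hz : 0 < z) :
    tailProb r J A z ≤ 2 * (A.card : ℝ) ^ 2 / z ^ 2 := by
  refine (tailProb_le hr A hz).trans ?_
  calc z⁻¹ * ∑ i ∈ A, partnerProb r J (A.erase i) z
      ≤ z⁻¹ * ∑ i ∈ A, 2 * z⁻¹ * A.card := by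
        refine mul_le_mul_of_nonneg_left (Finset.sum_le_sum fun i _ => ?_) (by positivity)
        refine (partnerProb_le_two_mul hr _ hz).trans ?_
        have : ((A.erase i).card : ℝ) ≤ A.card := by exact_mod_cast Finset.card_erase_le
        gcongr
    _ = _ := by rw [Finset.sum_const, nsmul_eq_mul]; field_simp

end Tail

/-! ### The expected benchmark of equal-revenue bids -/

section Mean

/-- The function `1 - (1 - t) * exp (-t)`. -/
noncomputable def partnerBound (t : ℝ) : ℝ := 1 - (1 - t) * Real.exp (-t)

/-- The continuous extension of `(1 - (1 - t) * exp (-t)) / t`. -/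
noncomputable def partnerRate : ℝ → ℝ := dslope partnerBound 0

theorem partnerBound_zero : partnerBound 0 = 0 := by simp [partnerBound]

theorem differentiable_partnerBound : Differentiable ℝ partnerBound := by
  unfold partnerBound
  fun_prop

theorem mul_partnerRate (t : ℝ) : t * partnerRate t = partnerBound t := by
  have h := sub_smul_dslope partnerBound 0 t
  simpa [partnerBound_zero, partnerRate] using h

theorem continuous_partnerRate : Continuous partnerRate := by
  rw [← continuousOn_univ]
  exact (continuousOn_dslope univ_mem).mpr
    ⟨differentiable_partnerBound.continuous.continuousOn, differentiable_partnerBound 0⟩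

theorem partnerBound_nonneg {t : ℝ} (ht : 0 ≤ t) : 0 ≤ partnerBound t := by
  unfold partnerBound
  have h1 := Real.add_one_le_exp (-t)
  have h2 : Real.exp (-t) * (1 - t) ≤ Real.exp (-t) * Real.exp (-t) :=
    mul_le_mul_of_nonneg_left (by linarith) (Real.exp_pos _).le
  have h3 : Real.exp (-t) ≤ 1 := Real.exp_le_one_iff.mpr (by linarith)
  nlinarith [Real.exp_pos (-t)]

/-- The excess of the limit ratio over `1`. -/
noncomputable def limitExcess : ℝ := ∫ t in (0 : ℝ)..1, partnerRate t

theorem integral_partnerRate_nonneg {τ : ℝ} (hτ : 0 ≤ τ) :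
    0 ≤ ∫ t in (0 : ℝ)..τ, partnerRate t := by
  refine intervalIntegral.integral_nonneg_of_ae_restrict hτ ?_
  rw [Filter.EventuallyLE, ae_restrict_iff' measurableSet_Icc]
  have : ∀ᵐ t : ℝ, t ≠ 0 := by simp [ae_iff]
  filter_upwards [this] with t ht0 ht
  have h0 : 0 < t := lt_of_le_of_ne ht.1 (Ne.symm ht0)
  have h1 := partnerBound_nonneg ht.1
  rw [← mul_partnerRate] at h1
  exact nonneg_of_mul_nonneg_right h1 h0

theorem limitExcess_nonneg : 0 ≤ limitExcess := integral_partnerRate_nonneg zero_le_one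

/-- The substitution `t = a / z` in the integral of the tail bound. -/
theorem integral_partnerBound_le {K a b : ℝ} (hK : 0 ≤ K) (ha : 0 < a) (hab : a ≤ b) :
    ∫ z in a..b, K / z * partnerBound (a / z) ≤ K * limitExcess := by
  have hderiv : ∀ z ∈ Set.uIcc a b, HasDerivAt
      (fun z => -(K * ∫ t in (0 : ℝ)..(a / z), partnerRate t)) (K / z * partnerBound (a / z)) z := by
    intro z hz
    rw [Set.uIcc_of_le hab] at hz
    have hz0 : z ≠ 0 := (ha.trans_le hz.1).ne'
    have h1 : HasDerivAt (fun z : ℝ => a / z) (-(a / z ^ 2)) z := by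
      have := (hasDerivAt_inv hz0).const_mul a
      simpa [div_eq_mul_inv] using this
    have h2 := (continuous_partnerRate.integral_hasStrictDerivAt 0 (a / z)).hasDerivAt
    have h3 := ((h2.comp z h1).const_mul K).neg
    refine h3.congr_deriv ?_
    rw [← mul_partnerRate]
    field_simp
  have hint : IntervalIntegrable (fun z => K / z * partnerBound (a / z)) volume a b := by
    refine ContinuousOn.intervalIntegrable ?_
    have hz0 : ∀ z ∈ Set.uIcc a b, z ≠ 0 := fun z hz => by
      rw [Set.uIcc_of_le hab] at hz
      exact (ha.trans_le hz.1).ne'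
    exact (continuousOn_const.div continuousOn_id hz0).mul
      (differentiable_partnerBound.continuous.comp_continuousOn
        (continuousOn_const.div continuousOn_id hz0))
  rw [intervalIntegral.integral_eq_sub_of_hasDerivAt hderiv hint, div_self ha.ne']
  have := mul_nonneg hK (integral_partnerRate_nonneg (div_nonneg ha.le (ha.le.trans hab)))
  rw [limitExcess]
  linarith

theorem integral_two_sq_div_le {K a b : ℝ} (ha : 0 < a) (hab : a ≤ b) :
    ∫ z in a..b, 2 * K ^ 2 / z ^ 2 ≤ 2 * K ^ 2 / a := by
  have hz0 : ∀ z ∈ Set.uIcc a b, z ≠ 0 := fun z hz => by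
    rw [Set.uIcc_of_le hab] at hz
    exact (ha.trans_le hz.1).ne'
  have hderiv : ∀ z ∈ Set.uIcc a b, HasDerivAt (fun z => -(2 * K ^ 2 / z))
      (2 * K ^ 2 / z ^ 2) z := by
    intro z hz
    have := ((hasDerivAt_inv (hz0 z hz)).const_mul (2 * K ^ 2)).neg
    simpa [div_eq_mul_inv, Pi.neg_def] using this
  have hint : IntervalIntegrable (fun z => 2 * K ^ 2 / z ^ 2) volume a b := by
    refine ContinuousOn.intervalIntegrable ?_
    exact continuousOn_const.div (continuousOn_id.pow 2) fun z hz => pow_ne_zero 2 (hz0 z hz)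
  rw [intervalIntegral.integral_eq_sub_of_hasDerivAt hderiv hint]
  have : 0 ≤ 2 * K ^ 2 / b := div_nonneg (by positivity) (ha.le.trans hab)
  linarith

variable {ι : Type*} [DecidableEq ι] {J : ℕ} {r : ℝ}

theorem twoBuyer_bids_le (hr : 1 < r) (A : Finset ι) (b : ι → Fin (J + 1)) :
    twoBuyer A (bids r b) ≤ A.card * r ^ J := by
  have h0 : (0 : ℝ) ≤ A.card * r ^ J := by positivity
  rw [twoBuyer_le_iff h0]
  intro t k ht hk hkA
  have hpos : 0 < countGE A (bids r b) t := by omega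
  obtain ⟨i, hi⟩ := Finset.card_pos.mp hpos
  have hit := (Finset.mem_filter.mp hi).2
  have h1 : t ≤ r ^ J := hit.trans (pow_le_pow_right₀ hr.le (Nat.lt_succ_iff.mp (b i).isLt))
  have h2 : (k : ℝ) ≤ A.card := by exact_mod_cast hkA.trans (countGE_le_card _ _ _)
  exact mul_le_mul h2 h1 ht (Nat.cast_nonneg _)

theorem twoBuyer_of_card_le_one {A : Finset ι} (hA : A.card ≤ 1) (x : ι → ℝ) :
    twoBuyer A x = 0 := by
  refine le_antisymm ((twoBuyer_le_iff le_rfl).mpr fun t k _ hk hkA => ?_) (twoBuyer_nonneg _ _)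
  have := hkA.trans (countGE_le_card A x t)
  omega

variable [Fintype ι]

/-- The layer cake formula for the benchmark. -/
theorem meanTwoBuyer_eq_integral (A : Finset ι) {Z : ℝ}
    (hZ : ∀ b : ι → Fin (J + 1), twoBuyer A (bids r b) ≤ Z) :
    meanTwoBuyer r J A 0 = ∫ z in (0 : ℝ)..Z, tailProb r J A z := by
  have hlayer : ∀ b : ι → Fin (J + 1),
      ∫ z in (0 : ℝ)..Z, (if z ≤ twoBuyer A (bids r b) then (1 : ℝ) else 0) =
        twoBuyer A (bids r b) := by
    intro b
    have := intervalIntegral.integral_indicator (f := fun _ : ℝ => (1 : ℝ)) (μ := volume)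
      (a₁ := 0) (a₂ := twoBuyer A (bids r b)) (a₃ := Z) ⟨twoBuyer_nonneg _ _, hZ b⟩
    simpa [Set.indicator] using this
  have hint : ∀ b : ι → Fin (J + 1), IntervalIntegrable
      (fun z => if z ≤ twoBuyer A (bids r b) then (1 : ℝ) else 0) volume 0 Z := by
    intro b
    refine AntitoneOn.intervalIntegrable fun z _ z' _ hz => ?_
    split_ifs with h1 h2 h2
    · exact le_rfl
    · exact absurd (hz.trans h1) h2
    · norm_num
    · exact le_rfl
  unfold tailProb prodExp
  rw [intervalIntegral.integral_finsetSum fun b _ => (hint b).const_mul _]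
  simp only [intervalIntegral.integral_const_mul, hlayer]
  rfl

theorem meanTwoBuyer_zero_le (hr : 1 < r) (hr2 : r ≤ 2) (hJ : Fintype.card ι * r ≤ r ^ J)
    (A : Finset ι) :
    meanTwoBuyer r J A 0 ≤ A.card * (r + limitExcess + 2 * Fintype.card ι / r ^ J) := by
  have hr0 : 0 < r := by positivity
  have hV : 0 < r ^ J := by positivity
  have hex := limitExcess_nonneg
  rcases Nat.lt_or_ge A.card 2 with hA | hA
  · have : meanTwoBuyer r J A 0 = 0 := by
      simp [meanTwoBuyer, twoBuyer_of_card_le_one (Nat.lt_succ_iff.mp hA), prodExp]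
    rw [this]
    positivity
  have hKn : (A.card : ℝ) ≤ Fintype.card ι := by exact_mod_cast A.card_le_univ
  have hK1 : (2 : ℝ) ≤ A.card := by exact_mod_cast hA
  set K : ℝ := (A.card : ℝ) with hK
  set V := r ^ J with hVdef
  have hKV : K * r ≤ V := (mul_le_mul_of_nonneg_right hKn hr0.le).trans hJ
  have hKr : 0 < K * r := by positivity
  have hVZ : V ≤ K * V := le_mul_of_one_le_left hV.le (by linarith)
  have hii : ∀ a b, IntervalIntegrable (tailProb r J A) volume a b := fun a b =>
    ((tailProb_antitone hr A).antitoneOn _).intervalIntegrable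
  rw [meanTwoBuyer_eq_integral A (twoBuyer_bids_le hr A),
    ← intervalIntegral.integral_add_adjacent_intervals (hii 0 V) (hii V _),
    ← intervalIntegral.integral_add_adjacent_intervals (hii 0 (K * r)) (hii _ V)]
  have h1 : ∫ z in (0 : ℝ)..(K * r), tailProb r J A z ≤ K * r := by
    have := intervalIntegral.integral_mono_on hKr.le (hii 0 (K * r))
      (intervalIntegrable_const (c := (1 : ℝ))) fun z _ => tailProb_le_one hr A z
    simpa using this
  have h2 : ∫ z in (K * r)..V, tailProb r J A z ≤ K * limitExcess := by
    refine le_trans (intervalIntegral.integral_mono_on hKV (hii _ _) ?_ fun z hz => ?_)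
      (integral_partnerBound_le (K := K) (by linarith) hKr hKV)
    · refine ContinuousOn.intervalIntegrable ?_
      have hz0 : ∀ z ∈ Set.uIcc (K * r) V, z ≠ 0 := fun z hz => by
        rw [Set.uIcc_of_le hKV] at hz
        exact (hKr.trans_le hz.1).ne'
      exact (continuousOn_const.div continuousOn_id hz0).mul
        (differentiable_partnerBound.continuous.comp_continuousOn
          (continuousOn_const.div continuousOn_id hz0))
    · exact tailProb_le_of_le hr hr2 hA hz.1 hz.2
  have h3 : ∫ z in V..(K * V), tailProb r J A z ≤ 2 * K ^ 2 / V := by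
    refine le_trans (intervalIntegral.integral_mono_on hVZ (hii _ _) ?_ fun z hz => ?_)
      (integral_two_sq_div_le hV hVZ)
    · refine ContinuousOn.intervalIntegrable ?_
      exact continuousOn_const.div (continuousOn_id.pow 2) fun z hz => by
        rw [Set.uIcc_of_le hVZ] at hz
        exact pow_ne_zero 2 (hV.trans_le hz.1).ne'
    · exact tailProb_le_sq hr A (hV.trans_le hz.1)
  have h4 : 2 * K ^ 2 / V ≤ K * (2 * Fintype.card ι / V) := by
    rw [← mul_div_assoc]
    exact div_le_div_of_nonneg_right (by nlinarith) hV.le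
  linarith

end Mean

/-! ### The limit of the offline ratios -/

section Limit

/-- The absolute values of the terms of the alternating series for `limitExcess`. -/
noncomputable def excessTerm (m : ℕ) : ℝ :=
  ((m : ℝ) + 2) / (((m : ℝ) + 1) * (m + 1).factorial)

theorem excessTerm_antitone : Antitone excessTerm := by
  refine antitone_nat_of_succ_le fun m => ?_
  unfold excessTerm
  rw [Nat.factorial_succ (m + 1), div_le_div_iff₀ (by positivity) (by positivity)]
  push_cast
  have h : (0 : ℝ) ≤ m := Nat.cast_nonneg m
  have hf : (0 : ℝ) < (m + 1).factorial := by exact_mod_cast Nat.factorial_pos _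
  have : ((m : ℝ) + 1 + 2) * (m + 1) ≤ (m + 2) * ((m + 1 + 1) * (m + 1 + 1)) := by
    nlinarith [mul_nonneg h h, mul_nonneg h (mul_nonneg h h)]
  nlinarith [mul_le_mul_of_nonneg_right this hf.le]

theorem summable_succ_div_factorial :
    Summable fun m : ℕ => ((m : ℝ) + 2) / (m + 1).factorial := by
  have h1 : Summable fun m : ℕ => (1 : ℝ) / m.factorial := by
    simpa using Real.summable_pow_div_factorial 1
  have h2 : Summable fun m : ℕ => (1 : ℝ) / (m + 1).factorial := (summable_nat_add_iff 1).mpr h1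
  refine (h1.add h2).congr fun m => ?_
  rw [Nat.factorial_succ]
  push_cast
  have hf : (0 : ℝ) < m.factorial := by exact_mod_cast Nat.factorial_pos _
  field_simp
  ring

theorem hasSum_partnerRate {t : ℝ} (ht : t ≠ 0) :
    HasSum (fun m : ℕ => (-1) ^ m * (((m : ℝ) + 2) / (m + 1).factorial) * t ^ m)
      (partnerRate t) := by
  have h0 : HasSum (fun n : ℕ => (-t) ^ n / n.factorial) (Real.exp (-t)) := by
    rw [Real.exp_eq_exp_ℝ]
    exact NormedSpace.expSeries_div_hasSum_exp (-t)
  have h1 := (hasSum_nat_add_iff' 1).mpr h0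
  have h2 := ((h0.mul_left t).sub h1).div_const t
  have h3 : (t * Real.exp (-t) - (Real.exp (-t) -
      ∑ i ∈ Finset.range 1, (-t) ^ i / (i.factorial : ℝ))) / t = partnerRate t := by
    rw [div_eq_iff ht, mul_comm (partnerRate t), mul_partnerRate, partnerBound]
    simp
    ring
  rw [h3] at h2
  refine h2.congr_fun fun m => ?_
  rw [Nat.factorial_succ]
  have hf : (0 : ℝ) < m.factorial := by exact_mod_cast Nat.factorial_pos _
  rw [neg_pow t, neg_pow t (m + 1), pow_succ, pow_succ]
  push_cast
  field_simp
  ring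

theorem hasSum_limitExcess : HasSum (fun m : ℕ => (-1) ^ m * excessTerm m) limitExcess := by
  have h := intervalIntegral.hasSum_integral_of_dominated_convergence (μ := volume)
    (a := (0 : ℝ)) (b := 1) (f := partnerRate)
    (F := fun (m : ℕ) t => (-1) ^ m * (((m : ℝ) + 2) / (m + 1).factorial) * t ^ m)
    (fun m _ => ((m : ℝ) + 2) / (m + 1).factorial)
    (fun m => (Continuous.aestronglyMeasurable (by fun_prop)))
    (fun m => Eventually.of_forall fun t ht => ?_)
    (Eventually.of_forall fun _ _ => summable_succ_div_factorial) intervalIntegrable_const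
    (Eventually.of_forall fun t ht => hasSum_partnerRate ?_)
  · refine h.congr_fun fun m => ?_
    rw [intervalIntegral.integral_const_mul, integral_pow, excessTerm]
    field_simp
    simp
  · rw [Set.uIoc_of_le zero_le_one] at ht
    rw [norm_mul, norm_mul, norm_pow, norm_neg, norm_one, one_pow, one_mul,
      Real.norm_of_nonneg (by positivity), Real.norm_of_nonneg (pow_nonneg ht.1.le m)]
    exact mul_le_of_le_one_right (by positivity) (pow_le_one₀ ht.1.le ht.2)
  · rw [Set.uIoc_of_le zero_le_one] at ht
    exact ht.1.ne'

theorem limitExcess_bounds : 1.42 ≤ limitExcess ∧ limitExcess < 1.43 := by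
  have h := hasSum_limitExcess.tendsto_sum_nat
  have h1 := excessTerm_antitone.alternating_series_le_tendsto h 2
  have h2 := excessTerm_antitone.tendsto_le_alternating_series h 3
  norm_num [Finset.sum_range_succ, excessTerm, Nat.factorial] at h1 h2
  constructor <;> norm_num <;> linarith

theorem offlineRatio_succ_eq (n : ℕ) : offlineRatio (n + 1) =
    1 + ∑' m : ℕ, (-1) ^ m * (((m : ℝ) + 2) / (m + 1)) *
      ((n.choose (m + 1) : ℝ) * (1 / ((n : ℝ) + 1)) ^ (m + 1)) := by
  rw [tsum_eq_sum (s := Finset.range n) fun m hm => by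
    rw [Nat.choose_eq_zero_of_lt (by simpa using hm)]; simp]
  rw [offlineRatio, sub_eq_add_neg, ← Finset.sum_neg_distrib]
  congr 1
  refine Finset.sum_bij' (fun i _ => i - 2) (fun m _ => m + 2) ?_ ?_ ?_ ?_ ?_
  · intro i hi
    simp only [Finset.mem_Icc, Finset.mem_range] at hi ⊢
    omega
  · intro m hm
    simp only [Finset.mem_Icc, Finset.mem_range] at hm ⊢
    omega
  · intro i hi
    simp only [Finset.mem_Icc] at hi
    omega
  · intro m _
    rfl
  · intro i hi
    simp only [Finset.mem_Icc] at hi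
    obtain ⟨m, rfl⟩ : ∃ m, i = m + 2 := ⟨i - 2, by omega⟩
    rw [Nat.add_sub_cancel, Nat.add_sub_cancel, show m + 2 - 1 = m + 1 from rfl, neg_div, neg_pow,
      pow_succ (-1 : ℝ)]
    push_cast
    have e : (m : ℝ) + 2 - 1 = m + 1 := by ring
    rw [e]
    ring

theorem tendsto_offlineRatio : Tendsto offlineRatio atTop (𝓝 (1 + limitExcess)) := by
  rw [← tendsto_add_atTop_iff_nat 1, ← hasSum_limitExcess.tsum_eq]
  simp only [offlineRatio_succ_eq]
  refine tendsto_const_nhds.add (tendsto_tsum_of_dominated_convergence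
    summable_succ_div_factorial (fun m => ?_) (Eventually.of_forall fun n m => ?_))
  · have h1 : Tendsto (fun n : ℕ => (n : ℝ) * (1 / ((n : ℝ) + 1))) atTop (𝓝 1) := by
      simpa [div_eq_mul_inv] using tendsto_natCast_div_add_atTop (1 : ℝ)
    have h2 := (ProbabilityTheory.tendsto_choose_mul_pow_atTop (m + 1) h1).const_mul
      ((-1 : ℝ) ^ m * (((m : ℝ) + 2) / (m + 1)))
    convert h2 using 2
    rw [excessTerm]
    field_simp
    simp
  · rw [norm_mul, norm_mul, norm_pow, norm_neg, norm_one, one_pow, one_mul,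
      Real.norm_of_nonneg (by positivity), Real.norm_of_nonneg (by positivity)]
    have hn : (0 : ℝ) < (n : ℝ) + 1 := by positivity
    have hf : (0 : ℝ) < (m + 1).factorial := by exact_mod_cast Nat.factorial_pos _
    have h1 : (n.choose (m + 1) : ℝ) * (1 / ((n : ℝ) + 1)) ^ (m + 1) ≤ 1 / (m + 1).factorial := by
      rw [one_div, inv_pow, ← div_eq_mul_inv, div_le_iff₀ (by positivity)]
      refine (Nat.choose_le_pow_div (α := ℝ) (m + 1) n).trans ?_
      rw [div_eq_mul_one_div, mul_comm]
      gcongr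
      linarith
    calc ((m : ℝ) + 2) / (m + 1) * ((n.choose (m + 1) : ℝ) * (1 / ((n : ℝ) + 1)) ^ (m + 1))
        ≤ ((m : ℝ) + 2) * (1 / (m + 1).factorial) := by
          refine mul_le_mul ?_ h1 (by positivity) (by positivity)
          exact div_le_self (by positivity) (by linarith [Nat.cast_nonneg (α := ℝ) m])
      _ = _ := by ring

end Limit

/-! ### Charges for a fixed number of bidders -/

section Charges

/-- For every `β` above the limit ratio and bids on a sufficiently fine and large grid, the benchmark
can be split into charges of the individual bidders which are monotone in the own bid and have
expectation at most `β` over an own bid that follows the equal-revenue law. -/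
theorem exists_grid_charges (n : ℕ) [NeZero n] {β ε : ℝ} (hβ : 1 + limitExcess < β) (hε : 0 < ε) :
    ∃ r : ℝ, 1 < r ∧ r < 1 + ε ∧ ∀ᶠ J : ℕ in atTop,
      ∃ ρ : (Fin n → Fin (J + 1)) → Fin n → ℝ, (∀ b i, 0 ≤ ρ b i) ∧
        (∀ b i, Monotone fun y => ρ (update b i y) i) ∧
        (∀ (σ : Equiv.Perm (Fin n)) b i, ρ (b ∘ σ) i = ρ b (σ i)) ∧
        (∀ b, ∑ i, ρ b i = twoBuyer Finset.univ (bids r b)) ∧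
        ∀ b i, ∑ y, erLaw r J 0 y * ρ (update b i y) i ≤ β := by
  have hcont : Tendsto (fun r : ℝ => n * (1 - r⁻¹) + (r + limitExcess) * (1 + n * (1 - r⁻¹ ^ n)))
      (𝓝[>] 1) (𝓝 (1 + limitExcess)) := by
    have : ContinuousAt (fun r : ℝ =>
        n * (1 - r⁻¹) + (r + limitExcess) * (1 + n * (1 - r⁻¹ ^ n))) 1 := by
      have : ContinuousAt (fun r : ℝ => r⁻¹) 1 := continuousAt_inv₀ one_ne_zero
      fun_prop
    have h := this.tendsto
    simp only [inv_one, sub_self, one_pow, mul_zero, add_zero, mul_one, zero_add] at h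
    exact h.mono_left nhdsWithin_le_nhds
  have hev : ∀ᶠ r : ℝ in 𝓝[>] 1, r < 1 + min ε 1 :=
    nhdsWithin_le_nhds (Iio_mem_nhds (by simp [hε]))
  obtain ⟨r, ⟨hrβ, hrε⟩, hr⟩ := (((hcont.eventually (Iio_mem_nhds hβ)).and hev).and
    self_mem_nhdsWithin).exists
  have hr : 1 < r := hr
  have hr2 : r ≤ 2 := by have := min_le_right ε 1; linarith
  refine ⟨r, hr, by have := min_le_left ε 1; linarith, ?_⟩
  have hpow : Tendsto (fun J : ℕ => r ^ J) atTop atTop := tendsto_pow_atTop_atTop_of_one_lt hr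
  have hJlim : Tendsto (fun J : ℕ => n * (1 - r⁻¹) +
      (r + limitExcess + 2 * n / r ^ J) * (1 + n * (1 - r⁻¹ ^ n))) atTop
      (𝓝 (n * (1 - r⁻¹) + (r + limitExcess) * (1 + n * (1 - r⁻¹ ^ n)))) := by
    have h1 := tendsto_const_nhds.div_atTop hpow (a := 2 * (n : ℝ))
    have h2 := ((tendsto_const_nhds (x := r + limitExcess)).add h1).mul_const
      (1 + n * (1 - r⁻¹ ^ n))
    simpa using (tendsto_const_nhds (x := n * (1 - r⁻¹))).add h2
  filter_upwards [hJlim.eventually (Iio_mem_nhds hrβ), hpow.eventually_ge_atTop (n * r)]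
    with J hJβ hJn
  have hcard : Fintype.card (Fin n) = n := Fintype.card_fin n
  have hex := limitExcess_nonneg
  have hC : 0 ≤ r + limitExcess + 2 * n / r ^ J := by positivity
  have hq : 0 ≤ 1 - r⁻¹ ^ n :=
    sub_nonneg.mpr (pow_le_one₀ (by positivity) (inv_le_one_of_one_le₀ hr.le))
  have hq' : 0 ≤ 1 - r⁻¹ := sub_nonneg.mpr (inv_le_one_of_one_le₀ hr.le)
  have hCβ : r + limitExcess + 2 * n / r ^ J ≤ n * (1 - r⁻¹) +
      (r + limitExcess + 2 * n / r ^ J) * (1 + n * (1 - r⁻¹ ^ n)) := by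
    have h1 : 0 ≤ (r + limitExcess + 2 * n / r ^ J) * (n * (1 - r⁻¹ ^ n)) := by positivity
    have h2 : 0 ≤ n * (1 - r⁻¹) := by positivity
    linarith
  refine exists_charges (ι := Fin n) (erLaw_pos hr) (sum_erLaw hr (Nat.zero_le J))
    (fun b => twoBuyer_nonneg _ _) (fun b b' h => twoBuyer_mono fun i _ => bids_mono hr (h i))
    (fun σ b => twoBuyer_comp_perm σ (by simp) (bids r b)) (hC.trans hCβ) hJβ ?_
  intro l hl hl0
  refine prodExp_twoBuyer_mul_le hr hC (fun A => ?_) (by rw [hcard]) hCβ hl hl0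
  have := meanTwoBuyer_zero_le (ι := Fin n) hr hr2 (by rw [hcard]; exact hJn) A
  rwa [hcard] at this

end Charges

/-! ### Charges for all bids -/

section Scale

variable {r : ℝ}

/-- The level of a bid `x` on the grid `r ^ (-M), …, r ^ M`: the bid is rounded down, bids below
the grid have level `0`, and bids above the grid have level `2 * M`. -/
noncomputable def gridLevel (r : ℝ) (M : ℕ) (x : ℝ≥0) : Fin (2 * M + 1) :=
  ⟨open Classical in Nat.findGreatest (fun l => r ^ l ≤ x * r ^ M) (2 * M),
    Nat.lt_succ_of_le (Nat.findGreatest_le _)⟩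

theorem gridLevel_mono (hr : 1 < r) (M : ℕ) : Monotone (gridLevel r M) := by
  classical
  intro x x' h
  rw [Fin.le_def]
  refine Nat.findGreatest_mono_left (fun l hl => hl.trans ?_) _
  exact mul_le_mul_of_nonneg_right (by exact_mod_cast h) (pow_pos (one_pos.trans hr) M).le

theorem pow_gridLevel_le (r : ℝ) (M : ℕ) (x : ℝ≥0) :
    r ^ (gridLevel r M x : ℕ) ≤ max ((x : ℝ) * r ^ M) 1 := by
  classical
  by_cases h : (gridLevel r M x : ℕ) = 0
  · rw [h, pow_zero]; exact le_max_right _ _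
  · exact le_max_of_le_left (Nat.findGreatest_of_ne_zero (P := fun l => r ^ l ≤ x * r ^ M) rfl h)

theorem le_pow_gridLevel_succ {M : ℕ} {x : ℝ≥0} (hr : 1 < r) (hx : (x : ℝ) ≤ r ^ M) :
    x * r ^ M ≤ r ^ ((gridLevel r M x : ℕ) + 1) := by
  classical
  rcases Nat.lt_or_ge (gridLevel r M x : ℕ) (2 * M) with h | h
  · exact (not_le.mp (Nat.findGreatest_is_greatest (P := fun l => r ^ l ≤ x * r ^ M)
      (Nat.lt_succ_self _) h)).le
  · calc x * r ^ M ≤ r ^ M * r ^ M := mul_le_mul_of_nonneg_right hx (by positivity)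
      _ = r ^ (2 * M) := by rw [← pow_add, two_mul]
      _ ≤ _ := pow_le_pow_right₀ hr.le (by omega)

theorem gridLevel_eq (hr : 1 < r) {M m j : ℕ} (hm : m ≤ M) (hj : j ≤ 2 * m) {x : ℝ≥0}
    (hx : (x : ℝ) = r ^ j / r ^ m) : (gridLevel r M x : ℕ) = j + (M - m) := by
  classical
  have hr0 : 0 < r := by positivity
  have h : (x : ℝ) * r ^ M = r ^ (j + (M - m)) := by
    rw [hx, div_mul_eq_mul_div, div_eq_iff (by positivity), ← pow_add, ← pow_add]
    congr 1
    omega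
  rw [gridLevel]
  simp only [h, pow_le_pow_iff_right₀ hr]
  rw [Nat.findGreatest_eq_iff]
  refine ⟨by omega, fun _ => le_rfl, fun l hl _ => by omega⟩

/-- Summation by parts for expectations with respect to the equal-revenue law. -/
theorem sum_erLaw_mul (r : ℝ) (J : ℕ) (φ : ℕ → ℝ) :
    ∑ x : Fin (J + 1), erLaw r J 0 x * φ x =
      φ 0 + ∑ j ∈ Finset.range J, (φ (j + 1) - φ j) * r⁻¹ ^ (j + 1) := by
  have h1 : ∀ x : Fin (J + 1), erLaw r J 0 x * φ x =
      r⁻¹ ^ (x : ℕ) * φ x - if (x : ℕ) < J then r⁻¹ ^ ((x : ℕ) + 1) * φ x else 0 := by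
    intro x
    have := x.isLt
    unfold erLaw
    rw [if_neg (by omega : ¬ (x : ℕ) < 0)]
    split_ifs with h2 h3 h3
    · omega
    · rw [h2]; ring
    · ring
    · omega
  rw [Finset.sum_congr rfl fun x _ => h1 x, Finset.sum_sub_distrib,
    Fin.sum_univ_eq_sum_range (fun x => r⁻¹ ^ x * φ x),
    Fin.sum_univ_eq_sum_range (fun x => if x < J then r⁻¹ ^ (x + 1) * φ x else 0),
    Finset.sum_range_succ', Finset.sum_range_succ, if_neg (lt_irrefl J), add_zero,
    Finset.sum_congr rfl (fun x hx => if_pos (Finset.mem_range.mp hx))]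
  have h2 : ∀ j, (φ (j + 1) - φ j) * r⁻¹ ^ (j + 1) =
      r⁻¹ ^ (j + 1) * φ (j + 1) - r⁻¹ ^ (j + 1) * φ j := fun j => by ring
  simp only [h2, Finset.sum_sub_distrib]
  ring

/-- Properties of charges `T b i` of the bidders `i` for the bids `b` which allow to collect them in
expectation by random prices: a charge is monotone in the own bid, is at most the own bid (up to
bids below `δ`), and, by `window`, the required probabilities of the prices
`r ^ (1 - m), …, r ^ m` add up to at most `1`. -/
structure IsCharge (r : ℝ) {n : ℕ} (T : (Fin n → ℝ≥0) → Fin n → ℝ) (m : ℕ) (δ : ℝ) :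
    Prop where
  nonneg : ∀ b i, 0 ≤ T b i
  mono : ∀ b i, Monotone fun x => T (update b i x) i
  comp_perm : ∀ (σ : Equiv.Perm (Fin n)) b i, T (b ∘ σ) i = T b (σ i)
  le : ∀ b i, T b i ≤ max (b i : ℝ) δ
  window : ∀ b i, ∀ x : ℕ → ℝ≥0, (∀ j, (x j : ℝ) = r ^ j / r ^ m) →
    ∑ j ∈ Finset.range (2 * m), (T (update b i (x (j + 1))) i - T (update b i (x j)) i) /
      x (j + 1) ≤ 1

theorem exists_isCharge_of_grid (hr : 1 < r) {n M : ℕ} {β : ℝ} (hβ : 0 < β)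
    {ρ : (Fin n → Fin (2 * M + 1)) → Fin n → ℝ} (h0 : ∀ b i, 0 ≤ ρ b i)
    (hmono : ∀ b i, Monotone fun y => ρ (update b i y) i)
    (hperm : ∀ (σ : Equiv.Perm (Fin n)) b i, ρ (b ∘ σ) i = ρ b (σ i))
    (hsum : ∀ b, ∑ i, ρ b i = twoBuyer Finset.univ (bids r b))
    (hle : ∀ b i, ∑ y, erLaw r (2 * M) 0 y * ρ (update b i y) i ≤ β) :
    ∃ T : (Fin n → ℝ≥0) → Fin n → ℝ, (∀ m ≤ M, IsCharge r T m (r ^ M)⁻¹) ∧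
      ∀ b (s : ℝ≥0) (N : ℕ), (s : ℝ) ≤ r ^ M → 2 ≤ N →
        N ≤ (Finset.univ.filter fun i => s ≤ b i).card → N * (s : ℝ) / (r * β) ≤ ∑ i, T b i := by
  classical
  have hr0 : 0 < r := by positivity
  have hrM : 0 < r ^ M := by positivity
  have hlev : ∀ (b : Fin n → ℝ≥0) i x, (fun k => gridLevel r M (update b i x k)) =
      update (fun k => gridLevel r M (b k)) i (gridLevel r M x) := fun b i x => by
    ext k
    by_cases hk : k = i
    · subst hk; simp
    · simp [hk]
  refine ⟨fun b i => ρ (fun k => gridLevel r M (b k)) i / (β * r ^ M), fun m hm => ⟨fun b i =>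
    div_nonneg (h0 _ _) (by positivity), fun b i x x' hx => ?_, fun σ b i => ?_, fun b i => ?_,
    fun b i x hx => ?_⟩, fun b s N hs hN hNb => ?_⟩
  · simp only [hlev]
    exact div_le_div_of_nonneg_right (hmono _ i (gridLevel_mono hr M hx)) (by positivity)
  · rw [← hperm σ]
    rfl
  · -- The charge at level `a` is paid with probability at least `r ^ (-a)`.
    set a := gridLevel r M (b i) with ha
    set c : Fin n → Fin (2 * M + 1) := fun k => gridLevel r M (b k) with hc
    have h1 : ρ c i * r⁻¹ ^ (a : ℕ) ≤ β := by
      refine le_trans ?_ (hle c i)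
      rw [← sum_erLaw_ge hr (Nat.lt_succ_iff.mp a.isLt), Finset.mul_sum]
      refine Finset.sum_le_sum fun y _ => ?_
      split_ifs with hy
      · rw [mul_comm]
        refine mul_le_mul_of_nonneg_left ?_ (erLaw_nonneg hr _ _)
        have := hmono c i (Fin.le_def.mpr hy)
        simpa [ha, hc] using this
      · rw [mul_zero]
        exact mul_nonneg (erLaw_nonneg hr _ _) (h0 _ _)
    have h2 : ρ c i ≤ β * r ^ (a : ℕ) := by
      rwa [inv_pow, ← div_eq_mul_inv, div_le_iff₀ (by positivity)] at h1
    have h3 := pow_gridLevel_le r M (b i)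
    rw [div_le_iff₀ (by positivity)]
    calc ρ c i ≤ β * max ((b i : ℝ) * r ^ M) 1 :=
          h2.trans (mul_le_mul_of_nonneg_left h3 hβ.le)
      _ = max (b i : ℝ) (r ^ M)⁻¹ * (β * r ^ M) := by
          rw [mul_left_comm, max_mul_of_nonneg _ _ hrM.le, inv_mul_cancel₀ hrM.ne']
  · simp only [hlev]
    set c : Fin n → Fin (2 * M + 1) := fun k => gridLevel r M (b k) with hc
    let φ : ℕ → ℝ := fun l => ρ (update c i ⟨min l (2 * M), by omega⟩) i
    have hφmono : Monotone φ := fun l l' hl =>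
      hmono c i (Fin.le_def.mpr (min_le_min_right _ hl))
    have hφ : ∀ y : Fin (2 * M + 1), φ y = ρ (update c i y) i := fun y => by
      have : (⟨min (y : ℕ) (2 * M), by omega⟩ : Fin (2 * M + 1)) = y :=
        Fin.ext (min_eq_left (Nat.lt_succ_iff.mp y.isLt))
      simp only [φ, this]
    have hgx : ∀ j ≤ 2 * m, ρ (update c i (gridLevel r M (x j))) i = φ (j + (M - m)) :=
      fun j hj => by rw [← gridLevel_eq hr hm hj (hx j), hφ]
    set D : ℕ → ℝ := fun j => (φ (j + 1) - φ j) * r⁻¹ ^ (j + 1) with hD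
    have hD0 : ∀ j, 0 ≤ D j := fun j =>
      mul_nonneg (sub_nonneg.mpr (hφmono (Nat.le_succ j))) (by positivity)
    have hterm : ∀ j ∈ Finset.range (2 * m),
        (ρ (update c i (gridLevel r M (x (j + 1)))) i / (β * r ^ M) -
          ρ (update c i (gridLevel r M (x j))) i / (β * r ^ M)) / x (j + 1) =
        D (M - m + j) / β := by
      intro j hj
      have hj := Finset.mem_range.mp hj
      rw [hgx j hj.le, hgx (j + 1) hj, hx, hD]
      dsimp only
      rw [show M - m + j + 1 = j + 1 + (M - m) by omega, show M - m + j = j + (M - m) by omega,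
        inv_pow, pow_add r (j + 1), ← pow_sub_mul_pow r hm]
      field_simp
    rw [Finset.sum_congr rfl hterm, ← Finset.sum_div, div_le_one hβ]
    have hEφ := sum_erLaw_mul r (2 * M) φ
    rw [Finset.sum_congr rfl fun y _ => by rw [hφ y]] at hEφ
    calc ∑ j ∈ Finset.range (2 * m), D (M - m + j)
        = ∑ j ∈ Finset.Ico (M - m) (M - m + 2 * m), D j := by
          rw [Finset.sum_Ico_eq_sum_range, Nat.add_sub_cancel_left]
      _ ≤ ∑ j ∈ Finset.range (2 * M), D j := by
          refine Finset.sum_le_sum_of_subset_of_nonneg (fun j hj => ?_) fun j _ _ => hD0 j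
          simp only [Finset.mem_Ico, Finset.mem_range] at hj ⊢
          omega
      _ ≤ φ 0 + ∑ j ∈ Finset.range (2 * M), D j := le_add_of_nonneg_left (h0 _ _)
      _ ≤ β := hEφ ▸ hle c i
  · rw [← Finset.sum_div, hsum, div_le_div_iff₀ (by positivity) (by positivity)]
    have h1 := le_twoBuyer (A := Finset.univ) (x := bids r fun k => gridLevel r M (b k))
      (t := s * r ^ M / r) (by positivity) hN (hNb.trans (Finset.card_le_card fun i hi => by
        simp only [Finset.mem_filter, Finset.mem_univ, true_and] at hi ⊢
        rw [div_le_iff₀ hr0, bids, ← pow_succ]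
        exact (le_pow_gridLevel_succ hr hs).trans
          (pow_le_pow_right₀ hr.le (Nat.succ_le_succ (gridLevel_mono hr M hi)))))
    calc (N : ℝ) * s * (β * r ^ M) = (N * (s * r ^ M / r)) * (r * β) := by field_simp
      _ ≤ _ := mul_le_mul_of_nonneg_right h1 (by positivity)

/-- Charges for all bids arise as a limit of charges for finer and larger grids, along an
ultrafilter. -/
theorem exists_isCharge (n : ℕ) [NeZero n] {β ε : ℝ} (hβ : 1 + limitExcess < β) (hε : 0 < ε) :
    ∃ r : ℝ, 1 < r ∧ r < 1 + ε ∧ ∃ T : (Fin n → ℝ≥0) → Fin n → ℝ, (∀ m, IsCharge r T m 0) ∧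
      ∀ b (s : ℝ≥0) (N : ℕ), 2 ≤ N →
        N ≤ (Finset.univ.filter fun i => s ≤ b i).card → N * (s : ℝ) / (r * β) ≤ ∑ i, T b i := by
  obtain ⟨r, hr, hrε, hJ⟩ := exists_grid_charges n hβ hε
  refine ⟨r, hr, hrε, ?_⟩
  have hβ0 : 0 < β := by have := limitExcess_nonneg; linarith
  have hr0 : 0 < r := by positivity
  have htwo : Tendsto (fun M : ℕ => 2 * M) atTop atTop :=
    tendsto_id.const_mul_atTop' (by norm_num)
  have hM := htwo.eventually hJ
  have hM' := hM.mono fun M ⟨ρ, h0, hmono, hperm, hsum, hle⟩ =>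
    exists_isCharge_of_grid hr hβ0 h0 hmono hperm hsum hle
  obtain ⟨T, hT⟩ := hM'.choice
  have hU : (hyperfilter ℕ : Filter ℕ) ≤ atTop := by
    rw [← Nat.cofinite_eq_atTop]; exact hyperfilter_le_cofinite
  have hTU := hU hT
  have hδ : Tendsto (fun M : ℕ => (r ^ M)⁻¹) (hyperfilter ℕ) (𝓝 0) :=
    ((tendsto_pow_atTop_atTop_of_one_lt hr).inv_tendsto_atTop).mono_left hU
  have hlim : ∀ b i, ∃ y, Tendsto (fun M => T M b i) (hyperfilter ℕ) (𝓝 y) := by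
    intro b i
    have hmem : ∀ᶠ M in (hyperfilter ℕ : Filter ℕ),
        T M b i ∈ Set.Icc (0 : ℝ) (max (b i : ℝ) 1) := by
      filter_upwards [hTU] with M hM
      have h := hM.1 0 (Nat.zero_le M)
      exact ⟨h.nonneg b i, (h.le b i).trans
        (max_le_max le_rfl (inv_le_one_of_one_le₀ (one_le_pow₀ hr.le)))⟩
    obtain ⟨y, -, hy⟩ := isCompact_Icc.ultrafilter_le_nhds
      ((hyperfilter ℕ).map fun M => T M b i) (le_principal_iff.mpr hmem)
    exact ⟨y, hy⟩
  choose T' hT' using hlim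
  refine ⟨T', fun m => ?_, fun b s N hN hNb => ?_⟩
  · have hm : ∀ᶠ M in (hyperfilter ℕ : Filter ℕ),
        IsCharge r (T M) m (r ^ M)⁻¹ := by
      filter_upwards [hTU, hU (eventually_ge_atTop m)] with M hM hmM using hM.1 m hmM
    refine ⟨fun b i => ge_of_tendsto (hT' b i) (hm.mono fun M h => h.nonneg b i),
      fun b i x x' hx => le_of_tendsto_of_tendsto (hT' _ i) (hT' _ i)
        (hm.mono fun M h => h.mono b i hx),
      fun σ b i => tendsto_nhds_unique (hT' _ i) ((hT' b (σ i)).congr'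
        (hm.mono fun M h => (h.comp_perm σ b i).symm)),
      fun b i => le_of_tendsto_of_tendsto (hT' b i)
        (tendsto_const_nhds.max hδ) (hm.mono fun M h => h.le b i),
      fun b i x hx => le_of_tendsto (tendsto_finsetSum _ fun j _ =>
        ((hT' _ i).sub (hT' _ i)).div_const _) (hm.mono fun M h => h.window b i x hx)⟩
  · refine ge_of_tendsto (tendsto_finsetSum _ fun i _ => hT' b i) ?_
    filter_upwards [hTU, hU ((tendsto_pow_atTop_atTop_of_one_lt hr).eventually_ge_atTop (s : ℝ))]
      with M hM hs using hM.2 b s N hs hN hNb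

end Scale

/-! ### Random prices -/

section Price

open scoped ENNReal

/-- The payment for the price `p` of a bidder who bids `z`. -/
noncomputable def postedPayment (z p : ℝ≥0) : ℝ := if p ≤ z then (p : ℝ) else 0

theorem postedPayment_nonneg (z p : ℝ≥0) : 0 ≤ postedPayment z p := by
  unfold postedPayment
  split_ifs
  · exact p.coe_nonneg
  · exact le_rfl

theorem measurable_postedPayment (z : ℝ≥0) : Measurable (postedPayment z) :=
  Measurable.ite measurableSet_Iic measurable_coe_nnreal_real measurable_const

theorem integrable_postedPayment (z : ℝ≥0) (π : Measure ℝ≥0) [IsFiniteMeasure π] :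
    Integrable (postedPayment z) π := by
  refine Integrable.of_bound (measurable_postedPayment z).aestronglyMeasurable z
    (Eventually.of_forall fun p => ?_)
  rw [Real.norm_of_nonneg (postedPayment_nonneg z p), postedPayment]
  split_ifs with h
  · exact_mod_cast h
  · exact z.coe_nonneg

variable {r : ℝ}

/-- A step function `P` with jumps at the powers of `r` is the expected payment for a random price
if the required probabilities of the prices `r ^ a` add up to at most `1`. With the remaining
probability, the price is `0`. -/
theorem exists_priceLaw (hr : 1 < r) {P : ℤ → ℝ} (hmono : Monotone P)
    (hle : ∀ a, P a ≤ r ^ a)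
    (hwin : ∀ m : ℕ, ∑ j ∈ Finset.range (2 * m),
      (P ((j : ℤ) + 1 - m) - P ((j : ℤ) - m)) / r ^ ((j : ℤ) + 1 - m) ≤ 1) :
    ∃ π : Measure ℝ≥0, IsProbabilityMeasure π ∧
      ∀ (a : ℤ) (z : ℝ≥0), r ^ a ≤ z → P a ≤ ∫ p, postedPayment z p ∂π := by
  have hr0 : 0 < r := by positivity
  let q : ℤ → ℝ := fun a => (P a - P (a - 1)) / r ^ a
  have hq0 : ∀ a, 0 ≤ q a := fun a =>
    div_nonneg (sub_nonneg.mpr (hmono (by omega))) (by positivity)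
  have hqs : ∀ (m : ℕ) (j : ℕ), q ((j : ℤ) + 1 - m) =
      (P ((j : ℤ) + 1 - m) - P ((j : ℤ) - m)) / r ^ ((j : ℤ) + 1 - m) := fun m j => by
    dsimp only [q]
    rw [show (j : ℤ) + 1 - m - 1 = j - m by ring]
  have htsum : ∑' a, ENNReal.ofReal (q a) ≤ 1 := by
    rw [ENNReal.tsum_eq_iSup_sum]
    refine iSup_le fun S => ?_
    obtain ⟨m, hm⟩ : ∃ m : ℕ, ∀ a ∈ S, a.natAbs < m :=
      ⟨S.sup Int.natAbs + 1, fun a ha => Nat.lt_succ_of_le (Finset.le_sup (f := Int.natAbs) ha)⟩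
    rw [← ENNReal.ofReal_sum_of_nonneg fun a _ => hq0 a, ENNReal.ofReal_le_one]
    calc ∑ a ∈ S, q a
        ≤ ∑ a ∈ (Finset.range (2 * m)).image (fun j : ℕ => (j : ℤ) + 1 - m), q a := by
          refine Finset.sum_le_sum_of_subset_of_nonneg (fun a ha => ?_) fun a _ _ => hq0 a
          have := hm a ha
          exact Finset.mem_image.mpr ⟨(a + m - 1).toNat, Finset.mem_range.mpr (by omega), by omega⟩
      _ = ∑ j ∈ Finset.range (2 * m), q ((j : ℤ) + 1 - m) :=
          Finset.sum_image fun j _ j' _ h => by simpa using h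
      _ ≤ 1 := by simpa only [hqs] using hwin m
  set x : ℤ → ℝ≥0 := fun a => (r ^ a).toNNReal with hx
  have hxa : ∀ a, (x a : ℝ) = r ^ a := fun a => Real.coe_toNNReal _ (by positivity)
  set ν : Measure ℝ≥0 := Measure.sum fun a : ℤ => ENNReal.ofReal (q a) • Measure.dirac (x a) with hν
  set π : Measure ℝ≥0 := ν + (1 - ∑' a, ENNReal.ofReal (q a)) • Measure.dirac 0 with hπ
  have hprob : IsProbabilityMeasure π := ⟨by
    rw [hπ, hν]
    simp only [Measure.add_apply, Measure.sum_apply _ MeasurableSet.univ, Measure.smul_apply,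
      measure_univ, smul_eq_mul, mul_one]
    exact add_tsub_cancel_of_le htsum⟩
  refine ⟨π, hprob, fun a z hz => ?_⟩
  have hlow : ∀ m : ℕ, -(m : ℤ) ≤ a → P a - P (-m) ≤ ∫ p, postedPayment z p ∂π := by
    intro m hm
    obtain ⟨n, hn⟩ : ∃ n : ℕ, a = (n : ℤ) - m := ⟨(a + m).toNat, by omega⟩
    have hpay : ∀ j ∈ Finset.range n, q ((j : ℤ) + 1 - m) *
        postedPayment z (x ((j : ℤ) + 1 - m)) = P (((j + 1 : ℕ) : ℤ) - m) - P ((j : ℤ) - m) := by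
      intro j hj
      have hj := Finset.mem_range.mp hj
      have h1 : r ^ ((j : ℤ) + 1 - m) ≤ z := (zpow_le_zpow_right₀ hr.le (by omega)).trans hz
      rw [postedPayment, if_pos (by rw [← NNReal.coe_le_coe, hxa]; exact h1), hxa, hqs,
        div_mul_cancel₀ _ (by positivity)]
      push_cast
      rfl
    have hsum : P a - P (-m) = ∑ j ∈ Finset.range n, q ((j : ℤ) + 1 - m) *
        postedPayment z (x ((j : ℤ) + 1 - m)) := by
      rw [Finset.sum_congr rfl hpay, Finset.sum_range_sub (fun j : ℕ => P ((j : ℤ) - m)), hn]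
      simp
    rw [hsum, ← ENNReal.ofReal_le_ofReal_iff (integral_nonneg (postedPayment_nonneg z)),
      ofReal_integral_eq_lintegral_ofReal (integrable_postedPayment z π)
        (Eventually.of_forall (postedPayment_nonneg z)),
      ENNReal.ofReal_sum_of_nonneg fun j _ => mul_nonneg (hq0 _) (postedPayment_nonneg _ _)]
    calc ∑ j ∈ Finset.range n, ENNReal.ofReal (q ((j : ℤ) + 1 - m) *
          postedPayment z (x ((j : ℤ) + 1 - m)))
        ≤ ∑' j : ℕ, ENNReal.ofReal (q ((j : ℤ) + 1 - m) *
          postedPayment z (x ((j : ℤ) + 1 - m))) := ENNReal.sum_le_tsum _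
      _ ≤ ∑' c : ℤ, ENNReal.ofReal (q c * postedPayment z (x c)) :=
          ENNReal.tsum_comp_le_tsum_of_injective (f := fun j : ℕ => (j : ℤ) + 1 - m)
            (fun j j' h => by simpa using h)
            (fun c => ENNReal.ofReal (q c * postedPayment z (x c)))
      _ = ∫⁻ p, ENNReal.ofReal (postedPayment z p) ∂ν := by
          rw [hν, lintegral_sum_measure]
          refine tsum_congr fun c => ?_
          rw [lintegral_smul_measure, lintegral_dirac, smul_eq_mul, ENNReal.ofReal_mul (hq0 c)]
      _ ≤ _ := lintegral_mono' (Measure.le_add_right le_rfl) le_rfl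
  have hlim : Tendsto (fun m : ℕ => P a - r⁻¹ ^ m) atTop (𝓝 (P a - 0)) :=
    tendsto_const_nhds.sub (tendsto_pow_atTop_nhds_zero_of_lt_one (by positivity)
      (inv_lt_one_of_one_lt₀ hr))
  rw [sub_zero] at hlim
  refine le_of_tendsto hlim ?_
  filter_upwards [eventually_ge_atTop (-a).toNat] with m hm
  refine le_trans (sub_le_sub_left ?_ _) (hlow m (by omega))
  refine (hle _).trans (le_of_eq ?_)
  rw [zpow_neg, zpow_natCast, inv_pow]

/-- Rounding a bid down to a power of `r`. -/
theorem exists_round (hr : 1 < r) (x : ℝ≥0) : ∃ x' : ℝ≥0, (x : ℝ) ≤ r * x' ∧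
    ((x' : ℝ) = 0 ∨ ∃ a : ℤ, (x' : ℝ) = r ^ a ∧ r ^ a ≤ (x : ℝ)) := by
  rcases eq_or_ne x 0 with rfl | hx
  · exact ⟨0, by simp⟩
  · obtain ⟨a, ha⟩ := exists_mem_Ico_zpow (x := (x : ℝ))
      (by exact_mod_cast pos_iff_ne_zero.mpr hx) hr
    have hr0 : 0 < r := by positivity
    refine ⟨⟨r ^ a, by positivity⟩, ?_, Or.inr ⟨a, rfl, ha.1⟩⟩
    refine ha.2.le.trans (le_of_eq ?_)
    rw [zpow_add_one₀ hr0.ne', mul_comm]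
    rfl

/-- Random prices, depending on the bids of the previous bidders, whose expected revenue from a
bidder who is uniformly random among the `k + 1` bidders is nearly optimal. -/
theorem exists_priceLaws (k : ℕ) {β : ℝ} (hβ : 1 + limitExcess < β) :
    ∃ π : (Fin k → ℝ≥0) → Measure ℝ≥0, (∀ y, IsProbabilityMeasure (π y)) ∧
      ∀ (b : Fin (k + 1) → ℝ≥0) (s : ℝ≥0) (N : ℕ), 2 ≤ N →
        N ≤ (Finset.univ.filter fun i => s ≤ b i).card →
        N * ((s : ℝ) / β) ≤ ∑ i, ∫ p, postedPayment (b i) p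
          ∂π (fun j => b (Equiv.swap i (Fin.last k) j.castSucc)) := by
  obtain ⟨β', hβ', hβ'β⟩ := exists_between hβ
  have hβ'0 : 0 < β' := by have := limitExcess_nonneg; linarith
  -- The factor `r ^ 2` that is lost by rounding must be at most `β / β'`.
  obtain ⟨ε, hε, hεβ⟩ : ∃ ε : ℝ, 0 < ε ∧ (1 + ε) ^ 2 * β' ≤ β := by
    have hlim : Tendsto (fun ε : ℝ => (1 + ε) ^ 2 * β') (𝓝[>] 0) (𝓝 ((1 + 0) ^ 2 * β')) := by
      have : Continuous fun ε : ℝ => (1 + ε) ^ 2 * β' := by fun_prop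
      exact (this.tendsto 0).mono_left nhdsWithin_le_nhds
    obtain ⟨ε, h1, h2⟩ := ((hlim.eventually (Iic_mem_nhds (by linarith :
      (1 + 0 : ℝ) ^ 2 * β' < β))).and self_mem_nhdsWithin).exists
    exact ⟨ε, h2, h1⟩
  obtain ⟨r, hr, hrε, T, hT, hTsum⟩ := exists_isCharge (k + 1) hβ' hε
  have hr0 : 0 < r := by positivity
  choose round hround hround' using exists_round hr
  let pw : ℤ → ℝ≥0 := fun a => ⟨r ^ a, by positivity⟩
  let P : (Fin k → ℝ≥0) → ℤ → ℝ := fun y a =>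
    T (Fin.snoc (fun j => round (y j)) (pw a)) (Fin.last k)
  have hP : ∀ y a, P y a = T (update (Fin.snoc (fun j => round (y j)) 0) (Fin.last k) (pw a))
      (Fin.last k) := fun y a => by
    dsimp only [P]
    congr 1
    exact (Fin.update_snoc_last (α := fun _ => ℝ≥0) _ _ _).symm
  have hlaw : ∀ y, ∃ π : Measure ℝ≥0, IsProbabilityMeasure π ∧
      ∀ (a : ℤ) (z : ℝ≥0), r ^ a ≤ z → P y a ≤ ∫ p, postedPayment z p ∂π := by
    intro y
    refine exists_priceLaw hr (fun a a' h => ?_) (fun a => ?_) fun m => ?_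
    · rw [hP, hP]
      exact (hT 0).mono _ _ (zpow_le_zpow_right₀ hr.le h)
    · have := (hT 0).le (Fin.snoc (fun j => round (y j)) (pw a)) (Fin.last k)
      rw [Fin.snoc_last, max_eq_left (pw a).coe_nonneg] at this
      exact this
    · have hx : ∀ j : ℕ, ((pw ((j : ℤ) - m) : ℝ≥0) : ℝ) = r ^ j / r ^ m := fun j => by
        change r ^ ((j : ℤ) - m) = _
        rw [zpow_sub₀ hr0.ne', zpow_natCast, zpow_natCast]
      have := (hT m).window (Fin.snoc (fun j => round (y j)) 0) (Fin.last k)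
        (fun j => pw ((j : ℤ) - m)) hx
      refine le_trans (le_of_eq (Finset.sum_congr rfl fun j _ => ?_)) this
      rw [hP, hP]
      push_cast
      rw [show (j : ℤ) + 1 - m = j + 1 - m from rfl]
      rfl
  choose π hπ hPπ using hlaw
  refine ⟨π, hπ, fun b s N hN hNb => ?_⟩
  have hpay : ∀ i, T (fun j => round (b j)) i ≤ ∫ p, postedPayment (b i) p
      ∂π (fun j => b (Equiv.swap i (Fin.last k) j.castSucc)) := by
    intro i
    have hsnoc : ((fun j => round (b j)) ∘ Equiv.swap i (Fin.last k) : Fin (k + 1) → ℝ≥0) =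
        Fin.snoc (fun j => round (b (Equiv.swap i (Fin.last k) j.castSucc))) (round (b i)) := by
      ext j
      refine Fin.lastCases ?_ (fun j => ?_) j
      · simp
      · simp
    have hTi : T (fun j => round (b j)) i =
        T (Fin.snoc (fun j => round (b (Equiv.swap i (Fin.last k) j.castSucc))) (round (b i)))
          (Fin.last k) := by
      rw [← hsnoc, (hT 0).comp_perm, Equiv.swap_apply_right]
    rcases hround' (b i) with h0 | ⟨a, ha, hab⟩
    · refine le_trans (((hT 0).le _ i).trans ?_) (integral_nonneg (postedPayment_nonneg _))
      exact max_le h0.le le_rfl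
    · rw [hTi]
      have : round (b i) = pw a := NNReal.coe_injective ha
      rw [this]
      exact hPπ _ a (b i) hab
  refine le_trans ?_ (Finset.sum_le_sum fun i _ => hpay i)
  have hs' : N ≤ (Finset.univ.filter fun i => s / ⟨r, hr0.le⟩ ≤ round (b i)).card := by
    refine hNb.trans (Finset.card_le_card fun i hi => ?_)
    simp only [Finset.mem_filter, Finset.mem_univ, true_and] at hi ⊢
    have h1 : (s : ℝ) ≤ b i := by exact_mod_cast hi
    rw [← NNReal.coe_le_coe]
    change (s : ℝ) / r ≤ round (b i)
    rw [div_le_iff₀' hr0]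
    exact h1.trans (hround _)
  refine le_trans ?_ (hTsum _ _ N hN hs')
  change N * ((s : ℝ) / β) ≤ N * ((s : ℝ) / r) / (r * β')
  have h1 : r ^ 2 * β' ≤ β :=
    (mul_le_mul_of_nonneg_right (pow_le_pow_left₀ hr0.le hrε.le 2) hβ'0.le).trans hεβ
  calc N * ((s : ℝ) / β) ≤ N * ((s : ℝ) / (r ^ 2 * β')) := by gcongr
    _ = _ := by field_simp

end Price

/-! ### Random arrival order -/

section Order

variable {n : ℕ}

/-- The bids of the first `k + 1` bidders when the bidders arrive in the order `σ`. -/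
def arrivals (b : Fin n → ℝ≥0) (σ : Equiv.Perm (Fin n)) (k : Fin n) (i : Fin (k.val + 1)) : ℝ≥0 :=
  b (σ (Fin.castLE k.isLt i))

theorem arrivals_swap (b : Fin n → ℝ≥0) (σ : Equiv.Perm (Fin n)) (k : Fin n)
    (i : Fin (k.val + 1)) :
    arrivals b (σ * Equiv.swap (Fin.castLE k.isLt i) k) k =
      arrivals b σ k ∘ Equiv.swap i (Fin.last k.val) := by
  ext j
  have hinj : Injective (Fin.castLE (Nat.succ_le_of_lt k.isLt) : Fin (k.val + 1) → Fin n) :=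
    Fin.castLE_injective _
  have : Equiv.swap (Fin.castLE k.isLt i) k (Fin.castLE k.isLt j) =
      Fin.castLE k.isLt (Equiv.swap i (Fin.last k.val) j) :=
    (hinj.map_swap i (Fin.last k.val) j).symm
  simp [arrivals, this]

/-- The last one of the first `k + 1` bidders is a uniformly random one of them. -/
theorem sum_perm_arrivals (b : Fin n → ℝ≥0) (k : Fin n) (Φ : (Fin (k.val + 1) → ℝ≥0) → ℝ) :
    ((k.val : ℝ) + 1) * ∑ σ : Equiv.Perm (Fin n), Φ (arrivals b σ k) =
      ∑ σ : Equiv.Perm (Fin n), ∑ i, Φ (arrivals b σ k ∘ Equiv.swap i (Fin.last k.val)) := by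
  rw [Finset.sum_comm]
  have : ∀ i : Fin (k.val + 1), ∑ σ : Equiv.Perm (Fin n),
      Φ (arrivals b σ k ∘ Equiv.swap i (Fin.last k.val)) =
        ∑ σ : Equiv.Perm (Fin n), Φ (arrivals b σ k) := by
    intro i
    simp only [← arrivals_swap]
    exact Equiv.sum_comp (Equiv.mulRight (Equiv.swap (Fin.castLE k.isLt i) k))
      fun σ => Φ (arrivals b σ k)
  simp [this]

/-- The number of bids of at least `s`. -/
noncomputable def numGE {m : ℕ} (c : Fin m → ℝ≥0) (s : ℝ≥0) : ℕ :=
  (Finset.univ.filter fun i => s ≤ c i).card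

theorem numGE_comp_perm {m : ℕ} (c : Fin m → ℝ≥0) (τ : Equiv.Perm (Fin m)) (s : ℝ≥0) :
    numGE (c ∘ τ) s = numGE c s := by
  refine Finset.card_bij (fun i _ => τ i) (fun i hi => by simpa using hi)
    (fun _ _ _ _ h => τ.injective h) (fun j hj => ⟨τ.symm j, by simpa using hj, by simp⟩)

/-- The indicator that the last bid is at least `s` and is not the only such bid. -/
noncomputable def lastRepeats {m : ℕ} (s : ℝ≥0) (c : Fin (m + 1) → ℝ≥0) : ℝ :=
  if s ≤ c (Fin.last m) ∧ 2 ≤ numGE c s then 1 else 0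

theorem sum_lastRepeats_swap {m : ℕ} (s : ℝ≥0) (c : Fin (m + 1) → ℝ≥0) :
    ∑ i, lastRepeats s (c ∘ Equiv.swap i (Fin.last m)) =
      if 2 ≤ numGE c s then (numGE c s : ℝ) else 0 := by
  simp only [lastRepeats, numGE_comp_perm, comp_apply, Equiv.swap_apply_right]
  split_ifs with h
  · simp only [h, and_true]
    rw [Finset.sum_boole, numGE]
  · simp [h]

/-- All bidders with bids of at least `s` except the first one of them have predecessors with such
bids. -/
theorem numGE_sub_one_le_sum_lastRepeats (b : Fin n → ℝ≥0) (σ : Equiv.Perm (Fin n)) (s : ℝ≥0) :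
    (numGE b s : ℝ) - 1 ≤ ∑ k, lastRepeats s (arrivals b σ k) := by
  classical
  set S := Finset.univ.filter fun k => s ≤ b (σ k) with hS
  have hcard : S.card = numGE b s := numGE_comp_perm b σ s
  have hnonneg : ∀ k, 0 ≤ lastRepeats s (arrivals b σ k) := fun k => by
    unfold lastRepeats; split_ifs <;> norm_num
  rcases S.eq_empty_or_nonempty with h0 | hne
  · rw [h0, Finset.card_empty] at hcard
    rw [← hcard]
    have := Finset.sum_nonneg fun k (_ : k ∈ Finset.univ) => hnonneg k
    push_cast
    linarith
  set k₀ := S.min' hne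
  have hk₀ : k₀ ∈ S := S.min'_mem hne
  have hterm : ∀ k ∈ S.erase k₀, lastRepeats s (arrivals b σ k) = 1 := by
    intro k hk
    obtain ⟨hne', hkS⟩ := Finset.mem_erase.mp hk
    have hlt : k₀ < k := lt_of_le_of_ne (S.min'_le k hkS) (Ne.symm hne')
    refine if_pos ⟨(Finset.mem_filter.mp hkS).2, ?_⟩
    refine Finset.one_lt_card.mpr ⟨⟨k₀, Nat.lt_succ_of_lt hlt⟩, ?_, Fin.last k.val, ?_, ?_⟩
    · exact Finset.mem_filter.mpr ⟨Finset.mem_univ _, (Finset.mem_filter.mp hk₀).2⟩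
    · exact Finset.mem_filter.mpr ⟨Finset.mem_univ _, (Finset.mem_filter.mp hkS).2⟩
    · exact Fin.ne_of_lt hlt
  calc (numGE b s : ℝ) - 1 = ∑ k ∈ S.erase k₀, 1 := by
        rw [Finset.sum_const, Finset.card_erase_of_mem hk₀, hcard, nsmul_one,
          Nat.cast_sub (by rw [← hcard]; exact Finset.card_pos.mpr hne), Nat.cast_one]
    _ = ∑ k ∈ S.erase k₀, lastRepeats s (arrivals b σ k) :=
        (Finset.sum_congr rfl hterm).symm
    _ ≤ _ := Finset.sum_le_univ_sum_of_nonneg hnonneg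

/-- If the expected revenue `R k` from a uniformly random one of the first `k + 1` bidders, conditional
on their bids, is at least a `1 / (k + 1)`-fraction of the revenue of the price `s`, divided by `β`,
whenever at least two of them accept this price, then the random-order revenue is the revenue of the
price `s` from all bidders but one, divided by `β`. The reason is that the bidder who arrives last is
such a random one, so that accepting bidders with an accepting predecessor contribute
`s / β` each. -/
theorem le_sum_perm_revenue (b : Fin n → ℝ≥0) (s : ℝ≥0) {β : ℝ} (hβ : 0 < β)
    {R : (k : ℕ) → (Fin (k + 1) → ℝ≥0) → ℝ} (hR0 : ∀ k c, 0 ≤ R k c)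
    (hR : ∀ k c, 2 ≤ numGE c s →
      numGE c s * ((s : ℝ) / β) ≤ ∑ i, R k (c ∘ Equiv.swap i (Fin.last k))) :
    (n.factorial : ℝ) * (((numGE b s : ℝ) - 1) * ((s : ℝ) / β)) ≤
      ∑ σ : Equiv.Perm (Fin n), ∑ k : Fin n, R k (arrivals b σ k) := by
  have hsβ : 0 ≤ (s : ℝ) / β := by positivity
  have hk : ∀ k : Fin n, (s : ℝ) / β * ∑ σ : Equiv.Perm (Fin n), lastRepeats s (arrivals b σ k) ≤
      ∑ σ : Equiv.Perm (Fin n), R k (arrivals b σ k) := by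
    intro k
    have hk0 : (0 : ℝ) < (k.val : ℝ) + 1 := by positivity
    refine le_of_mul_le_mul_left ?_ hk0
    rw [mul_left_comm, sum_perm_arrivals, sum_perm_arrivals, Finset.mul_sum]
    refine Finset.sum_le_sum fun σ _ => ?_
    rw [sum_lastRepeats_swap]
    split_ifs with h
    · rw [mul_comm]; exact hR k _ h
    · rw [mul_zero]; exact Finset.sum_nonneg fun i _ => hR0 _ _
  rw [Finset.sum_comm]
  refine le_trans ?_ (Finset.sum_le_sum fun k _ => hk k)
  rw [← Finset.mul_sum, Finset.sum_comm, mul_comm ((numGE b s : ℝ) - 1), mul_left_comm]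
  refine mul_le_mul_of_nonneg_left ?_ hsβ
  calc (n.factorial : ℝ) * ((numGE b s : ℝ) - 1)
      = ∑ σ : Equiv.Perm (Fin n), ((numGE b s : ℝ) - 1) := by
        rw [Finset.sum_const, Finset.card_univ, Fintype.card_perm, Fintype.card_fin, nsmul_eq_mul]
    _ ≤ _ := Finset.sum_le_sum fun σ _ => numGE_sub_one_le_sum_lastRepeats b σ s

end Order

/-! ### A nearly optimal online auction -/

section Auction

/-- The deterministic auction that offers the price `price ⟨k, h⟩` to the bidder who arrives after
`k` bidders with the bids `h`. -/
noncomputable def postedAuction (price : (Σ k : ℕ, Fin k → ℝ≥0) → ℝ≥0) : DetOnlineAuction where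
  decision k h z := if price ⟨k, h⟩ ≤ z then .serve (price ⟨k, h⟩) else .reject
  truthful k h v z := by
    split_ifs with h1 h2 h2
    · exact le_rfl
    · have : (v : ℝ) < price ⟨k, h⟩ := by exact_mod_cast not_le.mp h2
      simp only [Decision.utility]
      linarith
    · have : (price ⟨k, h⟩ : ℝ) ≤ v := by exact_mod_cast h2
      simpa only [Decision.utility] using sub_nonneg.mpr this
    · exact le_rfl
  individuallyRational k h v := by
    split_ifs with h1
    · have : (price ⟨k, h⟩ : ℝ) ≤ v := by exact_mod_cast h1
      simpa only [Decision.utility] using sub_nonneg.mpr this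
    · exact le_rfl

theorem payment_postedAuction (price : (Σ k : ℕ, Fin k → ℝ≥0) → ℝ≥0) (k : ℕ)
    (h : Fin k → ℝ≥0) (z : ℝ≥0) :
    ((((postedAuction price).decision k h z).payment : ℝ≥0) : ℝ) =
      postedPayment z (price ⟨k, h⟩) := by
  simp only [postedAuction, postedPayment]
  split_ifs <;> simp [Decision.payment]

/-- The auction that offers independent random prices with the laws `π ⟨k, h⟩`. -/
noncomputable def randomPriceAuction (π : (Σ k : ℕ, Fin k → ℝ≥0) → Measure ℝ≥0)
    [∀ i, IsProbabilityMeasure (π i)] : OnlineAuction where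
  Ω := (Σ k : ℕ, Fin k → ℝ≥0) → ℝ≥0
  P := Measure.infinitePi π
  det := postedAuction
  measurable_payment k h z := by
    have h1 : (fun ω : (Σ k : ℕ, Fin k → ℝ≥0) → ℝ≥0 =>
        ((postedAuction ω).decision k h z).payment) =
        fun ω => if ω ⟨k, h⟩ ≤ z then ω ⟨k, h⟩ else 0 := by
      ext ω
      simp only [postedAuction]
      split_ifs <;> simp [Decision.payment]
    rw [h1]
    exact Measurable.ite (measurableSet_le (measurable_pi_apply _) measurable_const)
      (measurable_pi_apply _) measurable_const

theorem integral_revenue_randomPriceAuction (π : (Σ k : ℕ, Fin k → ℝ≥0) → Measure ℝ≥0)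
    [∀ i, IsProbabilityMeasure (π i)] {n : ℕ} (b : Fin n → ℝ≥0) :
    ∫ ω, ((((randomPriceAuction π).det ω).revenue b : ℝ≥0) : ℝ) ∂(randomPriceAuction π).P =
      ∑ k : Fin n, ∫ p, postedPayment (b k) p ∂π ⟨k, fun j => b (Fin.castLE k.isLt.le j)⟩ := by
  have hmp : ∀ i, MeasurePreserving (fun ω : (Σ k : ℕ, Fin k → ℝ≥0) → ℝ≥0 => ω i)
      (Measure.infinitePi π) (π i) := fun i => measurePreserving_eval_infinitePi π i
  have hint : ∀ i z, Integrable (fun ω : (Σ k : ℕ, Fin k → ℝ≥0) → ℝ≥0 =>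
      postedPayment z (ω i)) (Measure.infinitePi π) := fun i z =>
    (hmp i).integrable_comp_of_integrable (integrable_postedPayment z (π i))
  change ∫ ω, (((postedAuction ω).revenue b : ℝ≥0) : ℝ) ∂(Measure.infinitePi π) = _
  simp only [DetOnlineAuction.revenue, NNReal.coe_sum, payment_postedAuction]
  rw [integral_finsetSum _ fun k _ => hint _ _]
  refine Finset.sum_congr rfl fun k _ => ?_
  rw [← (hmp ⟨k, fun j => b (Fin.castLE k.isLt.le j)⟩).map_eq]
  exact (integral_map (hmp _).aemeasurable
    (measurable_postedPayment _).aestronglyMeasurable).symm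

theorem lt_numGE_sortedBids {n : ℕ} (b : Fin n → ℝ≥0) (k : Fin n) :
    k.val + 1 ≤ numGE b (sortedBids b k) := by
  rw [← numGE_comp_perm b (Tuple.sort fun j => OrderDual.toDual (b j)), ← Fin.card_Iic]
  refine Finset.card_le_card fun i hi => ?_
  exact Finset.mem_filter.mpr ⟨Finset.mem_univ _,
    Tuple.monotone_sort (fun j => OrderDual.toDual (b j)) (Finset.mem_Iic.mp hi)⟩

theorem maxV_le {n : ℕ} {b : Fin n → ℝ≥0} {c : ℝ} (hc : 0 ≤ c)
    (h : ∀ k : Fin n, (k.val : ℝ) * sortedBids b k ≤ c) : ((maxV b : ℝ≥0) : ℝ) ≤ c := by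
  lift c to ℝ≥0 using hc
  exact NNReal.coe_le_coe.mpr (Finset.sup_le fun k _ => by exact_mod_cast h k)

theorem exists_isCompetitive {β : ℝ} (hβ : 1 + limitExcess < β) :
    ∃ A : OnlineAuction, A.IsCompetitive β := by
  have hβ0 : 0 < β := by have := limitExcess_nonneg; linarith
  choose π hπ hrev using fun k => exists_priceLaws k hβ
  let law : (Σ k : ℕ, Fin k → ℝ≥0) → Measure ℝ≥0 := fun i => π i.1 i.2
  have : ∀ i, IsProbabilityMeasure (law i) := fun i => hπ i.1 i.2
  refine ⟨randomPriceAuction law, hβ0, fun n b => ?_⟩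
  let R : (k : ℕ) → (Fin (k + 1) → ℝ≥0) → ℝ := fun k c =>
    ∫ p, postedPayment (c (Fin.last k)) p ∂π k (fun j => c j.castSucc)
  have hR0 : ∀ k c, 0 ≤ R k c := fun k c => integral_nonneg (postedPayment_nonneg _)
  have hR : ∀ (s : ℝ≥0) k c, 2 ≤ numGE c s →
      numGE c s * ((s : ℝ) / β) ≤ ∑ i, R k (c ∘ Equiv.swap i (Fin.last k)) := by
    intro s k c hN
    refine (hrev k c s _ hN le_rfl).trans (le_of_eq ?_)
    simp only [R, comp_apply, Equiv.swap_apply_right]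
  have hfac : (0 : ℝ) < n.factorial := by exact_mod_cast n.factorial_pos
  have hER : (randomPriceAuction law).expectedRevenue b =
      (∑ σ : Equiv.Perm (Fin n), ∑ k : Fin n, R k (arrivals b σ k)) / n.factorial := by
    rw [OnlineAuction.expectedRevenue]
    congr 1
    refine Finset.sum_congr rfl fun σ _ => ?_
    rw [integral_revenue_randomPriceAuction]
    rfl
  have hE0 : 0 ≤ (randomPriceAuction law).expectedRevenue b := by
    rw [hER]
    exact div_nonneg (Finset.sum_nonneg fun σ _ => Finset.sum_nonneg fun k _ => hR0 _ _) hfac.le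
  rw [div_le_iff₀ hβ0]
  refine maxV_le (mul_nonneg hE0 hβ0.le) fun k => ?_
  rw [← div_le_iff₀ hβ0, hER, le_div_iff₀ hfac]
  refine le_trans ?_ (le_sum_perm_revenue b (sortedBids b k) hβ0 hR0 (hR _))
  have hk : (k.val : ℝ) + 1 ≤ numGE b (sortedBids b k) := by
    exact_mod_cast lt_numGE_sortedBids b k
  rw [mul_comm, mul_div_assoc]
  exact mul_le_mul_of_nonneg_left
    (mul_le_mul_of_nonneg_right (by linarith) (by positivity)) hfac.le

theorem optimalOnlineRatio_le : optimalOnlineRatio ≤ 1 + limitExcess := by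
  refine le_of_forall_gt_imp_ge_of_dense fun β hβ => ?_
  exact csInf_le ⟨0, fun _ ⟨_, hA⟩ => hA.1.le⟩ (exists_isCompetitive hβ)

end Auction

/-! ### Two bidders -/

section LowerBound

/-- A truthful auction offers one price, which is independent of the bid, to each bidder who pays
anything. -/
theorem exists_price (M : DetOnlineAuction) (k : ℕ) (h : Fin k → ℝ≥0) :
    ∃ p : ℝ≥0, ∀ z, (M.decision k h z).payment = 0 ∨
      (M.decision k h z).payment = p ∧ p ≤ z := by
  by_cases hex : ∃ z₀, (M.decision k h z₀).payment ≠ 0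
  · obtain ⟨z₀, hz₀⟩ := hex
    refine ⟨(M.decision k h z₀).payment, fun z => ?_⟩
    have h1 := M.truthful k h z₀ z
    have h2 := M.truthful k h z z₀
    have h3 := M.individuallyRational k h z
    rcases hd₀ : M.decision k h z₀ with _ | p₀
    · rw [hd₀] at hz₀; exact absurd rfl hz₀
    rcases hd : M.decision k h z with _ | p
    · exact Or.inl rfl
    · rw [hd₀, hd] at h1 h2
      rw [hd] at h3
      simp only [Decision.utility] at h1 h2 h3
      refine Or.inr ⟨?_, ?_⟩
      · change p = p₀
        refine NNReal.coe_injective (le_antisymm ?_ ?_) <;> linarith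
      · change p₀ ≤ z
        refine NNReal.coe_le_coe.mp ?_
        linarith
  · push Not at hex
    exact ⟨0, fun z => Or.inl (hex z)⟩

theorem payment_le (M : DetOnlineAuction) (k : ℕ) (h : Fin k → ℝ≥0) (z : ℝ≥0) :
    (M.decision k h z).payment ≤ z := by
  obtain ⟨p, hp⟩ := exists_price M k h
  rcases hp z with h0 | ⟨h1, h2⟩
  · rw [h0]; exact zero_le
  · rw [h1]; exact h2

variable {r : ℝ} {J : ℕ}

/-- No truthful mechanism extracts more than `s` in expectation from a bid that follows the
equal-revenue law on the values `s * r ^ j`. -/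
theorem sum_erLaw_payment_le (hr : 1 < r) (M : DetOnlineAuction) (k : ℕ) (h : Fin k → ℝ≥0)
    {s : ℝ} (hs : 0 < s) {x : ℕ → ℝ≥0} (hx : ∀ j, (x j : ℝ) = s * r ^ j) :
    ∑ j : Fin (J + 1), erLaw r J 0 j * (((M.decision k h (x j)).payment : ℝ≥0) : ℝ) ≤ s := by
  obtain ⟨p, hp⟩ := exists_price M k h
  rcases eq_or_ne p 0 with rfl | hp0
  · have : ∀ z, (M.decision k h z).payment = 0 := fun z => by
      rcases hp z with h0 | h0
      · exact h0
      · exact h0.1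
    simp [this, hs.le]
  · have hp0 : 0 < (p : ℝ) := by exact_mod_cast pos_iff_ne_zero.mpr hp0
    calc ∑ j : Fin (J + 1), erLaw r J 0 j * (((M.decision k h (x j)).payment : ℝ≥0) : ℝ)
        ≤ ∑ j : Fin (J + 1), p * (erLaw r J 0 j * (if p / s ≤ r ^ (j : ℕ) then 1 else 0)) := by
          refine Finset.sum_le_sum fun j _ => ?_
          rw [mul_left_comm]
          refine mul_le_mul_of_nonneg_left ?_ (erLaw_nonneg hr _ _)
          rcases hp (x j) with h0 | ⟨h1, h2⟩
          · rw [h0, NNReal.coe_zero]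
            split_ifs <;> simp
          · rw [h1, if_pos, mul_one]
            rw [div_le_iff₀' hs, ← hx]
            exact_mod_cast h2
      _ ≤ p * (p / s)⁻¹ := by
          rw [← Finset.mul_sum]
          exact mul_le_mul_of_nonneg_left (sum_erLaw_ge_le hr (div_pos hp0 hs)) hp0.le
      _ = s := by field_simp

/-- The expected minimum of two independent bids that follow the equal-revenue law. -/
theorem sum_erLaw_min (hr : 1 < r) :
    ∑ i : Fin (J + 1), erLaw r J 0 i * ∑ j : Fin (J + 1), erLaw r J 0 j *
      r ^ min (i : ℕ) (j : ℕ) = 1 + r⁻¹ * (1 - r⁻¹ ^ J) := by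
  have hr0 : r ≠ 0 := by positivity
  have hpow : ∀ l, (r ^ (l + 1) - r ^ l) * r⁻¹ ^ (l + 1) = 1 - r⁻¹ := fun l => by
    rw [inv_pow, pow_succ]; field_simp
  have h1 : ∀ i : Fin (J + 1), ∑ j : Fin (J + 1), erLaw r J 0 j * r ^ min (i : ℕ) (j : ℕ) =
      1 + (i : ℕ) * (1 - r⁻¹) := by
    intro i
    have hi : (i : ℕ) ≤ J := Nat.lt_succ_iff.mp i.isLt
    rw [sum_erLaw_mul r J fun l => r ^ min (i : ℕ) l, Nat.min_zero, pow_zero]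
    congr 1
    rw [← Finset.sum_subset (Finset.range_subset_range.mpr hi)]
    · rw [Finset.sum_congr rfl fun l hl => by
        have := Finset.mem_range.mp hl
        rw [min_eq_right (by omega : l + 1 ≤ (i : ℕ)), min_eq_right this.le, hpow]]
      rw [Finset.sum_const, Finset.card_range, nsmul_eq_mul]
    · intro l _ hl
      have : (i : ℕ) ≤ l := not_lt.mp fun h => hl (Finset.mem_range.mpr h)
      rw [min_eq_left (by omega : (i : ℕ) ≤ l + 1), min_eq_left this, sub_self, zero_mul]
  rw [Finset.sum_congr rfl fun i _ => by rw [h1 i],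
    sum_erLaw_mul r J fun l => 1 + (l : ℝ) * (1 - r⁻¹)]
  have h2 : ∀ l ∈ Finset.range J, ((1 + ((l + 1 : ℕ) : ℝ) * (1 - r⁻¹)) - (1 + (l : ℝ) * (1 - r⁻¹))) *
      r⁻¹ ^ (l + 1) = r⁻¹ * ((r⁻¹ ^ l) * (1 - r⁻¹)) := fun l _ => by
    push_cast
    ring
  rw [Finset.sum_congr rfl h2, ← Finset.mul_sum, ← Finset.sum_mul, geom_sum_mul_neg]
  simp

variable (A : OnlineAuction)

/-- The expected payment of the first bidder. -/
noncomputable def firstPayment (z : ℝ≥0) : ℝ :=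
  ∫ ω, ((((A.det ω).decision 0 Fin.elim0 z).payment : ℝ≥0) : ℝ) ∂A.P

/-- The expected payment of the second bidder, who bids `z`, when the first bidder bids `y`. -/
noncomputable def secondPayment (y z : ℝ≥0) : ℝ :=
  ∫ ω, ((((A.det ω).decision 1 (fun _ => y) z).payment : ℝ≥0) : ℝ) ∂A.P

theorem measurable_payment_real (k : ℕ) (h : Fin k → ℝ≥0) (z : ℝ≥0) :
    Measurable fun ω => ((((A.det ω).decision k h z).payment : ℝ≥0) : ℝ) :=
  measurable_coe_nnreal_real.comp (A.measurable_payment k h z)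

theorem integrable_payment (k : ℕ) (h : Fin k → ℝ≥0) (z : ℝ≥0) :
    Integrable (fun ω => ((((A.det ω).decision k h z).payment : ℝ≥0) : ℝ)) A.P := by
  refine Integrable.of_bound (measurable_payment_real A k h z).aestronglyMeasurable z
    (Eventually.of_forall fun ω => ?_)
  rw [Real.norm_of_nonneg (NNReal.coe_nonneg _)]
  exact_mod_cast payment_le (A.det ω) k h z

theorem expectedRevenue_two (b : Fin 2 → ℝ≥0) : A.expectedRevenue b =
    (firstPayment A (b 0) + secondPayment A (b 0) (b 1) +
      (firstPayment A (b 1) + secondPayment A (b 1) (b 0))) / 2 := by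
  have hrev : ∀ c : Fin 2 → ℝ≥0, ∫ ω, (((A.det ω).revenue c : ℝ≥0) : ℝ) ∂A.P =
      firstPayment A (c 0) + secondPayment A (c 0) (c 1) := by
    intro c
    rw [firstPayment, secondPayment, ← integral_add (integrable_payment A _ _ _)
      (integrable_payment A _ _ _)]
    refine integral_congr_ae (Eventually.of_forall fun ω => ?_)
    dsimp only
    rw [DetOnlineAuction.revenue, Fin.sum_univ_two, NNReal.coe_add]
    congr 4
    · exact Subsingleton.elim (α := Fin 0 → ℝ≥0) _ _
    · ext j
      have : (j : ℕ) = 0 := Nat.lt_one_iff.mp j.isLt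
      congr 2
      exact Fin.ext this
  have huniv : (Finset.univ : Finset (Equiv.Perm (Fin 2))) = {1, Equiv.swap 0 1} := by decide
  rw [OnlineAuction.expectedRevenue, huniv, Finset.sum_pair (by decide), hrev, hrev]
  simp

theorem min_le_maxV (b : Fin 2 → ℝ≥0) : min (b 0) (b 1) ≤ maxV b := by
  have h1 : (1 : Fin 2) ∈ Finset.univ.filter fun k : Fin 2 => 1 ≤ k.val := by decide
  refine le_trans ?_ (Finset.le_sup (f := fun k : Fin 2 => (k.val : ℝ≥0) * sortedBids b k) h1)
  have h2 : ∀ i, min (b 0) (b 1) ≤ b i := fun i => by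
    fin_cases i
    · exact min_le_left _ _
    · exact min_le_right _ _
  simpa only [sortedBids, Fin.val_one, Nat.cast_one, one_mul] using h2 _

variable {A}

theorem sum_firstPayment_ge (hr : 1 < r) {β : ℝ} (hA : A.IsCompetitive β) {s : ℝ} (hs : 0 < s)
    {x : ℕ → ℝ≥0} (hx : ∀ j, (x j : ℝ) = s * r ^ j) :
    s * (1 + r⁻¹ * (1 - r⁻¹ ^ J)) / β ≤
      ∑ i : Fin (J + 1), erLaw r J 0 i * firstPayment A (x i) + s := by
  have hβ := hA.1
  set p := erLaw r J 0 with hp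
  have hp0 : ∀ y, 0 ≤ p y := erLaw_nonneg hr 0
  have hp1 : ∑ y, p y = 1 := sum_erLaw hr (Nat.zero_le J)
  have hpair : ∀ i j : Fin (J + 1), s * r ^ min (i : ℕ) (j : ℕ) / β ≤
      (firstPayment A (x i) + secondPayment A (x i) (x j) +
        (firstPayment A (x j) + secondPayment A (x j) (x i))) / 2 := by
    intro i j
    have h1 := hA.2 2 ![x i, x j]
    have h2 := min_le_maxV ![x i, x j]
    rw [expectedRevenue_two] at h1
    simp only [Matrix.cons_val_zero, Matrix.cons_val_one] at h1 h2
    refine le_trans (div_le_div_of_nonneg_right ?_ hβ.le) h1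
    have h3 : ((min (x i) (x j) : ℝ≥0) : ℝ) ≤ (maxV ![x i, x j] : ℝ≥0) := by exact_mod_cast h2
    refine le_trans ?_ h3
    rw [NNReal.coe_min, hx, hx]
    refine le_min ?_ ?_ <;> refine mul_le_mul_of_nonneg_left (pow_le_pow_right₀ hr.le ?_) hs.le
    · exact min_le_left _ _
    · exact min_le_right _ _
  have hsecond : ∀ y, ∑ j : Fin (J + 1), p j * secondPayment A y (x j) ≤ s := by
    intro y
    simp only [secondPayment]
    simp only [← integral_const_mul]
    rw [← integral_finsetSum _ fun j _ => (integrable_payment A _ _ _).const_mul _]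
    have h1 := integral_mono (μ := A.P) (integrable_finsetSum Finset.univ
      fun (j : Fin (J + 1)) _ => (integrable_payment A 1 (fun _ => y) (x j)).const_mul (p j))
      (integrable_const s) fun ω => by
        simpa using sum_erLaw_payment_le (J := J) hr (A.det ω) 1 (fun _ => y) hs hx
    simpa using h1
  have hsum : ∑ i : Fin (J + 1), ∑ j : Fin (J + 1), p i * p j * (s * r ^ min (i : ℕ) (j : ℕ) / β) ≤
      ∑ i : Fin (J + 1), ∑ j : Fin (J + 1), p i * p j *
        ((firstPayment A (x i) + secondPayment A (x i) (x j) +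
        (firstPayment A (x j) + secondPayment A (x j) (x i))) / 2) :=
    Finset.sum_le_sum fun i _ => Finset.sum_le_sum fun j _ =>
      mul_le_mul_of_nonneg_left (hpair i j) (mul_nonneg (hp0 i) (hp0 j))
  have hleft : ∑ i : Fin (J + 1), ∑ j : Fin (J + 1), p i * p j *
      (s * r ^ min (i : ℕ) (j : ℕ) / β) = s * (1 + r⁻¹ * (1 - r⁻¹ ^ J)) / β := by
    rw [← sum_erLaw_min hr, Finset.mul_sum, Finset.sum_div]
    refine Finset.sum_congr rfl fun i _ => ?_
    rw [Finset.mul_sum, Finset.mul_sum, Finset.sum_div]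
    exact Finset.sum_congr rfl fun j _ => by ring
  set g : Fin (J + 1) → Fin (J + 1) → ℝ := fun i j =>
    p i * (firstPayment A (x i) * p j) + p i * (p j * secondPayment A (x i) (x j)) with hg
  have hright : ∑ i, ∑ j, p i * p j * ((firstPayment A (x i) + secondPayment A (x i) (x j) +
      (firstPayment A (x j) + secondPayment A (x j) (x i))) / 2) = ∑ i, ∑ j, g i j := by
    have h1 : ∀ i j : Fin (J + 1), p i * p j * ((firstPayment A (x i) +
        secondPayment A (x i) (x j) + (firstPayment A (x j) + secondPayment A (x j) (x i))) / 2) =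
        2⁻¹ * (g i j + g j i) := fun i j => by rw [hg]; ring
    simp only [h1, ← Finset.mul_sum, Finset.sum_add_distrib]
    rw [Finset.sum_comm (f := fun i j => g j i)]
    ring
  rw [hleft, hright] at hsum
  refine hsum.trans ?_
  simp only [hg, Finset.sum_add_distrib, ← Finset.mul_sum, hp1, mul_one]
  refine add_le_add_right ?_ _
  calc ∑ i : Fin (J + 1), p i * ∑ j : Fin (J + 1), p j * secondPayment A (x i) (x j)
      ≤ ∑ i : Fin (J + 1), p i * s :=
        Finset.sum_le_sum fun i _ => mul_le_mul_of_nonneg_left (hsecond _) (hp0 i)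
    _ = s := by rw [← Finset.sum_mul, hp1, one_mul]

/-- The first bidder pays a negligible fraction of a large bid. -/
theorem tendsto_firstPayment_div (c : ℝ≥0) :
    Tendsto (fun N : ℕ => firstPayment A (N * c) / N) atTop (𝓝 0) := by
  simp only [firstPayment, ← integral_div]
  have h := tendsto_integral_of_dominated_convergence (μ := A.P) (f := fun _ => (0 : ℝ))
    (F := fun (N : ℕ) ω => ((((A.det ω).decision 0 Fin.elim0 (N * c)).payment : ℝ≥0) : ℝ) / N)
    (fun _ => (c : ℝ)) (fun N => ((measurable_payment_real A 0 _ _).div_const _).aestronglyMeasurable)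
    (integrable_const _) (fun N => Eventually.of_forall fun ω => ?_)
    (Eventually.of_forall fun ω => ?_)
  · simpa using h
  · rw [Real.norm_of_nonneg (by positivity)]
    refine div_le_of_le_mul₀ (by positivity) c.coe_nonneg ?_
    have : (((A.det ω).decision 0 Fin.elim0 (N * c)).payment : ℝ) ≤ ((N * c : ℝ≥0) : ℝ) := by
      exact_mod_cast payment_le (A.det ω) 0 Fin.elim0 (N * c)
    rw [mul_comm (c : ℝ)]
    simpa using this
  · obtain ⟨p, hp⟩ := exists_price (A.det ω) 0 Fin.elim0
    refine squeeze_zero (fun N => by positivity) (fun N => ?_)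
      (tendsto_const_div_atTop_nhds_zero_nat (p : ℝ))
    refine div_le_div_of_nonneg_right ?_ (Nat.cast_nonneg N)
    rcases hp (N * c) with h0 | ⟨h1, -⟩
    · rw [h0]; simp
    · rw [h1]

theorem two_le_of_isCompetitive {β : ℝ} (hA : A.IsCompetitive β) : 2 ≤ β := by
  have hβ := hA.1
  have hJ : ∀ r : ℝ, 1 < r → ∀ J : ℕ, 1 + r⁻¹ * (1 - r⁻¹ ^ J) ≤ β := by
    intro r hr J
    have hr0 : 0 < r := by positivity
    have hlim : Tendsto (fun N : ℕ => ∑ i : Fin (J + 1), erLaw r J 0 i *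
        (firstPayment A (N * (r.toNNReal ^ (i : ℕ))) / N)) atTop (𝓝 0) := by
      have h := tendsto_finsetSum (Finset.univ : Finset (Fin (J + 1))) fun i _ =>
        (tendsto_firstPayment_div (A := A) (r.toNNReal ^ (i : ℕ))).const_mul (erLaw r J 0 i)
      simpa only [mul_zero, Finset.sum_const_zero] using h
    have hlim' := hlim.add_const 1
    rw [zero_add] at hlim'
    rw [← div_le_one hβ]
    refine ge_of_tendsto hlim' ?_
    filter_upwards [eventually_gt_atTop 0] with N hN
    have hN' : (0 : ℝ) < N := by exact_mod_cast hN
    have h1 := sum_firstPayment_ge (J := J) hr hA hN' (x := fun j => N * r.toNNReal ^ j)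
      fun j => by simp [hr0.le]
    have h2 : ∑ i : Fin (J + 1), erLaw r J 0 i *
        (firstPayment A (N * (r.toNNReal ^ (i : ℕ))) / N) = (∑ i : Fin (J + 1), erLaw r J 0 i *
        firstPayment A (N * (r.toNNReal ^ (i : ℕ)))) / N := by
      rw [Finset.sum_div]
      exact Finset.sum_congr rfl fun i _ => by ring
    rw [h2, div_add_one hN'.ne', le_div_iff₀ hN']
    calc _ = (N : ℝ) * (1 + r⁻¹ * (1 - r⁻¹ ^ J)) / β := by ring
      _ ≤ _ := h1
  have hr : ∀ r : ℝ, 1 < r → 1 + r⁻¹ ≤ β := by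
    intro r hr
    have h1 := tendsto_pow_atTop_nhds_zero_of_lt_one (r := r⁻¹) (by positivity)
      (inv_lt_one_of_one_lt₀ hr)
    have h2 : Tendsto (fun J : ℕ => 1 + r⁻¹ * (1 - r⁻¹ ^ J)) atTop (𝓝 (1 + r⁻¹ * (1 - 0))) :=
      ((h1.const_sub 1).const_mul r⁻¹).const_add 1
    rw [sub_zero, mul_one] at h2
    exact le_of_tendsto' h2 (hJ r hr)
  have hlim : Tendsto (fun r : ℝ => 1 + r⁻¹) (𝓝[>] 1) (𝓝 (1 + 1⁻¹)) :=
    (((continuousAt_inv₀ (one_ne_zero (α := ℝ))).tendsto).const_add 1).mono_left nhdsWithin_le_nhds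
  have := le_of_tendsto hlim (eventually_nhdsWithin_of_forall fun r hr' => hr r hr')
  norm_num at this
  exact this

theorem two_le_optimalOnlineRatio : 2 ≤ optimalOnlineRatio :=
  le_csInf ⟨_, exists_isCompetitive (lt_add_one _)⟩ fun _ ⟨_, hA⟩ => two_le_of_isCompetitive hA

end LowerBound

end RandomOrder

theorem mainTheorem6 :
    ∃ lam : ℝ, Tendsto offlineRatio atTop (𝓝 lam) ∧ 2.42 ≤ lam ∧ lam < 2.43 ∧
      2 ≤ optimalOnlineRatio ∧ optimalOnlineRatio ≤ lam := by
  obtain ⟨h1, h2⟩ := RandomOrder.limitExcess_bounds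
  refine ⟨1 + RandomOrder.limitExcess, RandomOrder.tendsto_offlineRatio, ?_, ?_,
    RandomOrder.two_le_optimalOnlineRatio, RandomOrder.optimalOnlineRatio_le⟩
  · norm_num at h1 ⊢
    linarith
  · norm_num at h2 ⊢
    linarith
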